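/- **Definitions.** For $Z\subseteq\mathbb N$, a set $B\subseteq\mathbb N$ is *$Z$-hyperimmune* if it is infinite and its principal function $p_B$ ($p_B(n)$ is the $n$-th element of $B$ in increasing order, starting with $n=0$) is not dominated by any $Z$-computable function. A $\Pi^1_2$-statement $\mathsf P$ of the form "for every instance $X$ there is a solution $Y$ to $X$" (with $X,Y\subseteq\mathbb N$) *admits preservation of hyperimmunity* if for every set $Z$, every sequence $A_0,A_1,\dots$ of $Z$-hyperimmune sets and every $\mathsf P$-instance $X\le_T Z$, there is a solution $Y$ to $X$ such that every $A_i$ is $(Y\oplus Z)$-hyperimmune. A *largeness notion* is a collection $L$ of finite subsets of $\mathbb N$, closed under finite supersets, such that every infinite set has a finite subset in $L$. For a coloring $f:[\mathbb N]^2\to 2$, an *infinite $L$-grouping* for $f$ is an infinite sequence $F_0<F_1<\cdots$ of nonempty finite sets in $L$ (where $F<G$ means that every element of $F$ is smaller than every element of $G$) such that for all $i<j$ the coloring $f$ is constant on $F_i\times F_j$. $\mathrm{GP}^2_2$ states that for every largeness notion $L$, every $f:[\mathbb N]^2\to2$ has an infinite $L$-grouping. The coloring $f$ is *stable* if $\lim_y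 f(x,y)$ exists for every $x$, and $\mathrm{SGP}^2_2$ is the restriction of $\mathrm{GP}^2_2$ to stable colorings. As a problem, an instance of $\mathrm{SGP}^2_2$ is (a set coding) a pair $\langle L,f\rangle$ of an arbitrary collection $L$ of finite sets and a stable coloring $f$; a solution is (a set coding) either an infinite $L$-grouping for $f$ or an infinite set with no nonempty finite subset in $L$ (a witness that $L$ is not a largeness notion; if $L$ is closed under finite supersets, "nonempty" makes no difference). $\mathrm{COH}$ states that for every sequence of sets $R_0,R_1,\dots$ (coded by one set) there is an infinite set $C$ such that for each $i$, all but finitely many elements of $C$ are in $R_i$ or all but finitely many are in its complement. A coloring $f:[\mathbb N]^2\to2$ is *transitive* on $H$ if for all $x<y<z$ in $H$ with $f(x,y)=f(y,z)$ we have $f(x,z)=f(x,y)$. $\mathrm{EM}$ (Erdős–Moser) states that every coloring $f:[\mathbb N]^2\to2$ is transitive on some infinite set. $\mathrm{ADS}$ (ascending descending sequence) states that every transitive coloring $f:[\mathbb N]^2\to2$ (on $\mathbb N$) has an infinite homogeneous set, i.e. an infinite set on whose pairs $f$ is constant. $\mathsf{WKL_0}$ is $\mathsf{RCA_0}$ plus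 weak König's lemma: every infinite binary tree has an infinite path. $\mathsf{RCA_0}$ is the theory in second-order arithmetic of the basic axioms of arithmetic, $\Sigma^0_1$-induction and $\Delta^0_1$-comprehension; its models are structures $(M,S)$ with $S$ a nonempty family of subsets of $M$. **Theorem.** 1. $\mathrm{SGP}^2_2$ admits preservation of hyperimmunity. 2. $\mathsf{RCA_0}+\mathrm{GP}^2_2+\mathrm{COH}+\mathrm{EM}+\mathsf{WKL_0}$ does not imply $\mathrm{ADS}$; that is, not every model $(M,S)$ of $\mathsf{RCA_0}+\mathrm{GP}^2_2+\mathrm{COH}+\mathrm{EM}+\mathsf{WKL_0}$ is a model of $\mathrm{ADS}$. -/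

import Mathlib

namespace RevMath

/-! ## Relative computability, hyperimmunity, preservation of hyperimmunity -/

/-- The characteristic function of a set of natural numbers, as an oracle. -/
noncomputable def chi (Z : Set ℕ) : ℕ → ℕ := Set.indicator Z 1

/-- The function `g` is computable from the set `Z`. -/
def ComputableFrom (Z : Set ℕ) (g : ℕ → ℕ) : Prop :=
  ComputableIn {((chi Z : ℕ → ℕ) : ℕ →. ℕ)} g

/-- Turing reducibility `X ≤_T Z` between sets. -/
def TuringLE (X Z : Set ℕ) : Prop := ComputableFrom Z (chi X)

/-- The join `Y ⊕ Z`. -/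
def join (Y Z : Set ℕ) : Set ℕ :=
  {n | (∃ y ∈ Y, n = 2 * y) ∨ (∃ z ∈ Z, n = 2 * z + 1)}

/-- `B` is `Z`-hyperimmune: it is infinite, and its principal function (whose value at `n` is the
`n`-th element of `B` in increasing order) is not dominated by any `Z`-computable function. -/
def Hyperimmune (Z B : Set ℕ) : Prop :=
  B.Infinite ∧ ∀ g : ℕ → ℕ, ComputableFrom Z g →
    ¬ ∀ᶠ n in Filter.atTop, Nat.nth (· ∈ B) n ≤ g n

/-- A `Π¹₂`-statement "for every instance `X` there is a solution `Y` to `X`", seen as a problem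
whose instances and solutions are sets of natural numbers. -/
structure Problem where
  /-- `X` is an instance. -/
  Inst : Set ℕ → Prop
  /-- `Y` is a solution to the instance `X`. -/
  Sol : Set ℕ → Set ℕ → Prop

/-- The problem `P` admits preservation of hyperimmunity. -/
def Problem.PreservesHyperimmunity (P : Problem) : Prop :=
  ∀ (Z : Set ℕ) (A : ℕ → Set ℕ), (∀ i, Hyperimmune Z (A i)) →
    ∀ X : Set ℕ, P.Inst X → TuringLE X Z →
      ∃ Y : Set ℕ, P.Sol X Y ∧ ∀ i, Hyperimmune (join Y Z) (A i)

/-! ## The stable grouping principle for pairs and two colors, as a problem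

A coloring of `[ℕ]²` is given by a function `f : ℕ → ℕ → Fin 2` of which only the values `f x y`
with `x < y` matter. -/

/-- `f` is stable: `lim_y f(x, y)` exists for every `x`. -/
def Stable (f : ℕ → ℕ → Fin 2) : Prop :=
  ∀ x, ∃ c, ∀ᶠ y in Filter.atTop, f x y = c

/-- `F 0 < F 1 < ⋯` is an infinite `L`-grouping for `f`. (The blocks are required to be nonempty,
which makes the family really infinite.) -/
def IsGrouping (L : Set (Finset ℕ)) (f : ℕ → ℕ → Fin 2) (F : ℕ → Finset ℕ) : Prop :=
  (∀ i, F i ∈ L ∧ (F i).Nonempty) ∧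
  (∀ i j, i < j → ∀ x ∈ F i, ∀ y ∈ F j, x < y) ∧
  (∀ i j, i < j → ∃ c : Fin 2, ∀ x ∈ F i, ∀ y ∈ F j, f x y = c)

/-- `W` witnesses that `L` is not a largeness notion: `W` is infinite and has no (nonempty) finite
subset in `L`. If `L` is closed under finite supersets, the word "nonempty" makes no difference. -/
def NotLargeWitness (L : Set (Finset ℕ)) (W : Set ℕ) : Prop :=
  W.Infinite ∧ ∀ F ∈ L, F.Nonempty → ¬ (F : Set ℕ) ⊆ W

/-- The canonical index (binary expansion) of a finite set. -/
def finCode (F : Finset ℕ) : ℕ := ∑ x ∈ F, 2 ^ x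

/-- The pair `⟨L, f⟩` as a set of natural numbers. -/
def instCode (L : Set (Finset ℕ)) (f : ℕ → ℕ → Fin 2) : Set ℕ :=
  join (finCode '' L) {n | ∃ x y, x < y ∧ f x y = 1 ∧ n = Nat.pair x y}

/-- The sequence `⟨F 0, F 1, …⟩` as a set of natural numbers. -/
def seqCode (F : ℕ → Finset ℕ) : Set ℕ := {n | ∃ i, n = Nat.pair i (finCode (F i))}

/-- The problem `SGP²₂`. An instance is a pair `⟨L, f⟩` of a collection `L` of finite sets and a
stable coloring `f : [ℕ]² → 2`; a solution is either an infinite `L`-grouping for `f` or an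
infinite set witnessing that `L` is not a largeness notion. -/
def SGP22 : Problem where
  Inst X := ∃ L f, Stable f ∧ X = instCode L f
  Sol X Y := ∃ L f, X = instCode L f ∧
    ((∃ F, IsGrouping L f F ∧ Y = seqCode F) ∨ NotLargeWitness L Y)

/-! ## Second-order arithmetic -/

/-- A structure `(M, S)` for the language of second-order arithmetic. -/
structure L2Structure where
  /-- The first-order part. -/
  M : Type
  [zero : Zero M]
  [one : One M]
  [add : Add M]
  [mul : Mul M]
  [lt : LT M]
  /-- The second-order part. -/
  S : Set (Set M)
  S_nonempty : S.Nonempty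

attribute [instance] L2Structure.zero L2Structure.one L2Structure.add L2Structure.mul
  L2Structure.lt

/-- Number terms of the language of second-order arithmetic; `var i` is the number variable
`xᵢ`. -/
inductive L2Term where
  | var (i : ℕ)
  | zero
  | one
  | add (s t : L2Term)
  | mul (s t : L2Term)

/-- Bounded (`Σ⁰₀`) formulas. `mem t j` is `t ∈ Xⱼ` for the set variable `Xⱼ`, and `ball i t φ` is
`∀ xᵢ < t, φ`, where `t` is evaluated before `xᵢ` is bound. -/
inductive BddFormula where
  | eq (s t : L2Term)
  | lt (s t : L2Term)
  | mem (t : L2Term) (j : ℕ)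
  | neg (φ : BddFormula)
  | and (φ ψ : BddFormula)
  | ball (i : ℕ) (t : L2Term) (φ : BddFormula)

namespace L2Structure

variable (N : L2Structure)

/-- The value of a term under an assignment of the number variables. -/
def termVal (v : ℕ → N.M) : L2Term → N.M
  | .var i => v i
  | .zero => 0
  | .one => 1
  | .add s t => termVal v s + termVal v t
  | .mul s t => termVal v s * termVal v t

/-- Satisfaction of bounded formulas under an assignment of number and set variables. -/
def Sat (V : ℕ → Set N.M) : (ℕ → N.M) → BddFormula → Prop
  | v, .eq s t => N.termVal v s = N.termVal v t
  | v, .lt s t => N.termVal v s < N.termVal v t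
  | v, .mem t j => N.termVal v t ∈ V j
  | v, .neg φ => ¬ Sat V v φ
  | v, .and φ ψ => Sat V v φ ∧ Sat V v ψ
  | v, .ball i t φ => ∀ a : N.M, a < N.termVal v t → Sat V (Function.update v i a) φ

/-- The assignment `v` with `x₀ := a` and `x₁ := b`. -/
def assign (v : ℕ → N.M) (a b : N.M) : ℕ → N.M :=
  Function.update (Function.update v 0 a) 1 b

/-- The truth at `x₀ := a` of the `Σ⁰₁`-formula `∃ x₁ θ`. -/
def SatSigma (V : ℕ → Set N.M) (v : ℕ → N.M) (θ : BddFormula) (a : N.M) : Prop :=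
  ∃ b, N.Sat V (N.assign v a b) θ

/-- The truth at `x₀ := a` of the `Π⁰₁`-formula `∀ x₁ θ`. -/
def SatPi (V : ℕ → Set N.M) (v : ℕ → N.M) (θ : BddFormula) (a : N.M) : Prop :=
  ∀ b, N.Sat V (N.assign v a b) θ

/-- The basic axioms of arithmetic. -/
def BasicAxioms : Prop :=
  (∀ n : N.M, n + 1 ≠ 0) ∧
  (∀ m n : N.M, m + 1 = n + 1 → m = n) ∧
  (∀ m : N.M, m + 0 = m) ∧
  (∀ m n : N.M, m + (n + 1) = (m + n) + 1) ∧
  (∀ m : N.M, m * 0 = 0) ∧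
  (∀ m n : N.M, m * (n + 1) = m * n + m) ∧
  (∀ m : N.M, ¬ m < 0) ∧
  (∀ m n : N.M, m < n + 1 ↔ m < n ∨ m = n)

/-- The `Σ⁰₁`-induction scheme (with parameters). -/
def SigmaInduction : Prop :=
  ∀ (θ : BddFormula) (v : ℕ → N.M) (V : ℕ → Set N.M), (∀ j, V j ∈ N.S) →
    N.SatSigma V v θ 0 → (∀ n, N.SatSigma V v θ n → N.SatSigma V v θ (n + 1)) →
      ∀ n, N.SatSigma V v θ n

/-- The `Δ⁰₁`-comprehension scheme (with parameters). -/
def DeltaComprehension : Prop :=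
  ∀ (θ η : BddFormula) (v : ℕ → N.M) (V : ℕ → Set N.M), (∀ j, V j ∈ N.S) →
    (∀ n, N.SatSigma V v θ n ↔ N.SatPi V v η n) →
      {n | N.SatSigma V v θ n} ∈ N.S

/-- `(M, S)` is a model of `RCA₀`. -/
def RCA0 : Prop := N.BasicAxioms ∧ N.SigmaInduction ∧ N.DeltaComprehension

variable {N}

/-! ### Coding inside a structure -/

/-- `X` is infinite, that is, unbounded in `M`. -/
def Unbdd (X : Set N.M) : Prop := ∀ b : N.M, ∃ x ∈ X, b < x

/-- The pairing `(x + y)² + x`. -/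
def pair (x y : N.M) : N.M := (x + y) * (x + y) + x

/-- `x` belongs to the finite set coded by `c`: we have `c = ⟨k, ⟨m, n⟩⟩`, `x < k`, and
`m (x + 1) + 1` divides `n`. -/
def InCode (x c : N.M) : Prop :=
  ∃ k m n q : N.M, c = pair k (pair m n) ∧ x < k ∧ n = q * (m * (x + 1) + 1)

/-- `c` is the canonical, that is least, code of the finite set that it codes. The finite sets of
the structure are identified with their canonical codes. -/
def IsFin (c : N.M) : Prop := ∀ d : N.M, d < c → ¬ ∀ x : N.M, InCode x d ↔ InCode x c

/-- The finite set `c` is in the collection `L` of finite sets. -/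
def Large (L : Set N.M) (c : N.M) : Prop := IsFin c ∧ c ∈ L

/-- `L` is a largeness notion in the sense of the structure: every infinite set of the structure
has a finite subset in `L`, and `L` is closed under (finite) supersets. -/
def IsLargeness (L : Set N.M) : Prop :=
  (∀ X ∈ N.S, Unbdd X → ∃ c, Large L c ∧ ∀ x, InCode x c → x ∈ X) ∧
  (∀ c d : N.M, Large L c → IsFin d → (∀ x, InCode x c → InCode x d) → Large L d)

/-- The color of the pair `x < y` in the coloring of `[M]²` coded by the set `f`: the color is `1`
if this holds and `0` otherwise. -/
def Color (f : Set N.M) (x y : N.M) : Prop := pair x y ∈ f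

/-- `Y` codes an infinite `L`-grouping `F₀ < F₁ < ⋯` for the coloring `f`, as the graph of the
function sending `i` to the code of `Fᵢ`. -/
def CodesGrouping (L f Y : Set N.M) : Prop :=
  (∀ i : N.M, ∃! c, pair i c ∈ Y) ∧
  (∀ i c : N.M, pair i c ∈ Y → Large L c ∧ ∃ x, InCode x c) ∧
  (∀ i j c d : N.M, i < j → pair i c ∈ Y → pair j d ∈ Y →
    (∀ x y, InCode x c → InCode y d → x < y) ∧
    ((∀ x y, InCode x c → InCode y d → Color f x y) ∨
      (∀ x y, InCode x c → InCode y d → ¬ Color f x y)))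

/-- The coloring `f` is transitive on `H`. -/
def TransOn (f H : Set N.M) : Prop :=
  ∀ x ∈ H, ∀ y ∈ H, ∀ z ∈ H, x < y → y < z →
    (Color f x y → Color f y z → Color f x z) ∧
    (¬ Color f x y → ¬ Color f y z → ¬ Color f x z)

/-- `H` is homogeneous for the coloring `f`. -/
def Homogeneous (f H : Set N.M) : Prop :=
  (∀ x ∈ H, ∀ y ∈ H, x < y → Color f x y) ∨ (∀ x ∈ H, ∀ y ∈ H, x < y → ¬ Color f x y)

/-- `s` codes a finite binary string: `s = ⟨ℓ, c⟩`, where `ℓ` is the length and `c` is the finite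
set of the positions below `ℓ` at which the string has the value `1`. -/
def IsString (s : N.M) : Prop :=
  ∃ l c : N.M, s = pair l c ∧ IsFin c ∧ ∀ x, InCode x c → x < l

/-- `T` is (the set of codes of) a binary tree: a set of finite binary strings closed under initial
segments. -/
def IsTree (T : Set N.M) : Prop :=
  (∀ s ∈ T, IsString s) ∧
  (∀ l c l' c' : N.M, pair l c ∈ T → l' < l → IsFin c' →
    (∀ x, InCode x c' ↔ InCode x c ∧ x < l') → pair l' c' ∈ T)

/-- The set `P` (through its characteristic function) is a path through the tree `T`: each of its
initial segments is in `T`. -/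
def IsPath (P T : Set N.M) : Prop :=
  ∀ l : N.M, ∃ c : N.M, IsFin c ∧ (∀ x, InCode x c ↔ x ∈ P ∧ x < l) ∧ pair l c ∈ T

variable (N)

/-! ### The principles, as properties of a structure `(M, S)` -/

/-- `(M, S) ⊨ GP²₂`: for any largeness notion `L`, every coloring of pairs with two colors has an
infinite `L`-grouping. -/
def GP22 : Prop := ∀ L ∈ N.S, IsLargeness L → ∀ f ∈ N.S, ∃ Y ∈ N.S, CodesGrouping L f Y

/-- `(M, S) ⊨ COH`: every sequence of sets `Rᵢ = {x | ⟨i, x⟩ ∈ R}` has an infinite cohesive set. -/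
def COH : Prop :=
  ∀ R ∈ N.S, ∃ C ∈ N.S, Unbdd C ∧ ∀ i : N.M,
    (∃ b : N.M, ∀ x ∈ C, b < x → pair i x ∈ R) ∨ (∃ b : N.M, ∀ x ∈ C, b < x → pair i x ∉ R)

/-- `(M, S) ⊨ EM`: every coloring of pairs with two colors is transitive on some infinite set. -/
def EM : Prop := ∀ f ∈ N.S, ∃ H ∈ N.S, Unbdd H ∧ TransOn f H

/-- `(M, S) ⊨ ADS`: every transitive coloring of pairs with two colors has an infinite homogeneous
set. -/
def ADS : Prop := ∀ f ∈ N.S, TransOn f Set.univ → ∃ H ∈ N.S, Unbdd H ∧ Homogeneous f H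

/-- `(M, S)` satisfies weak König's lemma: every infinite binary tree has a path. -/
def WKL : Prop := ∀ T ∈ N.S, IsTree T → Unbdd T → ∃ P ∈ N.S, IsPath P T

end L2Structure

end RevMath

/-! Every principle in question except `ADS` can be solved while countably many given sets stay
hyperimmune; `ADS` cannot.

For part 1, a grouping is built by a Mathias-like forcing with conditions `(σ, X)`: `σ` lists the
blocks chosen so far and `X` is an infinite reservoir relative to which every `A i` remains
hyperimmune. A new block must be homogeneous for the set `B` of points with limit color 1, and `B`
need not be computable. The remedy is to put each question to all two-colorings `C` at once
(`forcing_dichotomy`). If for every `n` each `C` admits a `C`-homogeneous extension giving a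
functional a value at `n`, compactness yields an enumerable bound for such values; hyperimmunity of
`A i` beats the bound at some `n`, and taking `C = B` gives a legal extension. Otherwise, for some
`n`, the colorings without such an extension form a nonempty `Π⁰₁` class. The hyperimmune-free basis
theorem (`hyperimmuneFree_basis`) picks a harmless member `C`, and an infinite `C`-monochromatic
part of `X` is a reservoir that keeps the functional undefined at `n`. The same trick finds
homogeneous blocks in `L`, or else an infinite set without any (`Good.exists_grouping`).

`EM` and `COH` come from the same generic construction (`exists_generic`,
`Good.exists_transitive_cohesive`), and `WKL` from the basis theorem. Since a coloring is stable on
a set that is cohesive for its rows, only stable colorings need attention.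

Against `ADS` stands a generic `t : ℕ → ℚ` such that both the lower part of the induced order and
its complement are hyperimmune relative to the order (`exists_generic_order`). An infinite
homogeneous set for `t x < t y` is contained in one of the two, whereas a `Z`-hyperimmune set has no
infinite `Z`-computable subset. Iterating the preservation results from this order gives a Turing
ideal (`exists_closed_ideal`) whose `ω`-model satisfies everything but `ADS`. -/

namespace RevMath

attribute [fun_prop] Primrec Primrec.comp Primrec.const Primrec.fst Primrec.snd Primrec.pair Primrec.id

/-! ### Closure properties of primitive recursive functions and predicates. -/

section PrimrecClosure

variable {α β γ : Type} [Primcodable α] [Primcodable β] [Primcodable γ]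

@[fun_prop]
theorem primrec_add {f g : α → ℕ} (hf : Primrec f) (hg : Primrec g) :
    Primrec (fun a => f a + g a) := Primrec.nat_add.comp hf hg

@[fun_prop]
theorem primrec_mul {f g : α → ℕ} (hf : Primrec f) (hg : Primrec g) :
    Primrec (fun a => f a * g a) := Primrec.nat_mul.comp hf hg

@[fun_prop]
theorem primrec_div {f g : α → ℕ} (hf : Primrec f) (hg : Primrec g) :
    Primrec (fun a => f a / g a) := Primrec.nat_div.comp hf hg

@[fun_prop]
theorem primrec_mod {f g : α → ℕ} (hf : Primrec f) (hg : Primrec g) :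
    Primrec (fun a => f a % g a) := Primrec.nat_mod.comp hf hg

@[fun_prop]
theorem primrec_pow {f g : α → ℕ} (hf : Primrec f) (hg : Primrec g) :
    Primrec (fun a => f a ^ g a) :=
  (Primrec₂.unpaired'.1 Nat.Primrec.pow).comp hf hg

@[fun_prop]
theorem primrec_natPair {f g : α → ℕ} (hf : Primrec f) (hg : Primrec g) :
    Primrec (fun a => Nat.pair (f a) (g a)) := Primrec₂.natPair.comp hf hg

@[fun_prop]
theorem primrec_natUnpair {f : α → ℕ} (hf : Primrec f) :
    Primrec (fun a => Nat.unpair (f a)) := Primrec.unpair.comp hf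

@[fun_prop]
theorem primrec_length {f : α → List β} (hf : Primrec f) :
    Primrec (fun a => (f a).length) := Primrec.list_length.comp hf

@[fun_prop]
theorem primrec_append {f g : α → List β} (hf : Primrec f) (hg : Primrec g) :
    Primrec (fun a => f a ++ g a) := Primrec.list_append.comp hf hg

@[fun_prop]
theorem primrec_cons {f : α → β} {g : α → List β} (hf : Primrec f) (hg : Primrec g) :
    Primrec (fun a => f a :: g a) := Primrec.list_cons.comp hf hg

@[fun_prop]
theorem primrec_take {f : α → ℕ} {g : α → List β} (hf : Primrec f) (hg : Primrec g) :
    Primrec (fun a => (g a).take (f a)) := Primrec.list_take.comp hf hg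

@[fun_prop]
theorem primrec_getElem? {f : α → ℕ} {g : α → List β} (hf : Primrec f) (hg : Primrec g) :
    Primrec (fun a => (g a)[f a]?) := Primrec.list_getElem?.comp hg hf

@[fun_prop]
theorem primrec_getD {f : α → ℕ} {g : α → List β} {d : β} (hf : Primrec f) (hg : Primrec g) :
    Primrec (fun a => (g a).getD (f a) d) := (Primrec.list_getD d).comp hg hf

@[fun_prop]
theorem primrec_some {f : α → β} (hf : Primrec f) :
    Primrec (fun a => some (f a)) := Primrec.option_some.comp hf

@[fun_prop]
theorem primrec_decode {f : α → ℕ} (hf : Primrec f) :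
    Primrec (fun a => (Encodable.decode (f a) : Option β)) := Primrec.decode.comp hf

@[fun_prop]
theorem primrec_toList {f : α → Option β} (hf : Primrec f) :
    Primrec (fun a => (f a).toList) := Primrec.optionToList.comp hf

theorem primrecPred_eq {f g : α → β} (hf : Primrec f) (hg : Primrec g) :
    PrimrecPred (fun a => f a = g a) := Primrec.eq.comp hf hg
theorem primrecPred_lt {f g : α → ℕ} (hf : Primrec f) (hg : Primrec g) :
    PrimrecPred (fun a => f a < g a) := Primrec.nat_lt.comp hf hg
theorem primrecPred_le {f g : α → ℕ} (hf : Primrec f) (hg : Primrec g) :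
    PrimrecPred (fun a => f a ≤ g a) := Primrec.nat_le.comp hf hg

theorem primrecPred_comp {p : β → Prop} {f : α → β} (hp : PrimrecPred p) (hf : Primrec f) :
    PrimrecPred (fun a => p (f a)) := hp.comp hf

theorem primrecPred_exists_lt {p : α → ℕ → Prop} {n : α → ℕ} (hn : Primrec n)
    (hp : PrimrecPred (fun x : α × ℕ => p x.1 x.2)) : PrimrecPred (fun a => ∃ i < n a, p a i) :=
  (PrimrecRel.comp (PrimrecRel.exists_mem_list (R := fun (i : ℕ) (a : α) => p a i)
    (primrecPred_comp hp (f := fun x : ℕ × α => (x.2, x.1)) (by fun_prop)))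
    (Primrec.list_range.comp hn) Primrec.id).of_eq (by simp)

theorem primrecPred_forall_lt {p : α → ℕ → Prop} {n : α → ℕ} (hn : Primrec n)
    (hp : PrimrecPred (fun x : α × ℕ => p x.1 x.2)) : PrimrecPred (fun a => ∀ i < n a, p a i) :=
  (PrimrecRel.comp (PrimrecRel.forall_mem_list (R := fun (i : ℕ) (a : α) => p a i)
    (primrecPred_comp hp (f := fun x : ℕ × α => (x.2, x.1)) (by fun_prop)))
    (Primrec.list_range.comp hn) Primrec.id).of_eq (by simp)

theorem primrecPred_exists_mem {p : α → β → Prop} {w : α → List β} (hw : Primrec w)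
    (hp : PrimrecPred (fun x : α × β => p x.1 x.2)) : PrimrecPred (fun a => ∃ b ∈ w a, p a b) :=
  PrimrecRel.comp (PrimrecRel.exists_mem_list (R := fun i a => p a i)
    (primrecPred_comp hp (f := fun x : β × α => (x.2, x.1)) (by fun_prop))) hw Primrec.id

end PrimrecClosure

/-! ### Computable enumerability relative to a set -/

open Classical in
/-- The initial segment of length `s` of the characteristic function of `Z`. -/
noncomputable def pre (Z : Set ℕ) (s : ℕ) : List Bool := (List.range s).map fun i => decide (i ∈ Z)

@[simp] theorem length_pre (Z : Set ℕ) (s : ℕ) : (pre Z s).length = s := by simp [pre]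

theorem take_pre (Z : Set ℕ) {s t : ℕ} (h : s ≤ t) : (pre Z t).take s = pre Z s := by
  simp [pre, ← List.map_take, List.take_range, h]

theorem pre_prefix (Z : Set ℕ) {s t : ℕ} (h : s ≤ t) : pre Z s <+: pre Z t := by
  rw [← take_pre Z h]; exact List.take_prefix _ _

theorem pre_getElem?_true {Z : Set ℕ} {s i : ℕ} : (pre Z s)[i]? = some true ↔ i < s ∧ i ∈ Z := by
  by_cases h : i < s <;> simp [pre, h]

theorem pre_getElem?_false {Z : Set ℕ} {s i : ℕ} : (pre Z s)[i]? = some false ↔ i < s ∧ i ∉ Z := by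
  by_cases h : i < s <;> simp [pre, h]

theorem pre_congr {Y Z : Set ℕ} {s : ℕ} (h : ∀ i < s, i ∈ Y ↔ i ∈ Z) : pre Y s = pre Z s := by
  simp only [pre, List.map_inj_left, List.mem_range]
  intro i hi
  simp [h i hi]

/-- The right side is a bounded conjunction of membership and non-membership facts, hence enumerable
as soon as `Z` and its complement are. -/
theorem eq_pre_iff {Z : Set ℕ} {l : List Bool} : l = pre Z l.length ↔
    ∀ i < l.length, (l[i]? = some true ∧ i ∈ Z) ∨ (l[i]? = some false ∧ i ∉ Z) := by
  constructor
  · intro h i hi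
    rw [h]
    by_cases hz : i ∈ Z
    · exact Or.inl ⟨pre_getElem?_true.2 ⟨hi, hz⟩, hz⟩
    · exact Or.inr ⟨pre_getElem?_false.2 ⟨hi, hz⟩, hz⟩
  · intro h
    apply List.ext_getElem?
    intro i
    by_cases hi : i < l.length
    · rcases h i hi with ⟨h1, h2⟩ | ⟨h1, h2⟩
      · rw [h1, pre_getElem?_true.2 ⟨hi, h2⟩]
      · rw [h1, pre_getElem?_false.2 ⟨hi, h2⟩]
    · rw [List.getElem?_eq_none (by omega), List.getElem?_eq_none (by simp; omega)]

/-- The predicate `p` is computably enumerable relative to `Z`: membership is witnessed by a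
primitive recursive test on some initial segment of `Z`. -/
def CE (Z : Set ℕ) {α : Type} [Primcodable α] (p : α → Prop) : Prop :=
  ∃ R : α → List Bool → Prop, PrimrecPred (fun x : α × List Bool => R x.1 x.2) ∧
    (∀ a l l', l <+: l' → R a l → R a l') ∧ ∀ a, p a ↔ ∃ s, R a (pre Z s)

namespace CE

variable {Z : Set ℕ} {α β : Type} [Primcodable α] [Primcodable β]

theorem of_iff {p q : α → Prop} (hp : CE Z p) (h : ∀ a, q a ↔ p a) : CE Z q :=
  (funext fun a => propext (h a) : q = p) ▸ hp

theorem prim {p : α → Prop} (hp : PrimrecPred p) : CE Z p :=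
  ⟨fun a _ => p a, primrecPred_comp hp (by fun_prop), fun _ _ _ _ h => h, fun a => by simp⟩

theorem comp {p : β → Prop} {f : α → β} (hp : CE Z p) (hf : Primrec f) :
    CE Z (fun a => p (f a)) := by
  obtain ⟨R, h1, h2, h3⟩ := hp
  exact ⟨fun a l => R (f a) l,
    primrecPred_comp h1 (f := fun x : α × List Bool => (f x.1, x.2)) (by fun_prop),
    fun a => h2 (f a), fun a => h3 (f a)⟩

theorem and {p q : α → Prop} (hp : CE Z p) (hq : CE Z q) : CE Z (fun a => p a ∧ q a) := by
  obtain ⟨R, h1, h2, h3⟩ := hp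
  obtain ⟨Q, k1, k2, k3⟩ := hq
  refine ⟨fun a l => R a l ∧ Q a l, h1.and k1, fun a l l' h ⟨x, y⟩ => ⟨h2 a l l' h x, k2 a l l' h y⟩,
    fun a => ?_⟩
  change p a ∧ q a ↔ ∃ s, R a (pre Z s) ∧ Q a (pre Z s)
  rw [h3, k3]
  constructor
  · rintro ⟨⟨s, hs⟩, ⟨t, ht⟩⟩
    exact ⟨max s t, h2 _ _ _ (pre_prefix Z (le_max_left s t)) hs,
      k2 _ _ _ (pre_prefix Z (le_max_right s t)) ht⟩
  · rintro ⟨s, hs, ht⟩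
    exact ⟨⟨s, hs⟩, ⟨s, ht⟩⟩

theorem or {p q : α → Prop} (hp : CE Z p) (hq : CE Z q) : CE Z (fun a => p a ∨ q a) := by
  obtain ⟨R, h1, h2, h3⟩ := hp
  obtain ⟨Q, k1, k2, k3⟩ := hq
  refine ⟨fun a l => R a l ∨ Q a l, h1.or k1, fun a l l' h => Or.imp (h2 a l l' h) (k2 a l l' h),
    fun a => ?_⟩
  change p a ∨ q a ↔ ∃ s, R a (pre Z s) ∨ Q a (pre Z s)
  rw [h3, k3, exists_or]

theorem mem {f : α → ℕ} (hf : Primrec f) : CE Z (fun a => f a ∈ Z) := by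
  refine ⟨fun a l => l[f a]? = some true, primrecPred_eq (by fun_prop) (by fun_prop), ?_, ?_⟩
  · intro a l l' h e
    obtain ⟨t, rfl⟩ := h
    have := (List.getElem?_eq_some_iff.1 e).1
    exact (List.getElem?_append_left this).trans e
  · intro a
    simp only [pre_getElem?_true, exists_and_right]
    exact ⟨fun h => ⟨⟨_, Nat.lt_succ_self _⟩, h⟩, fun h => h.2⟩

theorem notMem {f : α → ℕ} (hf : Primrec f) : CE Z (fun a => f a ∉ Z) := by
  refine ⟨fun a l => l[f a]? = some false, primrecPred_eq (by fun_prop) (by fun_prop), ?_, ?_⟩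
  · intro a l l' h e
    obtain ⟨t, rfl⟩ := h
    have := (List.getElem?_eq_some_iff.1 e).1
    exact (List.getElem?_append_left this).trans e
  · intro a
    simp only [pre_getElem?_false, exists_and_right]
    exact ⟨fun h => ⟨⟨_, Nat.lt_succ_self _⟩, h⟩, fun h => h.2⟩

theorem ex {p : α → β → Prop} (hp : CE Z (fun x : α × β => p x.1 x.2)) :
    CE Z (fun a => ∃ b, p a b) := by
  obtain ⟨R, h1, h2, h3⟩ := hp
  -- The length of the prefix also bounds the code of the witness; this keeps the test both
  -- primitive recursive and monotone.
  refine ⟨fun a l => ∃ k < l.length, ∃ b ∈ (Encodable.decode k : Option β).toList, R (a, b) l,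
    ?_, ?_, ?_⟩
  · refine primrecPred_exists_lt (by fun_prop) (primrecPred_exists_mem (by fun_prop) ?_)
    exact primrecPred_comp h1
      (f := fun x : ((α × List Bool) × ℕ) × β => ((x.1.1.1, x.2), x.1.1.2)) (by fun_prop)
  · rintro a l l' h ⟨k, hk, b, hb, hR⟩
    exact ⟨k, hk.trans_le h.length_le, b, hb, h2 _ _ _ h hR⟩
  · intro a
    constructor
    · rintro ⟨b, hb⟩
      obtain ⟨s, hs⟩ := (h3 (a, b)).1 hb
      refine ⟨max s (Encodable.encode b + 1), Encodable.encode b, ?_, b, by simp, ?_⟩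
      · rw [length_pre]; omega
      · exact h2 _ _ _ (pre_prefix Z (le_max_left _ _)) hs
    · rintro ⟨s, k, _, b, _, hR⟩
      exact ⟨b, (h3 (a, b)).2 ⟨s, hR⟩⟩

theorem ball {p : α → ℕ → Prop} {n : α → ℕ} (hn : Primrec n)
    (hp : CE Z (fun x : α × ℕ => p x.1 x.2)) : CE Z (fun a => ∀ i < n a, p a i) := by
  obtain ⟨R, h1, h2, h3⟩ := hp
  refine ⟨fun a l => ∀ i < n a, R (a, i) l, ?_, ?_, ?_⟩
  · refine primrecPred_forall_lt (by fun_prop) ?_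
    exact primrecPred_comp h1
      (f := fun x : (α × List Bool) × ℕ => ((x.1.1, x.2), x.1.2)) (by fun_prop)
  · intro a l l' h hR i hi
    exact h2 _ _ _ h (hR i hi)
  · intro a
    constructor
    · intro h
      have : ∀ i, ∃ s, i < n a → R (a, i) (pre Z s) := fun i => by
        by_cases hi : i < n a
        · obtain ⟨s, hs⟩ := (h3 (a, i)).1 (h i hi)
          exact ⟨s, fun _ => hs⟩
        · exact ⟨0, fun h => absurd h hi⟩
      choose s hs using this
      refine ⟨(Finset.range (n a)).sup s, fun i hi => ?_⟩
      exact h2 _ _ _ (pre_prefix Z (Finset.le_sup (f := s) (Finset.mem_range.2 hi))) (hs i hi)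
    · rintro ⟨s, hs⟩ i hi
      exact (h3 (a, i)).2 ⟨s, hs i hi⟩

theorem ballMem {p : α → β → Prop} {w : α → List β} (hw : Primrec w)
    (hp : CE Z (fun x : α × β => p x.1 x.2)) : CE Z (fun a => ∀ b ∈ w a, p a b) := by
  have : CE Z (fun a => ∀ i < (w a).length, ∃ b, (w a)[i]? = some b ∧ p a b) := by
    refine ball (by fun_prop) (ex (and (prim (primrecPred_eq (by fun_prop) (by fun_prop))) ?_))
    exact hp.comp (f := fun x : (α × ℕ) × β => (x.1.1, x.2)) (by fun_prop)
  refine this.of_iff fun a => ?_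
  constructor
  · intro h i hi
    exact ⟨(w a)[i], by simp [hi], h _ (List.getElem_mem hi)⟩
  · intro h b hb
    obtain ⟨i, hi, rfl⟩ := List.getElem_of_mem hb
    obtain ⟨c, hc, hp⟩ := h i hi
    simp only [hi, List.getElem?_eq_getElem, Option.some.injEq] at hc
    exact hc ▸ hp

theorem const (p : Prop) : CE Z (fun _ : α => p) := by
  by_cases h : p
  · exact (prim (primrecPred_eq (Primrec.const (α := α) 0) (Primrec.const 0))).of_iff
      (fun a => by simp [h])
  · exact (prim (primrecPred_eq (Primrec.const (α := α) 0) (Primrec.const 1))).of_iff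
      (fun a => by simp [h])

/-- Predicates enumerable relative to sets that are uniformly decidable relative to `Z` are
enumerable relative to `Z`. -/
theorem exPre {W : α → Set ℕ} (h1 : CE Z (fun x : α × ℕ => x.2 ∈ W x.1))
    (h2 : CE Z (fun x : α × ℕ => x.2 ∉ W x.1)) {R : α → List Bool → Prop}
    (hR : CE Z (fun x : α × List Bool => R x.1 x.2)) :
    CE Z (fun a => ∃ s, R a (pre (W a) s)) := by
  -- The initial segment of `W a` is guessed as a list and verified bit by bit.
  have : CE Z (fun a => ∃ l : List Bool, (∀ i < l.length, (l[i]? = some true ∧ i ∈ W a) ∨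
      (l[i]? = some false ∧ i ∉ W a)) ∧ R a l) := by
    refine ex (and (ball (by fun_prop) (or (and ?_ ?_) (and ?_ ?_))) hR)
    · exact prim (primrecPred_eq (by fun_prop) (by fun_prop))
    · exact h1.comp (f := fun x : (α × List Bool) × ℕ => (x.1.1, x.2)) (by fun_prop)
    · exact prim (primrecPred_eq (by fun_prop) (by fun_prop))
    · exact h2.comp (f := fun x : (α × List Bool) × ℕ => (x.1.1, x.2)) (by fun_prop)
  refine this.of_iff fun a => ?_
  simp only [← eq_pre_iff]
  constructor
  · rintro ⟨s, hs⟩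
    exact ⟨pre (W a) s, by simp, hs⟩
  · rintro ⟨l, hl, hR⟩
    exact ⟨l.length, hl ▸ hR⟩

/-- Transitivity. -/
theorem trans {W : Set ℕ} (h1 : CE Z (· ∈ W)) (h2 : CE Z (· ∉ W)) {p : α → Prop} (hp : CE W p) :
    CE Z p := by
  obtain ⟨R, k1, k2, k3⟩ := hp
  refine (exPre (Z := Z) (W := fun _ : α => W) (h1.comp (f := Prod.snd) (by fun_prop))
    (h2.comp (f := Prod.snd) (by fun_prop)) (prim k1)).of_iff k3

end CE

end RevMath
namespace RevMath

/-! ### Comparison with oracle computability -/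

/-- By induction on the oracle computation. Primitive recursion is handled by guessing the list of
intermediate values, unbounded search by guessing a nonzero value at each smaller argument. -/
theorem CE.graph {Z : Set ℕ} {f : ℕ →. ℕ} (hf : Nat.RecursiveIn {((chi Z : ℕ → ℕ) : ℕ →. ℕ)} f) :
    CE Z (fun x : ℕ × ℕ => x.2 ∈ f x.1) := by
  induction hf with
  | zero =>
    exact (CE.prim (primrecPred_eq Primrec.snd (Primrec.const 0))).of_iff fun x => by
      exact Part.mem_some_iff
  | succ =>
    exact (CE.prim (primrecPred_eq Primrec.snd (Primrec.succ.comp Primrec.fst))).of_iff fun x => by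
      simp
  | left =>
    exact (CE.prim (primrecPred_eq (g := fun x : ℕ × ℕ => x.1.unpair.1) Primrec.snd
      (by fun_prop))).of_iff fun x => by exact Part.mem_some_iff
  | right =>
    exact (CE.prim (primrecPred_eq (g := fun x : ℕ × ℕ => x.1.unpair.2) Primrec.snd
      (by fun_prop))).of_iff fun x => by exact Part.mem_some_iff
  | oracle g hg =>
    rw [Set.mem_singleton_iff] at hg
    subst hg
    refine (CE.or (CE.and (CE.mem (f := fun x : ℕ × ℕ => x.1) (by fun_prop)) (CE.prim
      (primrecPred_eq Primrec.snd (Primrec.const 1)))) (CE.and (CE.notMem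
      (f := fun x : ℕ × ℕ => x.1) (by fun_prop)) (CE.prim
      (primrecPred_eq Primrec.snd (Primrec.const 0))))).of_iff fun x => ?_
    by_cases h : x.1 ∈ Z <;> simp [chi, h]
  | @pair f h _ _ ihf ihh =>
    have key : CE Z (fun x : ℕ × ℕ => ∃ y z, y ∈ f x.1 ∧ z ∈ h x.1 ∧ x.2 = Nat.pair y z) :=
      .ex (.ex (.and (ihf.comp (f := fun x : ((ℕ × ℕ) × ℕ) × ℕ => (x.1.1.1, x.1.2)) (by fun_prop))
        (.and (ihh.comp (f := fun x : ((ℕ × ℕ) × ℕ) × ℕ => (x.1.1.1, x.2)) (by fun_prop))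
        (.prim (primrecPred_eq (by fun_prop) (by fun_prop))))))
    refine key.of_iff fun x => ?_
    simp [Seq.seq, eq_comm]
  | @comp f h _ _ ihf ihh =>
    refine (CE.ex (p := fun (x : ℕ × ℕ) (z : ℕ) => z ∈ h x.1 ∧ x.2 ∈ f z) (CE.and
      (ihh.comp (f := fun x : (ℕ × ℕ) × ℕ => (x.1.1, x.2)) (by fun_prop))
      (ihf.comp (f := fun x : (ℕ × ℕ) × ℕ => (x.2, x.1.2)) (by fun_prop)))).of_iff fun x => ?_
    exact Part.mem_bind_iff
  | @prec f h _ _ ihf ihh =>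
    have key : CE Z (fun x : ℕ × ℕ => ∃ w : List ℕ, (∃ u, w[0]? = some u ∧ u ∈ f x.1.unpair.1) ∧
        (∀ i < x.1.unpair.2, ∃ y : ℕ × ℕ, w[i]? = some y.1 ∧ w[i + 1]? = some y.2 ∧
          y.2 ∈ h (Nat.pair x.1.unpair.1 (Nat.pair i y.1))) ∧ w[x.1.unpair.2]? = some x.2) := by
      refine .ex (.and (.ex (.and (.prim (primrecPred_eq (by fun_prop) (by fun_prop))) ?_))
        (.and (.ball (by fun_prop) (.ex (.and (.prim (primrecPred_eq (by fun_prop) (by fun_prop)))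
          (.and (.prim (primrecPred_eq (by fun_prop) (by fun_prop))) ?_))))
          (.prim (primrecPred_eq (by fun_prop) (by fun_prop)))))
      · exact ihf.comp (f := fun x : ((ℕ × ℕ) × List ℕ) × ℕ => (x.1.1.1.unpair.1, x.2))
          (by fun_prop)
      · exact ihh.comp (f := fun x : (((ℕ × ℕ) × List ℕ) × ℕ) × (ℕ × ℕ) =>
          (Nat.pair x.1.1.1.1.unpair.1 (Nat.pair x.1.2 x.2.1), x.2.2)) (by fun_prop)
    refine key.of_iff fun x => ?_
    obtain ⟨p, v⟩ := x
    simp only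
    generalize p.unpair.1 = a
    generalize p.unpair.2 = n
    induction n generalizing v with
    | zero =>
      constructor
      · intro hv
        exact ⟨[v], ⟨v, by simp, hv⟩, by simp, by simp⟩
      · rintro ⟨w, ⟨u, hu, huf⟩, -, hw⟩
        rw [hu, Option.some.injEq] at hw
        exact hw ▸ huf
    | succ n ih =>
      have hstep : v ∈ (Nat.rec (f a) (fun y IH => do
          let i ← IH
          h (Nat.pair a (Nat.pair y i))) (n + 1) : Part ℕ) ↔
          ∃ u, u ∈ (Nat.rec (f a) (fun y IH => do
          let i ← IH
          h (Nat.pair a (Nat.pair y i))) n : Part ℕ) ∧ v ∈ h (Nat.pair a (Nat.pair n u)) := by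
        simp
      refine hstep.trans ?_
      constructor
      · rintro ⟨u, hu, hv⟩
        obtain ⟨w, ⟨u0, h0, h0'⟩, h1, h2⟩ := (ih u).1 hu
        have hlen : n < w.length := (List.getElem?_eq_some_iff.1 h2).1
        -- The guessed list may be longer than needed, so it is truncated before the new value is
        -- appended.
        have htake : ∀ i ≤ n, (w.take (n + 1) ++ [v])[i]? = w[i]? := fun i hi => by
          rw [List.getElem?_append_left (by simp; omega), List.getElem?_take]
          simp; omega
        have hlast : (w.take (n + 1) ++ [v])[n + 1]? = some v := by
          rw [List.getElem?_append_right (by simp)]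
          simp [Nat.min_eq_left (Nat.succ_le_of_lt hlen)]
        refine ⟨w.take (n + 1) ++ [v], ⟨u0, by rw [htake 0 (by omega), h0], h0'⟩, fun i hi => ?_,
          hlast⟩
        rcases Nat.lt_succ_iff_lt_or_eq.1 hi with hi | rfl
        · obtain ⟨y, e1, e2, e3⟩ := h1 i hi
          exact ⟨y, by rw [htake i (by omega), e1], by rw [htake (i + 1) (by omega), e2], e3⟩
        · exact ⟨(u, v), by rw [htake i le_rfl, h2], hlast, hv⟩
      · rintro ⟨w, h0, h1, h2⟩
        obtain ⟨y, e1, e2, e3⟩ := h1 n (Nat.lt_succ_self n)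
        rw [h2, Option.some.injEq] at e2
        exact ⟨y.1, (ih y.1).2 ⟨w, h0, fun i hi => h1 i (by omega), e1⟩, e2 ▸ e3⟩
  | @rfind f _ ihf =>
    have key : CE Z (fun x : ℕ × ℕ => 0 ∈ f (Nat.pair x.1 x.2) ∧
        ∀ i < x.2, ∃ m, m ≠ 0 ∧ m ∈ f (Nat.pair x.1 i)) := by
      refine .and (ihf.comp (f := fun x : ℕ × ℕ => (Nat.pair x.1 x.2, 0)) (by fun_prop))
        (.ball (by fun_prop) (.ex (.and (.prim (PrimrecPred.not (primrecPred_eq (by fun_prop)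
          (by fun_prop)))) (ihf.comp (f := fun x : ((ℕ × ℕ) × ℕ) × ℕ =>
            (Nat.pair x.1.1.1 x.1.2, x.2)) (by fun_prop)))))
    refine key.of_iff fun x => ?_
    refine Nat.mem_rfind.trans ?_
    simp only [Part.map_eq_map, Part.mem_map_iff, decide_eq_true_eq, decide_eq_false_iff_not]
    constructor
    · rintro ⟨⟨m, hm, rfl⟩, h⟩
      exact ⟨hm, fun i hi => let ⟨m, a, b⟩ := h hi; ⟨m, b, a⟩⟩
    · rintro ⟨hm, h⟩
      exact ⟨⟨0, hm, rfl⟩, fun {i} hi => let ⟨m, a, b⟩ := h i hi; ⟨m, b, a⟩⟩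

theorem ComputableFrom.ce {Z : Set ℕ} {g : ℕ → ℕ} (hg : ComputableFrom Z g) :
    CE Z (fun x : ℕ × ℕ => g x.1 = x.2) := by
  refine (CE.graph (RecursiveIn.iff_nat.1 hg)).of_iff fun x => ?_
  rw [Part.mem_some_iff, eq_comm]

-- With prefixes of `Z` computable from `Z`, a primitive recursive test on prefixes can be run as an
-- oracle computation.
open Classical in
theorem recursiveIn_encode_pre (Z : Set ℕ) : Nat.RecursiveIn {((chi Z : ℕ → ℕ) : ℕ →. ℕ)}
    (fun s => Part.some (Encodable.encode (pre Z s))) := by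
  have hstep : Nat.Primrec (fun x : ℕ => Encodable.encode
      (((Encodable.decode x.unpair.1.unpair.2.unpair.2 : Option (List Bool)).getD []) ++
        [decide (x.unpair.2 = 1)])) := by
    refine Primrec.nat_iff.1 (Primrec.encode.comp ?_)
    refine primrec_append (Primrec.option_getD.comp (by fun_prop) (by fun_prop))
      (primrec_cons ?_ (by fun_prop))
    exact (Primrec.eq.comp (Primrec.snd.comp Primrec.unpair) (Primrec.const 1)).decide
  have horacle : Nat.RecursiveIn {((chi Z : ℕ → ℕ) : ℕ →. ℕ)}
      (fun x => Part.some (chi Z x.unpair.2.unpair.1)) := by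
    refine (Nat.RecursiveIn.comp (.oracle _ (Set.mem_singleton _)) (Nat.Primrec.recursiveIn
      (f := fun x => x.unpair.2.unpair.1) (Primrec.nat_iff.1 (by fun_prop)))).of_eq fun n => ?_
    exact Part.bind_some _ _
  have hh := Nat.RecursiveIn.comp (Nat.Primrec.recursiveIn hstep)
    (Nat.RecursiveIn.pair (Nat.Primrec.recursiveIn (O := {((chi Z : ℕ → ℕ) : ℕ →. ℕ)})
      Nat.Primrec.id) horacle)
  have hp := Nat.RecursiveIn.comp (Nat.RecursiveIn.prec (Nat.Primrec.recursiveIn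
    (Nat.Primrec.const (Encodable.encode ([] : List Bool)))) hh)
    (Nat.Primrec.recursiveIn (f := fun s => Nat.pair 0 s) (Primrec.nat_iff.1 (by fun_prop)))
  refine hp.of_eq fun n => ?_
  simp only [Part.coe_some, Part.bind_eq_bind, Part.bind_some, Nat.unpair_pair]
  induction n with
  | zero => simp [pre]
  | succ n ih =>
    simp only [ih]
    have h1 : decide (chi Z n = 1) = decide (n ∈ Z) := by
      by_cases h : n ∈ Z <;> simp [chi, h]
    simp [Seq.seq, h1, pre, List.range_succ]

/-- A total relation enumerable relative to `Z` has a `Z`-computable selector. -/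
theorem CE.exists_selector {Z : Set ℕ} {T : ℕ → ℕ → Prop} (hT : CE Z (fun x : ℕ × ℕ => T x.1 x.2))
    (htot : ∀ n, ∃ v, T n v) : ∃ g : ℕ → ℕ, ComputableFrom Z g ∧ ∀ n, T n (g n) := by
  obtain ⟨R, h1, -, h3⟩ := hT
  -- One number codes both the value and the length of the prefix confirming it, so a single
  -- unbounded search suffices.
  have htot' : ∀ n, ∃ k : ℕ, R (n, k.unpair.1) (pre Z k.unpair.2) := fun n => by
    obtain ⟨v, hv⟩ := htot n
    obtain ⟨s, hs⟩ := (h3 (n, v)).1 hv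
    exact ⟨Nat.pair v s, by simpa using hs⟩
  classical
  have hψ : Nat.Primrec (fun x : ℕ => if R (x.unpair.1.unpair.1, x.unpair.1.unpair.2.unpair.1)
      ((Encodable.decode x.unpair.2 : Option (List Bool)).getD []) then 0 else 1) := by
    refine Primrec.nat_iff.1 (Primrec.ite (primrecPred_comp h1 (f := fun x : ℕ =>
      ((x.unpair.1.unpair.1, x.unpair.1.unpair.2.unpair.1),
        ((Encodable.decode x.unpair.2 : Option (List Bool)).getD []))) ?_) (by fun_prop)
        (by fun_prop))
    exact Primrec.pair (by fun_prop) (Primrec.option_getD.comp (by fun_prop) (by fun_prop))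
  have hpre : Nat.RecursiveIn {((chi Z : ℕ → ℕ) : ℕ →. ℕ)}
      (fun x => Part.some (Encodable.encode (pre Z x.unpair.2.unpair.2))) := by
    refine (Nat.RecursiveIn.comp (recursiveIn_encode_pre Z) (Nat.Primrec.recursiveIn
      (f := fun x => x.unpair.2.unpair.2) (Primrec.nat_iff.1 (by fun_prop)))).of_eq fun n => ?_
    simp
  have hφ := Nat.RecursiveIn.rfind (Nat.RecursiveIn.comp (Nat.Primrec.recursiveIn hψ)
    (Nat.RecursiveIn.pair (Nat.Primrec.recursiveIn (O := {((chi Z : ℕ → ℕ) : ℕ →. ℕ)})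
      Nat.Primrec.id) hpre))
  have hg := Nat.RecursiveIn.comp Nat.RecursiveIn.left hφ
  refine ⟨fun n => (Nat.find (htot' n)).unpair.1, ?_, fun n => ?_⟩
  · refine RecursiveIn.iff_nat.2 (hg.of_eq_tot fun n => ?_)
    refine Part.mem_bind_iff.2 ⟨Nat.find (htot' n), ?_, Part.mem_some _⟩
    refine Nat.mem_rfind.2 ?_
    constructor
    · simpa [Seq.seq] using Nat.find_spec (htot' n)
    · intro m hm
      simpa [Seq.seq] using Nat.find_min (htot' n) hm
  · exact (h3 _).2 ⟨_, Nat.find_spec (htot' n)⟩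

/-- Post's theorem. It allows later reductions to be given by enumerations instead of programs. -/
theorem turingLE_iff {X Z : Set ℕ} : TuringLE X Z ↔ CE Z (· ∈ X) ∧ CE Z (· ∉ X) := by
  constructor
  · intro h
    refine ⟨(h.ce.comp (f := fun n : ℕ => (n, 1)) (by fun_prop)).of_iff fun n => ?_,
      (h.ce.comp (f := fun n : ℕ => (n, 0)) (by fun_prop)).of_iff fun n => ?_⟩ <;>
    by_cases h : n ∈ X <;> simp [chi, h]
  · rintro ⟨h1, h2⟩
    have hT : CE Z (fun x : ℕ × ℕ => (x.1 ∈ X ∧ x.2 = 1) ∨ (x.1 ∉ X ∧ x.2 = 0)) :=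
      .or (.and (h1.comp (f := Prod.fst) (by fun_prop)) (.prim (primrecPred_eq (by fun_prop)
        (by fun_prop)))) (.and (h2.comp (f := Prod.fst) (by fun_prop))
        (.prim (primrecPred_eq (by fun_prop) (by fun_prop))))
    obtain ⟨g, hg, h⟩ := hT.exists_selector (T := fun n v => (n ∈ X ∧ v = 1) ∨ (n ∉ X ∧ v = 0))
      fun n => by
        by_cases h : n ∈ X
        · exact ⟨1, by simp [h]⟩
        · exact ⟨0, by simp [h]⟩
    have : chi X = g := by
      funext n
      rcases h n with ⟨a, b⟩ | ⟨a, b⟩ <;> simp [chi, a, b]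
    rw [TuringLE, this]
    exact hg

theorem hyperimmune_iff {Z B : Set ℕ} : Hyperimmune Z B ↔ B.Infinite ∧
    ∀ T : ℕ → ℕ → Prop, CE Z (fun x : ℕ × ℕ => T x.1 x.2) → (∀ n, ∃ v, T n v) →
      ∃ n v, T n v ∧ v < Nat.nth (· ∈ B) n := by
  refine and_congr_right fun hB => ⟨fun h T hT htot => ?_, fun h g hg hdom => ?_⟩
  · obtain ⟨g, hg, hTg⟩ := hT.exists_selector htot
    have := h g hg
    contrapose! this
    exact Filter.Eventually.of_forall fun n => this n _ (hTg n)
  · obtain ⟨N, hN⟩ := Filter.eventually_atTop.1 hdom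
    -- Adding `p_B(N)` turns a function that dominates `p_B` from `N` on into one that bounds it
    -- everywhere, because `p_B` is monotone.
    set c := Nat.nth (· ∈ B) N with hc
    have hT : CE Z (fun x : ℕ × ℕ => ∃ u, g x.1 = u ∧ x.2 = u + c) :=
      .ex (.and (hg.ce.comp (f := fun x : (ℕ × ℕ) × ℕ => (x.1.1, x.2)) (by fun_prop))
        (.prim (primrecPred_eq (by fun_prop) (by fun_prop))))
    obtain ⟨n, v, ⟨u, rfl, rfl⟩, hv⟩ := h (fun n v => ∃ u, g n = u ∧ v = u + c) hT
      fun n => ⟨_, _, rfl, rfl⟩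
    rcases le_total N n with hn | hn
    · have := hN n hn
      omega
    · have : Nat.nth (· ∈ B) n ≤ Nat.nth (· ∈ B) N := Nat.nth_monotone hB hn
      omega

/-- Countability allows the functionals to be listed in one sequence of requirements; this list need
not be effective. -/
theorem countable_primrecPred (α : Type) [Primcodable α] :
    {p : α → Prop | PrimrecPred p}.Countable := by
  classical
  have : ∀ p : {p : α → Prop | PrimrecPred p}, ∃ c : Nat.Partrec.Code, ∀ a,
      (1 ∈ c.eval (Encodable.encode a) ↔ p.1 a) := by
    rintro ⟨p, hp⟩
    have h1 : Primrec (fun n : ℕ => if ∃ a ∈ (Encodable.decode n : Option α).toList, p a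
        then 1 else 0) := by
      refine Primrec.ite (primrecPred_exists_mem (by fun_prop) ?_) (by fun_prop) (by fun_prop)
      exact primrecPred_comp hp (f := Prod.snd) (by fun_prop)
    obtain ⟨c, hc⟩ := Nat.Partrec.Code.exists_code.1
      (Nat.Partrec.of_primrec (Primrec.nat_iff.1 h1))
    refine ⟨c, fun a => ?_⟩
    by_cases h : p a <;> simp [hc, h]
  choose F hF using this
  refine Function.Injective.countable (f := F) ?_
  rintro p q h
  apply Subtype.ext
  funext a
  rw [← hF p a, ← hF q a, h]

end RevMath
namespace RevMath

/-! ### Turing reducibility and joins -/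

theorem TuringLE.mem {X Z : Set ℕ} (h : TuringLE X Z) {α : Type} [Primcodable α] {f : α → ℕ}
    (hf : Primrec f) : CE Z (fun a => f a ∈ X) := (turingLE_iff.1 h).1.comp hf

theorem TuringLE.notMem {X Z : Set ℕ} (h : TuringLE X Z) {α : Type} [Primcodable α] {f : α → ℕ}
    (hf : Primrec f) : CE Z (fun a => f a ∉ X) := (turingLE_iff.1 h).2.comp hf

theorem TuringLE.ce {X Z : Set ℕ} (h : TuringLE X Z) {α : Type} [Primcodable α] {p : α → Prop}
    (hp : CE X p) : CE Z p :=
  CE.trans (turingLE_iff.1 h).1 (turingLE_iff.1 h).2 hp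

theorem TuringLE.refl (X : Set ℕ) : TuringLE X X :=
  turingLE_iff.2 ⟨CE.mem (by fun_prop), CE.notMem (by fun_prop)⟩

theorem TuringLE.trans {X Y Z : Set ℕ} (h : TuringLE X Y) (h' : TuringLE Y Z) : TuringLE X Z :=
  turingLE_iff.2 ⟨h'.ce (turingLE_iff.1 h).1, h'.ce (turingLE_iff.1 h).2⟩

theorem mem_join {Y Z : Set ℕ} {n : ℕ} :
    n ∈ join Y Z ↔ (n % 2 = 0 ∧ n / 2 ∈ Y) ∨ (n % 2 = 1 ∧ n / 2 ∈ Z) := by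
  constructor
  · rintro (⟨y, hy, rfl⟩ | ⟨y, hy, rfl⟩)
    · exact Or.inl ⟨by omega, by rwa [show 2 * y / 2 = y by omega]⟩
    · exact Or.inr ⟨by omega, by rwa [show (2 * y + 1) / 2 = y by omega]⟩
  · rintro (⟨h, hy⟩ | ⟨h, hy⟩)
    · exact Or.inl ⟨_, hy, by omega⟩
    · exact Or.inr ⟨_, hy, by omega⟩

theorem notMem_join {Y Z : Set ℕ} {n : ℕ} :
    n ∉ join Y Z ↔ (n % 2 = 0 ∧ n / 2 ∉ Y) ∨ (n % 2 = 1 ∧ n / 2 ∉ Z) := by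
  rw [mem_join]
  rcases Nat.mod_two_eq_zero_or_one n with h | h <;> simp [h]

theorem CE.mem_join {W Z : Set ℕ} {α : Type} [Primcodable α] {Y : α → Set ℕ}
    (hY : CE W (fun x : α × ℕ => x.2 ∈ Y x.1)) (hZ : TuringLE Z W) :
    CE W (fun x : α × ℕ => x.2 ∈ join (Y x.1) Z) := by
  refine (CE.or (.and (.prim (primrecPred_eq (f := fun x : α × ℕ => x.2 % 2) (by fun_prop)
    (.const 0))) (hY.comp (f := fun x : α × ℕ => (x.1, x.2 / 2)) (by fun_prop))) (.and (.prim
    (primrecPred_eq (f := fun x : α × ℕ => x.2 % 2) (by fun_prop) (.const 1)))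
    (hZ.mem (f := fun x : α × ℕ => x.2 / 2) (by fun_prop)))).of_iff fun x => ?_
  exact RevMath.mem_join

theorem CE.notMem_join {W Z : Set ℕ} {α : Type} [Primcodable α] {Y : α → Set ℕ}
    (hY : CE W (fun x : α × ℕ => x.2 ∉ Y x.1)) (hZ : TuringLE Z W) :
    CE W (fun x : α × ℕ => x.2 ∉ join (Y x.1) Z) := by
  refine (CE.or (.and (.prim (primrecPred_eq (f := fun x : α × ℕ => x.2 % 2) (by fun_prop)
    (.const 0))) (hY.comp (f := fun x : α × ℕ => (x.1, x.2 / 2)) (by fun_prop))) (.and (.prim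
    (primrecPred_eq (f := fun x : α × ℕ => x.2 % 2) (by fun_prop) (.const 1)))
    (hZ.notMem (f := fun x : α × ℕ => x.2 / 2) (by fun_prop)))).of_iff fun x => ?_
  exact RevMath.notMem_join

theorem turingLE_join_left (Y Z : Set ℕ) : TuringLE Y (join Y Z) := by
  refine turingLE_iff.2 ⟨(CE.mem (f := fun n => 2 * n) (by fun_prop)).of_iff fun n => ?_,
    (CE.notMem (f := fun n => 2 * n) (by fun_prop)).of_iff fun n => ?_⟩ <;>
  simp [mem_join]

theorem turingLE_join_right (Y Z : Set ℕ) : TuringLE Z (join Y Z) := by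
  have h : ∀ n, (2 * n + 1) / 2 = n := fun n => by omega
  refine turingLE_iff.2 ⟨(CE.mem (f := fun n => 2 * n + 1) (by fun_prop)).of_iff fun n => ?_,
    (CE.notMem (f := fun n => 2 * n + 1) (by fun_prop)).of_iff fun n => ?_⟩ <;>
  simp [mem_join, h, Nat.add_mod]

theorem TuringLE.join {X Y Z : Set ℕ} (hX : TuringLE X Z) (hY : TuringLE Y Z) :
    TuringLE (join X Y) Z := by
  refine turingLE_iff.2 ⟨?_, ?_⟩
  · exact (CE.mem_join (α := Unit) (Y := fun _ => X) (hX.mem (by fun_prop)) hY).comp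
      (f := fun n => ((), n)) (by fun_prop)
  · exact (CE.notMem_join (α := Unit) (Y := fun _ => X) (hX.notMem (by fun_prop)) hY).comp
      (f := fun n => ((), n)) (by fun_prop)

theorem TuringLE.inter {X Y Z : Set ℕ} (hX : TuringLE X Z) (hY : TuringLE Y Z) :
    TuringLE (X ∩ Y) Z :=
  turingLE_iff.2 ⟨(hX.mem Primrec.id).and (hY.mem Primrec.id),
    ((hX.notMem Primrec.id).or (hY.notMem Primrec.id)).of_iff fun n => by
      simp only [id, Set.mem_inter_iff]; tauto⟩

theorem TuringLE.diff {X Y Z : Set ℕ} (hX : TuringLE X Z) (hY : TuringLE Y Z) :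
    TuringLE (X \ Y) Z :=
  turingLE_iff.2 ⟨(hX.mem Primrec.id).and (hY.notMem Primrec.id),
    ((hX.notMem Primrec.id).or (hY.mem Primrec.id)).of_iff fun n => by
      simp only [id, Set.mem_sdiff]; tauto⟩

theorem turingLE_Iio (N : ℕ) (Z : Set ℕ) : TuringLE (Set.Iio N) Z :=
  turingLE_iff.2 ⟨.prim (primrecPred_lt (by fun_prop) (by fun_prop)),
    .prim (primrecPred_lt (by fun_prop) (by fun_prop)).not⟩

theorem Hyperimmune.mono {Z W B : Set ℕ} (h : Hyperimmune Z B) (hW : TuringLE W Z) :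
    Hyperimmune W B :=
  hyperimmune_iff.2 ⟨h.1, fun T hT => (hyperimmune_iff.1 h).2 T (hW.ce hT)⟩

/-! ### Compactness of Cantor space and the hyperimmune-free basis theorem -/

theorem pre_setOf_getElem? (l : List Bool) {j : ℕ} (hj : j ≤ l.length) :
    pre {i | l[i]? = some true} j = l.take j := by
  apply List.ext_getElem?
  intro i
  rw [List.getElem?_take]
  split_ifs with h
  · cases hb : l[i]? with
    | none => rw [List.getElem?_eq_none_iff] at hb; omega
    | some b =>
      cases b
      · exact pre_getElem?_false.2 ⟨h, by simp [hb]⟩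
      · exact pre_getElem?_true.2 ⟨h, by simp [hb]⟩
  · rw [List.getElem?_eq_none_iff, length_pre]
    omega

/-- For fixed `s` the condition depends on the first `s` coordinates only, so it is the preimage of
a subset of a finite discrete space. -/
theorem isClosed_avoiding (V : List Bool → Prop) :
    IsClosed {C : ℕ → Bool | ∀ s, ¬ V (pre {n | C n = true} s)} := by
  rw [Set.ofPred_forall]
  refine isClosed_iInter fun s => ?_
  have hc : Continuous (fun (C : ℕ → Bool) (i : Fin s) => C i) := by fun_prop
  have : {C : ℕ → Bool | ¬ V (pre {n | C n = true} s)} =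
      (fun (C : ℕ → Bool) (i : Fin s) => C i) ⁻¹'
        {c | ∀ C : ℕ → Bool, (fun i : Fin s => C i) = c → ¬ V (pre {n | C n = true} s)} := by
    ext C
    simp only [Set.mem_ofPred_eq, Set.mem_preimage]
    refine ⟨fun h D hD => ?_, fun h => h C rfl⟩
    rwa [pre_congr (Z := {n | C n = true}) fun i hi => ?_]
    have := congrFun hD ⟨i, hi⟩
    simp only at this
    simp [this]
  rw [this]
  exact (isClosed_discrete _).preimage hc

/-- The intersection of a decreasing sequence of nonempty closed classes of sets is nonempty. -/
theorem exists_avoiding_all (V : ℕ → List Bool → Prop) (hV : ∀ i l, V i l → V (i + 1) l)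
    (h : ∀ i, ∃ C : Set ℕ, ∀ s, ¬ V i (pre C s)) :
    ∃ C : Set ℕ, ∀ i s, ¬ V i (pre C s) := by
  classical
  have hne := IsCompact.nonempty_iInter_of_sequence_nonempty_isCompact_isClosed
    (fun i => {C : ℕ → Bool | ∀ s, ¬ V i (pre {n | C n = true} s)})
    (fun i C hC s hs => hC s (hV i _ hs))
    (fun i => by
      obtain ⟨C, hC⟩ := h i
      exact ⟨fun n => decide (n ∈ C), by simpa using hC⟩)
    (isClosed_avoiding _).isCompact (fun i => isClosed_avoiding _)
  obtain ⟨C, hC⟩ := hne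
  rw [Set.mem_iInter] at hC
  exact ⟨_, hC⟩

/-- The fan theorem: a bar of Cantor space has finite height. -/
theorem exists_length_of_forall_exists (V : List Bool → Prop)
    (h : ∀ C : Set ℕ, ∃ s, V (pre C s)) :
    ∃ k, ∀ l : List Bool, l.length = k → ∃ j ≤ k, V (l.take j) := by
  by_contra! hcon
  -- The `k`-th class tests prefixes of length at most `k` only, so a single string of length `k`
  -- shows that it is nonempty.
  obtain ⟨C, hC⟩ := exists_avoiding_all (fun k l => V l ∧ l.length ≤ k)
    (fun i l h => ⟨h.1, h.2.trans (Nat.le_succ i)⟩) fun k => by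
      obtain ⟨l, hl, hV⟩ := hcon k
      refine ⟨{i | l[i]? = some true}, fun s => ?_⟩
      rintro ⟨h1, h2⟩
      rw [length_pre] at h2
      rw [pre_setOf_getElem? l (hl ▸ h2)] at h1
      exact hV s h2 h1
  obtain ⟨s, hs⟩ := h C
  exact hC s s ⟨hs, by simp⟩

/-- The binary strings of length `k`. -/
def binStrings (k : ℕ) : List (List Bool) :=
  Nat.rec [[]] (fun _ L => L.map (List.cons true) ++ L.map (List.cons false)) k

theorem mem_binStrings {k : ℕ} {l : List Bool} : l ∈ binStrings k ↔ l.length = k := by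
  induction k generalizing l with
  | zero => simp [binStrings]
  | succ k ih =>
    change l ∈ (binStrings k).map (List.cons true) ++ (binStrings k).map (List.cons false) ↔ _
    simp only [List.mem_append, List.mem_map]
    cases l with
    | nil => simp
    | cons b l => cases b <;> simp [ih]

theorem primrec_binStrings : Primrec binStrings := by
  unfold binStrings
  refine Primrec.nat_rec₁ _ (f := fun (_ : ℕ) (L : List (List Bool)) =>
    L.map (List.cons true) ++ L.map (List.cons false)) ?_
  exact primrec_append (Primrec.list_map Primrec.snd
    (Primrec.list_cons.comp (Primrec.const true) Primrec.snd).to₂)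
    (Primrec.list_map Primrec.snd (Primrec.list_cons.comp (Primrec.const false) Primrec.snd).to₂)

/-- If `U n` covers Cantor space for every `n`, then a bound for the least value met along every
set can be found enumerably. -/
theorem exists_avoiding_or_bound {W : Set ℕ} {U : ℕ → ℕ → List Bool → Prop}
    (hU : CE W (fun x : (ℕ × ℕ) × List Bool => U x.1.1 x.1.2 x.2)) :
    (∃ n, ∃ C : Set ℕ, ∀ s u, ¬ U n u (pre C s)) ∨
    ∃ T : ℕ → ℕ → Prop, CE W (fun x : ℕ × ℕ => T x.1 x.2) ∧ (∀ n, ∃ v, T n v) ∧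
      ∀ n v, T n v → ∀ C : Set ℕ, ∃ s, ∃ u ≤ v, U n u (pre C s) := by
  rw [or_iff_not_imp_left]
  intro hcon
  push Not at hcon
  -- `v` is a bound if some level `k` is entirely covered by prefixes giving values at most `v`. A
  -- level is finite, so this is enumerable, and compactness provides such a level.
  refine ⟨fun n v => ∃ k, ∀ l ∈ binStrings k, ∃ j, j ≤ k ∧ ∃ u, u ≤ v ∧ U n u (l.take j),
    ?_, fun n => ?_, ?_⟩
  · refine .ex (.ballMem (primrec_binStrings.comp Primrec.snd) (.ex (.and (.prim
      (primrecPred_le (by fun_prop) (by fun_prop))) (.ex (.and (.prim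
      (primrecPred_le (by fun_prop) (by fun_prop))) ?_)))))
    exact hU.comp (f := fun x : ((((ℕ × ℕ) × ℕ) × List Bool) × ℕ) × ℕ =>
      ((x.1.1.1.1.1, x.2), x.1.1.2.take x.1.2)) (by fun_prop)
  · obtain ⟨k, hk⟩ := exists_length_of_forall_exists (fun l => ∃ u, U n u l) (hcon n)
    have : ∀ l : List Bool, ∃ u, l.length = k → ∃ j ≤ k, U n u (l.take j) := fun l => by
      by_cases hl : l.length = k
      · obtain ⟨j, hj, u, hu⟩ := hk l hl
        exact ⟨u, fun _ => ⟨j, hj, hu⟩⟩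
      · exact ⟨0, fun h => absurd h hl⟩
    choose u hu using this
    classical
    refine ⟨(binStrings k).toFinset.sup u, k, fun l hl => ?_⟩
    obtain ⟨j, hj, h⟩ := hu l (mem_binStrings.1 hl)
    exact ⟨j, hj, u l, Finset.le_sup (f := u) (List.mem_toFinset.2 hl), h⟩
  · rintro n v ⟨k, hk⟩ C
    obtain ⟨j, hj, u, hu, h⟩ := hk (pre C k) (mem_binStrings.2 (length_pre C k))
    rw [take_pre C hj] at h
    exact ⟨j, u, hu, h⟩

/-- A functional: a primitive recursive test for `Φ(n) = v` on initial segments of the oracle. -/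
def IsFunctional (R : ℕ × ℕ → List Bool → Prop) : Prop :=
  PrimrecPred (fun x : (ℕ × ℕ) × List Bool => R x.1 x.2)

theorem exists_functional_enumeration : ∃ Φ : ℕ → ℕ × ℕ → List Bool → Prop,
    (∀ e, IsFunctional (Φ e)) ∧ ∀ R, IsFunctional R → ∃ e, Φ e = R := by
  obtain ⟨F, hF⟩ := (countable_primrecPred ((ℕ × ℕ) × List Bool)).exists_eq_range
    ⟨fun _ => True, (primrecPred_eq (Primrec.const 0) (Primrec.const 0)).of_eq (by simp)⟩
  refine ⟨fun e x l => F e (x, l), fun e => ?_, fun R hR => ?_⟩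
  · have : F e ∈ Set.range F := ⟨e, rfl⟩
    rw [← hF] at this
    exact this
  · have : (fun x : (ℕ × ℕ) × List Bool => R x.1 x.2) ∈ Set.range F := hF ▸ hR
    obtain ⟨e, he⟩ := this
    exact ⟨e, by simp [he]⟩

/-- It suffices to consider functionals that are total on the oracle. -/
theorem hyperimmune_of_functionals {Y B : Set ℕ} (hB : B.Infinite)
    (h : ∀ R, IsFunctional R → (∀ n, ∃ v s, R (n, v) (pre Y s)) →
      ∃ n v s, R (n, v) (pre Y s) ∧ v < Nat.nth (· ∈ B) n) : Hyperimmune Y B := by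
  refine hyperimmune_iff.2 ⟨hB, fun T ⟨R, h1, h2, h3⟩ htot => ?_⟩
  obtain ⟨n, v, s, h4, h5⟩ := h R h1 fun n => by
    obtain ⟨v, hv⟩ := htot n
    exact ⟨v, (h3 (n, v)).1 hv⟩
  exact ⟨n, v, (h3 (n, v)).2 ⟨s, h4⟩, h5⟩

theorem CE.exPre_join {Z : Set ℕ} {α : Type} [Primcodable α] {Y : α → Set ℕ}
    (h1 : CE Z (fun x : α × ℕ => x.2 ∈ Y x.1)) (h2 : CE Z (fun x : α × ℕ => x.2 ∉ Y x.1))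
    {V : Set ℕ} (hV : TuringLE V Z) {R : ℕ × ℕ → List Bool → Prop} (hR : IsFunctional R)
    {f : α → ℕ × ℕ} (hf : Primrec f) :
    CE Z (fun a => ∃ s, R (f a) (pre (join (Y a) V) s)) := by
  refine CE.exPre (CE.mem_join h1 hV) (CE.notMem_join h2 hV) (.prim ?_)
  exact primrecPred_comp hR (f := fun x : α × List Bool => (f x.1, x.2)) (by fun_prop)

/-- The hyperimmune-free basis theorem: a nonempty `Π⁰₁(Z)` class has a member `P` such that
every `Z`-hyperimmune set is `P ⊕ Z`-hyperimmune. -/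
theorem hyperimmuneFree_basis {Z : Set ℕ} {U : List Bool → Prop} (hU : CE Z U)
    (hne : ∃ C : Set ℕ, ∀ s, ¬ U (pre C s)) :
    ∃ P : Set ℕ, (∀ s, ¬ U (pre P s)) ∧ ∀ B, Hyperimmune Z B → Hyperimmune (join P Z) B := by
  obtain ⟨Φ, hΦ, hΦs⟩ := exists_functional_enumeration
  let G : Type := {U : List Bool → Prop // CE Z U ∧ ∃ C : Set ℕ, ∀ s, ¬ U (pre C s)}
  have step : ∀ (e : ℕ) (V : G), ∃ V' : G, (∀ l, V.1 l → V'.1 l) ∧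
      ((∃ n, ∀ P : Set ℕ, (∀ s, ¬ V'.1 (pre P s)) → ∀ v s, ¬ Φ e (n, v) (pre (join P Z) s)) ∨
       ∃ T : ℕ → ℕ → Prop, CE Z (fun x : ℕ × ℕ => T x.1 x.2) ∧ (∀ n, ∃ v, T n v) ∧
        ∀ n v, T n v → ∀ P : Set ℕ, (∀ s, ¬ V'.1 (pre P s)) →
          ∃ u ≤ v, ∃ s, Φ e (n, u) (pre (join P Z) s)) := by
    rintro e ⟨V, hV, hVne⟩
    -- `D n u` is met along a set once the set leaves the current class, or once `Φ e` has the value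
    -- `u` at `n` on some prefix `t` of its join with `Z`.
    let D : ℕ → ℕ → List Bool → Prop := fun n u l => V l ∨
      ∃ k, k ≤ l.length ∧ ∃ t, Φ e (n, u) t ∧ t.length = k ∧ ∀ i < t.length,
        (t[i]? = some true ∧ ((i % 2 = 0 ∧ l[i / 2]? = some true) ∨ (i % 2 = 1 ∧ i / 2 ∈ Z))) ∨
        (t[i]? = some false ∧ ((i % 2 = 0 ∧ l[i / 2]? = some false) ∨ (i % 2 = 1 ∧ i / 2 ∉ Z)))
    have hD : CE Z (fun x : (ℕ × ℕ) × List Bool => D x.1.1 x.1.2 x.2) := by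
      refine .or (hV.comp Primrec.snd) (.ex (.and (.prim (primrecPred_le (by fun_prop)
        (by fun_prop))) (.ex (.and (.prim ?_) (.and (.prim (primrecPred_eq (by fun_prop)
        (by fun_prop))) (.ball (by fun_prop) (.or (.and (.prim (primrecPred_eq (by fun_prop)
        (by fun_prop))) (.or (.and (.prim (primrecPred_eq (by fun_prop) (by fun_prop)))
        (.prim (primrecPred_eq (by fun_prop) (by fun_prop)))) (.and (.prim (primrecPred_eq
        (by fun_prop) (by fun_prop))) (.mem (by fun_prop))))) (.and (.prim (primrecPred_eq
        (by fun_prop) (by fun_prop))) (.or (.and (.prim (primrecPred_eq (by fun_prop)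
        (by fun_prop))) (.prim (primrecPred_eq (by fun_prop) (by fun_prop)))) (.and (.prim
        (primrecPred_eq (by fun_prop) (by fun_prop))) (.notMem (by fun_prop)))))))))))) 
      exact primrecPred_comp (hΦ e) (f := fun x : (((ℕ × ℕ) × List Bool) × ℕ) × List Bool =>
        (x.1.1.1, x.2)) (by fun_prop)
    have hDpre : ∀ (n u : ℕ) (P : Set ℕ), (∀ s, ¬ V (pre P s)) →
        ((∃ s, D n u (pre P s)) ↔ ∃ s, Φ e (n, u) (pre (join P Z) s)) := by
      intro n u P hP
      constructor
      · rintro ⟨s, hs | ⟨k, hk, t, h1, h2, h3⟩⟩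
        · exact absurd hs (hP s)
        · have : t = pre (join P Z) t.length := by
            rw [eq_pre_iff]
            intro i hi
            rcases h3 i hi with ⟨a, b⟩ | ⟨a, b⟩
            · exact Or.inl ⟨a, mem_join.2 (b.imp_left (And.imp_right fun h =>
                (pre_getElem?_true.1 h).2))⟩
            · exact Or.inr ⟨a, notMem_join.2 (b.imp_left (And.imp_right fun h =>
                (pre_getElem?_false.1 h).2))⟩
          exact ⟨t.length, this ▸ h1⟩
      · rintro ⟨s, hs⟩
        refine ⟨s, Or.inr ⟨s, by simp, _, hs, by simp, fun i hi => ?_⟩⟩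
        rw [length_pre] at hi
        by_cases hm : i ∈ join P Z
        · refine Or.inl ⟨pre_getElem?_true.2 ⟨hi, hm⟩, (mem_join.1 hm).imp_left
            (And.imp_right fun h => pre_getElem?_true.2 ⟨by omega, h⟩)⟩
        · refine Or.inr ⟨pre_getElem?_false.2 ⟨hi, hm⟩, (notMem_join.1 hm).imp_left
            (And.imp_right fun h => pre_getElem?_false.2 ⟨by omega, h⟩)⟩
    -- In the first case the class is thinned so as to force `Φ e` to be undefined at `n`; in the
    -- second it is kept, and `T` bounds a value of `Φ e` uniformly over the class.
    rcases exists_avoiding_or_bound hD with ⟨n, C, hC⟩ | ⟨T, hT, htot, hTb⟩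
    · refine ⟨⟨fun l => ∃ u, D n u l, ?_, C, fun s => ?_⟩, fun l hl => ⟨0, Or.inl hl⟩,
        Or.inl ⟨n, fun P hP v s hs => ?_⟩⟩
      · exact .ex (hD.comp (f := fun x : List Bool × ℕ => ((n, x.2), x.1)) (by fun_prop))
      · simpa using hC s
      · have hPV : ∀ s, ¬ V (pre P s) := fun s hs => hP s ⟨0, Or.inl hs⟩
        obtain ⟨s, hs⟩ := (hDpre n v P hPV).2 ⟨s, hs⟩
        exact hP s ⟨v, hs⟩
    · refine ⟨⟨V, hV, hVne⟩, fun l hl => hl, Or.inr ⟨T, hT, htot, fun n v hTv P hP => ?_⟩⟩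
      obtain ⟨s, u, hu, hs⟩ := hTb n v hTv P
      exact ⟨u, hu, (hDpre n u P hP).1 ⟨s, hs⟩⟩
  choose next hnext1 hnext2 using step
  let seq : ℕ → G := fun k => Nat.rec ⟨U, hU, hne⟩ next k
  obtain ⟨P, hP⟩ := exists_avoiding_all (fun i => (seq i).1) (fun i => hnext1 i (seq i))
    fun i => (seq i).2.2
  refine ⟨P, hP 0, fun B hB => hyperimmune_of_functionals hB.1 fun R hR htot => ?_⟩
  obtain ⟨e, rfl⟩ := hΦs R hR
  rcases hnext2 e (seq e) with ⟨n, hn⟩ | ⟨T, hT, hTt, hTb⟩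
  · obtain ⟨v, s, hs⟩ := htot n
    exact absurd hs (hn P (hP (e + 1)) v s)
  -- `T` was found without reference to `B`, which is why the same `P` serves every hyperimmune `B`.
  · obtain ⟨n, v, hTv, hv⟩ := (hyperimmune_iff.1 hB).2 T hT hTt
    obtain ⟨u, hu, s, hs⟩ := hTb n v hTv P (hP (e + 1))
    exact ⟨n, u, s, hs, hu.trans_lt hv⟩

end RevMath
namespace RevMath

/-! ### Mathias-like forcing with blocks -/

/-- `x` is an element of the finite set with canonical index `b`. -/
def Bit (b x : ℕ) : Prop := b / 2 ^ x % 2 = 1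

theorem Bit.lt {b x : ℕ} (h : Bit b x) : x < b := by
  by_contra hx
  have : b / 2 ^ x = 0 := Nat.div_eq_of_lt ((Nat.lt_two_pow_self).trans_le
    (Nat.pow_le_pow_right (by norm_num) (not_lt.1 hx)))
  simp [Bit, this] at h

theorem primrecPred_bit {α : Type} [Primcodable α] {f g : α → ℕ} (hf : Primrec f)
    (hg : Primrec g) : PrimrecPred (fun a => Bit (f a) (g a)) :=
  primrecPred_eq (by fun_prop) (by fun_prop)

/-- `X` is infinite and preserves the hyperimmunity of each `A i`. -/
def Good (Z : Set ℕ) (A : ℕ → Set ℕ) (X : Set ℕ) : Prop :=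
  X.Infinite ∧ ∀ i, Hyperimmune (join X Z) (A i)

theorem Good.of_turingLE {Z : Set ℕ} {A : ℕ → Set ℕ} {X X' : Set ℕ} (h : Good Z A X)
    (hX' : TuringLE X' (join X Z)) (hinf : X'.Infinite) : Good Z A X' :=
  ⟨hinf, fun i => (h.2 i).mono (hX'.join (turingLE_join_right _ _))⟩

theorem Good.diff_Iio {Z : Set ℕ} {A : ℕ → Set ℕ} {X : Set ℕ} (h : Good Z A X) (N : ℕ) :
    Good Z A (X \ Set.Iio N) :=
  h.of_turingLE ((turingLE_join_left _ _).diff (turingLE_Iio _ _)) (h.1.sdiff (Set.finite_Iio N))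

/-- The blocks of `ρ` are subsets of `X`. -/
def BlocksIn (ρ : List ℕ) (X : Set ℕ) : Prop := ∀ b ∈ ρ, ∀ x, Bit b x → x ∈ X

/-- Each block of `ρ` is a subset of `B` or of its complement. -/
def BlocksHomog (ρ : List ℕ) (B : Set ℕ) : Prop :=
  ∀ b ∈ ρ, (∀ x, Bit b x → x ∈ B) ∨ (∀ x, Bit b x → x ∉ B)

theorem BlocksIn.mono {ρ : List ℕ} {X Y : Set ℕ} (h : BlocksIn ρ X) (hXY : X ⊆ Y) :
    BlocksIn ρ Y := fun b hb x hx => hXY (h b hb x hx)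

theorem BlocksIn.append {ρ τ : List ℕ} {X : Set ℕ} (h : BlocksIn ρ X) (h' : BlocksIn τ X) :
    BlocksIn (ρ ++ τ) X := fun b hb =>
  (List.mem_append.1 hb).elim (h b) (h' b)

/-- The blocks of `ρ` are subsets of `X`, and on each of them the string `l` is constant. -/
def BlocksHomogOn (ρ : List ℕ) (X : Set ℕ) (l : List Bool) : Prop :=
  ∀ b ∈ ρ, (∀ x < b, ¬ Bit b x ∨ x ∈ X) ∧
    ((∀ x < b, ¬ Bit b x ∨ l[x]? = some true) ∨ (∀ x < b, ¬ Bit b x ∨ l[x]? = some false))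

theorem CE.blocksHomogOn {X W : Set ℕ} (hX : TuringLE X W) {α : Type} [Primcodable α]
    {f : α → List ℕ} {g : α → List Bool} (hf : Primrec f) (hg : Primrec g) :
    CE W (fun a => BlocksHomogOn (f a) X (g a)) := by
  refine .ballMem hf (.and (.ball (by fun_prop) (.or (.prim (primrecPred_bit (by fun_prop)
    (by fun_prop)).not) (hX.mem (by fun_prop)))) (.or (.ball (by fun_prop) (.or (.prim
    (primrecPred_bit (by fun_prop) (by fun_prop)).not) (.prim (primrecPred_eq (by fun_prop)
    (by fun_prop))))) (.ball (by fun_prop) (.or (.prim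
    (primrecPred_bit (by fun_prop) (by fun_prop)).not) (.prim (primrecPred_eq (by fun_prop)
    (by fun_prop)))))))

theorem BlocksHomogOn.blocksIn {ρ : List ℕ} {X : Set ℕ} {l : List Bool}
    (h : BlocksHomogOn ρ X l) : BlocksIn ρ X := fun b hb x hx =>
  ((h b hb).1 x hx.lt).resolve_left fun h => h hx

theorem BlocksHomogOn.blocksHomog {ρ : List ℕ} {X B : Set ℕ} {s : ℕ}
    (h : BlocksHomogOn ρ X (pre B s)) : BlocksHomog ρ B := fun b hb =>
  (h b hb).2.imp
    (fun h x hx => (pre_getElem?_true.1 ((h x hx.lt).resolve_left fun h => h hx)).2)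
    (fun h x hx => (pre_getElem?_false.1 ((h x hx.lt).resolve_left fun h => h hx)).2)

theorem exists_blocksHomogOn {ρ : List ℕ} {X B : Set ℕ} (h : BlocksIn ρ X)
    (hB : BlocksHomog ρ B) : ∃ s, BlocksHomogOn ρ X (pre B s) := by
  -- An element of a block is smaller than its canonical index, so the prefix of length `ρ.sum` sees
  -- all the blocks.
  refine ⟨ρ.sum, fun b hb => ⟨fun x _ => or_iff_not_imp_left.2 fun hx =>
    h b hb x (not_not.1 hx), ?_⟩⟩
  have hle : b ≤ ρ.sum := List.le_sum_of_mem hb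
  refine (hB b hb).imp (fun h x hxb => or_iff_not_imp_left.2 fun hx => ?_)
    (fun h x hxb => or_iff_not_imp_left.2 fun hx => ?_)
  · exact pre_getElem?_true.2 ⟨by omega, h x (not_not.1 hx)⟩
  · exact pre_getElem?_false.2 ⟨by omega, h x (not_not.1 hx)⟩

/-- A nonempty `Π⁰₁` class of two-colorings of a good set `X` has a member with a good
monochromatic subset of `X`. -/
theorem Good.exists_subset {Z X : Set ℕ} {A : ℕ → Set ℕ} (hX : Good Z A X)
    {U : List Bool → Prop} (hU : CE (join X Z) U) (hne : ∃ C : Set ℕ, ∀ s, ¬ U (pre C s)) :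
    ∃ C : Set ℕ, (∀ s, ¬ U (pre C s)) ∧ ∃ X' ⊆ X, Good Z A X' ∧
      ((∀ x ∈ X', x ∈ C) ∨ (∀ x ∈ X', x ∉ C)) := by
  obtain ⟨C, hC, hCA⟩ := hyperimmuneFree_basis hU hne
  have hXC : TuringLE X (join C (join X Z)) :=
    (turingLE_join_left _ _).trans (turingLE_join_right _ _)
  have hZC : TuringLE Z (join C (join X Z)) :=
    (turingLE_join_right _ _).trans (turingLE_join_right _ _)
  have key : ∀ X', TuringLE X' (join C (join X Z)) → X'.Infinite → Good Z A X' :=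
    fun X' h hinf => ⟨hinf, fun i => (hCA _ (hX.2 i)).mono (h.join hZC)⟩
  refine ⟨C, hC, ?_⟩
  by_cases h : (X ∩ C).Infinite
  · exact ⟨X ∩ C, Set.inter_subset_left, key _ (hXC.inter (turingLE_join_left _ _)) h,
      Or.inl fun x hx => hx.2⟩
  · refine ⟨X \ C, Set.sdiff_subset, key _ (hXC.diff (turingLE_join_left _ _)) ?_,
      Or.inr fun x hx => hx.2⟩
    have := hX.1.sdiff (Set.not_infinite.1 h)
    exact this.mono fun x hx => ⟨hx.1, fun h => hx.2 ⟨hx.1, h⟩⟩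

/-- `Φ(n) = v` with oracle `Y ⊕ Z`. -/
def Converges (R : ℕ × ℕ → List Bool → Prop) (Z Y : Set ℕ) (n v : ℕ) : Prop :=
  ∃ s, R (n, v) (pre (join Y Z) s)

/-- Nothing is assumed about the complexity of `B`: the search ranges over all colorings, and `B`
enters only once a bound has been beaten. In the second alternative every block inside `X'` is
homogeneous for the chosen coloring, so no homogeneity condition on `ρ` is left. -/
theorem forcing_dichotomy {Z X B : Set ℕ} {A : ℕ → Set ℕ} {Ok : List ℕ → List ℕ → Prop}
    (hOk : CE Z (fun x : List ℕ × List ℕ => Ok x.1 x.2)) {real : List ℕ → Set ℕ}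
    (hr : CE Z (fun x : List ℕ × ℕ => x.2 ∈ real x.1))
    (hr' : CE Z (fun x : List ℕ × ℕ => x.2 ∉ real x.1))
    (hX : Good Z A X) (σ : List ℕ) {R : ℕ × ℕ → List Bool → Prop} (hR : IsFunctional R) (i : ℕ) :
    (∃ n v ρ, Ok σ ρ ∧ BlocksIn ρ X ∧ BlocksHomog ρ B ∧ Converges R Z (real (σ ++ ρ)) n v ∧
      v < Nat.nth (· ∈ A i) n) ∨
    (∃ n, ∃ X' ⊆ X, Good Z A X' ∧ ∀ ρ, Ok σ ρ → BlocksIn ρ X' →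
      ∀ v, ¬ Converges R Z (real (σ ++ ρ)) n v) := by
  have hXW := turingLE_join_left X Z
  have hZW := turingLE_join_right X Z
  have hU : CE (join X Z) (fun x : (ℕ × ℕ) × List Bool => ∃ ρ, Ok σ ρ ∧
      BlocksHomogOn ρ X x.2 ∧ Converges R Z (real (σ ++ ρ)) x.1.1 x.1.2) := by
    refine .ex (.and ?_ (.and (.blocksHomogOn hXW (by fun_prop) (by fun_prop))
      (.exPre_join ?_ ?_ hZW hR (by fun_prop))))
    · exact (hZW.ce hOk).comp (f := fun x : ((ℕ × ℕ) × List Bool) × List ℕ => (σ, x.2))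
        (by fun_prop)
    · exact (hZW.ce hr).comp (f := fun x : (((ℕ × ℕ) × List Bool) × List ℕ) × ℕ =>
        (σ ++ x.1.2, x.2)) (by fun_prop)
    · exact (hZW.ce hr').comp (f := fun x : (((ℕ × ℕ) × List Bool) × List ℕ) × ℕ =>
        (σ ++ x.1.2, x.2)) (by fun_prop)
  rcases exists_avoiding_or_bound (U := fun n v l => ∃ ρ, Ok σ ρ ∧ BlocksHomogOn ρ X l ∧
    Converges R Z (real (σ ++ ρ)) n v) hU with ⟨n, C, hC⟩ | ⟨T, hT, htot, hTb⟩
  · right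
    obtain ⟨C, hC, X', hX', hgood, hhom⟩ := hX.exists_subset (U := fun l => ∃ v ρ, Ok σ ρ ∧
      BlocksHomogOn ρ X l ∧ Converges R Z (real (σ ++ ρ)) n v)
      (.ex (hU.comp (f := fun x : List Bool × ℕ => ((n, x.2), x.1)) (by fun_prop)))
      ⟨C, fun s ⟨v, hv⟩ => hC s v hv⟩
    refine ⟨n, X', hX', hgood, fun ρ hρ hin v hv => ?_⟩
    have hhom' : BlocksHomog ρ C := fun b hb => hhom.imp (fun h x hx => h x (hin b hb x hx))
      (fun h x hx => h x (hin b hb x hx))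
    obtain ⟨s, hs⟩ := exists_blocksHomogOn (hin.mono hX') hhom'
    exact hC s ⟨v, ρ, hρ, hs, hv⟩
  · left
    obtain ⟨n, v, hTv, hv⟩ := (hyperimmune_iff.1 (hX.2 i)).2 T hT htot
    obtain ⟨s, u, hu, ρ, h1, h2, h3⟩ := hTb n v hTv B
    exact ⟨n, u, ρ, h1, h2.blocksIn, h2.blocksHomog, h3, hu.trans_lt hv⟩

theorem pre_join_congr {Y Y' Z : Set ℕ} {s : ℕ} (h : ∀ y < s, y ∈ Y ↔ y ∈ Y') :
    pre (join Y Z) s = pre (join Y' Z) s := by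
  refine pre_congr fun i hi => ?_
  rw [mem_join, mem_join, h (i / 2) (by omega)]

/-- Existence of generic sequences. A condition is a pair `(σ, X)` of a list of (canonical indices
of) blocks and a reservoir; `real σ` is the finite part of the oracle decided by `σ`. -/
theorem exists_generic {Z : Set ℕ} {A : ℕ → Set ℕ} (hA : ∀ i, (A i).Infinite)
    {Ok : List ℕ → List ℕ → Prop}
    (hOk : CE Z (fun x : List ℕ × List ℕ => Ok x.1 x.2)) {real : List ℕ → Set ℕ}
    (hr : CE Z (fun x : List ℕ × ℕ => x.2 ∈ real x.1))
    (hr' : CE Z (fun x : List ℕ × ℕ => x.2 ∉ real x.1))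
    (hmono : ∀ σ ρ, real σ ⊆ real (σ ++ ρ))
    (huse : ∀ σ ρ N, BlocksIn ρ {x | N ≤ x} → Ok σ ρ → ∀ y < N, y ∈ real (σ ++ ρ) → y ∈ real σ)
    (B : Set ℕ) {Valid : List ℕ → Set ℕ → Prop}
    (hsub : ∀ σ X X', Valid σ X → X' ⊆ X → Valid σ X')
    (hext : ∀ σ X ρ, Valid σ X → Ok σ ρ → BlocksIn ρ X → BlocksHomog ρ B →
      ∃ N, Valid (σ ++ ρ) (X \ Set.Iio N))
    (htrans : ∀ σ X ρ Y, Valid σ X → Valid (σ ++ ρ) Y → BlocksIn ρ X →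
      ∃ ρ', Ok σ ρ' ∧ BlocksIn ρ' X ∧ real (σ ++ ρ') = real (σ ++ ρ))
    {Q : ℕ → List ℕ → Set ℕ → Prop}
    (hQ : ∀ j σ X, Valid σ X → Good Z A X → ∃ ρ, ∃ X' ⊆ X, BlocksIn ρ X ∧ Valid (σ ++ ρ) X' ∧
      Good Z A X' ∧ Q j (σ ++ ρ) X')
    {σ₀ : List ℕ} {X₀ : Set ℕ} (h₀ : Valid σ₀ X₀) (h₀' : Good Z A X₀) :
    ∃ (σ : ℕ → List ℕ) (X : ℕ → Set ℕ), σ 0 = σ₀ ∧ X 0 = X₀ ∧ (∀ k, Valid (σ k) (X k)) ∧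
      (∀ k m, k ≤ m → X m ⊆ X k ∧ ∃ ρ, σ m = σ k ++ ρ ∧ BlocksIn ρ (X k)) ∧
      (∀ j, ∃ k, Q j (σ k) (X k)) ∧
      ∀ i, Hyperimmune (join (⋃ k, real (σ k)) Z) (A i) := by
  obtain ⟨Φ, hΦ, hΦs⟩ := exists_functional_enumeration
  -- Either a value below the `n`-th element of `A i` is computed and the reservoir lies beyond its
  -- use `s`, or no admissible extension from the reservoir gives a value at `n`. The second clause
  -- ignores `B`, so that it also covers the replacement blocks supplied by `htrans`.
  let H : ℕ → ℕ → List ℕ → Set ℕ → Prop := fun e i σ X =>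
    (∃ n v s, Φ e (n, v) (pre (join (real σ) Z) s) ∧ v < Nat.nth (· ∈ A i) n ∧ X ⊆ {x | s ≤ x}) ∨
    (∃ n, ∀ ρ, Ok σ ρ → BlocksIn ρ X → ∀ v, ¬ Converges (Φ e) Z (real (σ ++ ρ)) n v)
  let G : Type := {c : List ℕ × Set ℕ // Valid c.1 c.2 ∧ Good Z A c.2}
  have step : ∀ (k : ℕ) (c : G), ∃ c' : G, c'.1.2 ⊆ c.1.2 ∧
      (∃ ρ, c'.1.1 = c.1.1 ++ ρ ∧ BlocksIn ρ c.1.2) ∧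
      (∀ j, k = 2 * j → Q j c'.1.1 c'.1.2) ∧
      (∀ e i, k = 2 * Nat.pair e i + 1 → H e i c'.1.1 c'.1.2) := by
    rintro k ⟨⟨σ, X⟩, hv, hg⟩
    rcases Nat.even_or_odd' k with ⟨j, rfl | rfl⟩
    · obtain ⟨ρ, X', h1, h2, h3, h4, h5⟩ := hQ j σ X hv hg
      refine ⟨⟨(σ ++ ρ, X'), h3, h4⟩, h1, ⟨ρ, rfl, h2⟩, fun j' hj => ?_, fun e i h => ?_⟩
      · rwa [show j' = j by omega]
      · omega
    · obtain ⟨⟨e, i⟩, rfl⟩ := Nat.pairEquiv.surjective j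
      simp only [Nat.pairEquiv_apply, Function.uncurry_apply_pair]
      have key : ∃ c' : G, c'.1.2 ⊆ X ∧ (∃ ρ, c'.1.1 = σ ++ ρ ∧ BlocksIn ρ X) ∧
          H e i c'.1.1 c'.1.2 := by
        rcases forcing_dichotomy (B := B) hOk hr hr' hg σ (hΦ e) i with
          ⟨n, v, ρ, h1, h2, h3, ⟨s, h4⟩, h5⟩ | ⟨n, X', h1, h2, h3⟩
        · obtain ⟨N, hN⟩ := hext σ X ρ hv h1 h2 h3
          -- The first cut restores validity, the second protects the use of the computation.
          refine ⟨⟨(σ ++ ρ, (X \ Set.Iio N) \ Set.Iio s), hsub _ _ _ hN Set.sdiff_subset,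
            (hg.diff_Iio N).diff_Iio s⟩, Set.sdiff_subset.trans Set.sdiff_subset, ⟨ρ, rfl, h2⟩,
            Or.inl ⟨n, v, s, h4, h5, fun x hx =>
            not_lt.1 (show ¬ x < s from hx.2)⟩⟩
        · exact ⟨⟨(σ, X'), hsub _ _ _ hv h1, h2⟩, h1, ⟨[], by simp, by simp [BlocksIn]⟩,
            Or.inr ⟨n, h3⟩⟩
      obtain ⟨c', h1, h2, h3⟩ := key
      refine ⟨c', h1, h2, fun j hj => by omega, fun e' i' h => ?_⟩
      obtain ⟨rfl, rfl⟩ := Nat.pair_eq_pair.1 (show Nat.pair e i = Nat.pair e' i' by omega)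
      exact h3
  choose next hn1 hn2 hn3 hn4 using step
  let c : ℕ → G := fun k => Nat.rec ⟨(σ₀, X₀), h₀, h₀'⟩ next k
  have hle : ∀ k m, k ≤ m → (c m).1.2 ⊆ (c k).1.2 ∧
      ∃ ρ, (c m).1.1 = (c k).1.1 ++ ρ ∧ BlocksIn ρ (c k).1.2 := by
    intro k m hkm
    induction m, hkm using Nat.le_induction with
    | base => exact ⟨subset_rfl, [], by simp, by simp [BlocksIn]⟩
    | succ m _ ih =>
      obtain ⟨ρ, h1, h2⟩ := ih.2
      obtain ⟨τ, h3, h4⟩ := hn2 m (c m)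
      exact ⟨(hn1 m (c m)).trans ih.1, ρ ++ τ, by rw [← List.append_assoc, ← h1]; exact h3,
        h2.append (h4.mono ih.1)⟩
  have hreal : ∀ k m, k ≤ m → real (c k).1.1 ⊆ real (c m).1.1 := fun k m hkm => by
    obtain ⟨ρ, h, -⟩ := (hle k m hkm).2
    rw [h]
    exact hmono _ _
  -- The finite parts increase, so below `N` the union is exhausted at some finite stage.
  have hlim : ∀ N k, ∃ m ≥ k, ∀ y < N, y ∈ (⋃ k, real (c k).1.1) ↔ y ∈ real (c m).1.1 := by
    intro N k
    have : ∀ y, ∃ m, y ∈ (⋃ k, real (c k).1.1) → y ∈ real (c m).1.1 := fun y => by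
      by_cases hy : y ∈ ⋃ k, real (c k).1.1
      · obtain ⟨m, hm⟩ := Set.mem_iUnion.1 hy
        exact ⟨m, fun _ => hm⟩
      · exact ⟨0, fun h => absurd h hy⟩
    choose m hm using this
    refine ⟨max k ((Finset.range N).sup m), le_max_left _ _, fun y hy => ⟨fun h => ?_, fun h =>
      Set.mem_iUnion.2 ⟨_, h⟩⟩⟩
    exact hreal _ _ ((Finset.le_sup (f := m) (Finset.mem_range.2 hy)).trans (le_max_right _ _))
      (hm y h)
  refine ⟨fun k => (c k).1.1, fun k => (c k).1.2, rfl, rfl, fun k => (c k).2.1, hle,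
    fun j => ⟨2 * j + 1, hn3 (2 * j) (c (2 * j)) j rfl⟩, fun i => ?_⟩
  refine hyperimmune_of_functionals (hA i) fun R hR htot => ?_
  obtain ⟨e, rfl⟩ := hΦs R hR
  set k := 2 * Nat.pair e i + 1 with hk
  rcases hn4 k (c k) e i hk with ⟨n, v, s, h1, h2, h3⟩ | ⟨n, hn⟩
  · refine ⟨n, v, s, ?_, h2⟩
    rwa [pre_join_congr (Y' := real (next k (c k)).1.1) fun y hy => ?_]
    obtain ⟨m, hm, hlim⟩ := hlim s (k + 1)
    rw [hlim y hy]
    refine ⟨fun h => ?_, fun h => hreal (k + 1) m hm h⟩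
    obtain ⟨-, ρ, hρ, hin⟩ := hle (k + 1) m hm
    -- What many later stages have added need not be a single admissible extension; `ρ'` is one with
    -- the same effect on the oracle.
    obtain ⟨ρ', h4, h5, h6⟩ := htrans _ _ ρ (c m).1.2 (c (k + 1)).2.1 (hρ ▸ (c m).2.1) hin
    rw [hρ, ← h6] at h
    exact huse _ ρ' s (h5.mono h3) h4 y hy h
  · obtain ⟨v, s, hs⟩ := htot n
    obtain ⟨m, hm, hlim⟩ := hlim s (k + 1)
    obtain ⟨-, ρ, hρ, hin⟩ := hle (k + 1) m hm
    obtain ⟨ρ', h4, h5, h6⟩ := htrans _ _ ρ (c m).1.2 (c (k + 1)).2.1 (hρ ▸ (c m).2.1) hin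
    refine absurd ⟨s, ?_⟩ (hn ρ' h4 h5 v)
    change Φ e (n, v) (pre (join (real ((c (k + 1)).1.1 ++ ρ')) Z) s)
    rw [h6, ← hρ]
    rwa [← pre_join_congr hlim]

end RevMath
namespace RevMath

/-! ### Canonical indices of finite sets -/

theorem bit_iff_testBit {b x : ℕ} : Bit b x ↔ b.testBit x := by
  rw [Nat.testBit_eq_decide_div_mod_eq, decide_eq_true_eq, Bit]

theorem bit_finCode {F : Finset ℕ} {x : ℕ} : Bit (finCode F) x ↔ x ∈ F := by
  rw [bit_iff_testBit, ← Nat.mem_bitIndices, ← List.mem_toFinset, finCode,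
    Finset.toFinset_bitIndices_sum_two_pow]

/-- The finite set with canonical index `b`. -/
def finDecode (b : ℕ) : Finset ℕ := b.bitIndices.toFinset

theorem mem_finDecode {b x : ℕ} : x ∈ finDecode b ↔ Bit b x := by
  rw [bit_iff_testBit, finDecode, List.mem_toFinset, Nat.mem_bitIndices]

theorem finCode_finDecode (b : ℕ) : finCode (finDecode b) = b :=
  Finset.sum_toFinset_bitIndices_two_pow b

theorem finDecode_finCode (F : Finset ℕ) : finDecode (finCode F) = F :=
  Finset.toFinset_bitIndices_sum_two_pow F

theorem bit_two_pow {x y : ℕ} : Bit (2 ^ x) y ↔ y = x := by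
  have := bit_finCode (F := {x}) (x := y)
  simpa [finCode] using this

/-- The union of the blocks of `σ`. -/
def elems (σ : List ℕ) : Set ℕ := {x | ∃ b ∈ σ, Bit b x}

theorem elems_append (σ ρ : List ℕ) : elems (σ ++ ρ) = elems σ ∪ elems ρ := by
  ext x
  simp only [elems, List.mem_append, Set.mem_ofPred_eq, Set.mem_union]
  constructor
  · rintro ⟨b, hb | hb, h⟩
    exacts [Or.inl ⟨b, hb, h⟩, Or.inr ⟨b, hb, h⟩]
  · rintro (⟨b, hb, h⟩ | ⟨b, hb, h⟩)
    exacts [⟨b, Or.inl hb, h⟩, ⟨b, Or.inr hb, h⟩]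

theorem mem_elems_singleton {b x : ℕ} : x ∈ elems [b] ↔ Bit b x := by simp [elems]

theorem lt_sum_of_mem_elems {σ : List ℕ} {x : ℕ} (h : x ∈ elems σ) : x < σ.sum := by
  obtain ⟨b, hb, hx⟩ := h
  exact hx.lt.trans_le (List.le_sum_of_mem hb)

theorem BlocksIn.elems_subset {ρ : List ℕ} {X : Set ℕ} (h : BlocksIn ρ X) : elems ρ ⊆ X := by
  rintro x ⟨b, hb, hx⟩
  exact h b hb x hx

@[fun_prop]
theorem primrec_sum {α : Type} [Primcodable α] {f : α → List ℕ} (hf : Primrec f) :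
    Primrec (fun a => (f a).sum) :=
  Primrec.list_foldr (h := fun _ (p : ℕ × ℕ) => p.1 + p.2) hf (Primrec.const 0)
    (primrec_add (Primrec.fst.comp Primrec.snd) (Primrec.snd.comp Primrec.snd))

theorem primrecPred_mem_elems {α : Type} [Primcodable α] {f : α → List ℕ} {g : α → ℕ}
    (hf : Primrec f) (hg : Primrec g) : PrimrecPred (fun a => g a ∈ elems (f a)) :=
  primrecPred_exists_mem hf (primrecPred_bit (by fun_prop) (by fun_prop))

/-- Merging blocks makes forcing facts about one-block extensions apply to everything added later.
-/
theorem exists_block (ρ : List ℕ) : ∃ b, elems [b] = elems ρ := by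
  classical
  refine ⟨finCode ((Finset.range ρ.sum).filter (· ∈ elems ρ)), ?_⟩
  ext x
  rw [mem_elems_singleton, bit_finCode, Finset.mem_filter, Finset.mem_range]
  exact ⟨fun h => h.2, fun h => ⟨lt_sum_of_mem_elems h, h⟩⟩

/-! ### Stable colorings -/

/-- The color `f x y` has a limit along `X`, for each `x ∈ X`. -/
def StableOn (f : ℕ → ℕ → Prop) (X : Set ℕ) : Prop :=
  ∀ x ∈ X, (∃ N, ∀ y ∈ X, N ≤ y → f x y) ∨ (∃ N, ∀ y ∈ X, N ≤ y → ¬ f x y)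

/-- The set of the `x` whose color has the limit `1` along `X`. -/
def limitSet (f : ℕ → ℕ → Prop) (X : Set ℕ) : Set ℕ := {x | ∃ N, ∀ y ∈ X, N ≤ y → f x y}

theorem StableOn.exists_threshold {f : ℕ → ℕ → Prop} {X : Set ℕ} (h : StableOn f X) (M : ℕ) :
    ∃ N, ∀ x ∈ X, x < M → x < N ∧ ∀ y ∈ X, N ≤ y → (f x y ↔ x ∈ limitSet f X) := by
  have : ∀ x, ∃ N, x ∈ X → ∀ y ∈ X, N ≤ y → (f x y ↔ x ∈ limitSet f X) := fun x => by
    by_cases hx : x ∈ X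
    · by_cases hB : x ∈ limitSet f X
      · obtain ⟨N, hN⟩ := id hB
        exact ⟨N, fun _ y hy hNy => iff_of_true (hN y hy hNy) hB⟩
      · obtain ⟨N, hN⟩ := (h x hx).resolve_left hB
        exact ⟨N, fun _ y hy hNy => iff_of_false (hN y hy hNy) hB⟩
    · exact ⟨0, fun h => absurd h hx⟩
  choose N hN using this
  refine ⟨max M ((Finset.range M).sup N), fun x hx hxM => ⟨hxM.trans_le (le_max_left _ _),
    fun y hy h => hN x hx y hy (le_trans ?_ h)⟩⟩
  exact (Finset.le_sup (f := N) (Finset.mem_range.2 hxM)).trans (le_max_right _ _)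

/-! ### The Erdős–Moser theorem and cohesiveness -/

/-- The coloring `f` is transitive on `H`. -/
def Trans (f : ℕ → ℕ → Prop) (H : Set ℕ) : Prop :=
  ∀ x ∈ H, ∀ y ∈ H, ∀ z ∈ H, x < y → y < z →
    (f x y → f y z → f x z) ∧ (¬ f x y → ¬ f y z → ¬ f x z)

/-- Only triples `u < v < x` are new. If `u ∈ F` and `v ∈ E`, the pairs `u, v` and `u, x` have the
same color; if both are in `E`, the pairs `u, x` and `v, x` do. Neither pattern can violate
transitivity. -/
theorem Trans.insert_of_block {f : ℕ → ℕ → Prop} {F E : Set ℕ} {x : ℕ} (h : Trans f (F ∪ E))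
    (hF : Trans f (insert x F)) (hFE : ∀ a ∈ F, ∀ b ∈ E, a < b ∧ (f a b ↔ f a x))
    (hFx : ∀ a ∈ F, a < x) (hEx : ∀ b ∈ E, b < x)
    (hE : ∀ b ∈ E, ∀ c ∈ E, f b x ↔ f c x) : Trans f (insert x (F ∪ E)) := by
  have hlt : ∀ a ∈ F ∪ E, a < x := fun a ha => ha.elim (hFx a) (hEx a)
  intro u hu v hv w hw huv hvw
  have hle : ∀ a ∈ insert x (F ∪ E), a ≤ x := by
    rintro a (rfl | ha)
    exacts [le_rfl, (hlt a ha).le]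
  have hv' : v ∈ F ∪ E := hv.resolve_left fun hvx => by
    have := hle w hw
    omega
  have hu' : u ∈ F ∪ E := hu.resolve_left fun hux => by
    have := hle w hw
    omega
  rcases hw with rfl | hw
  · rcases hu' with hu' | hu' <;> rcases hv' with hv' | hv'
    · exact hF u (Or.inr hu') v (Or.inr hv') w (Or.inl rfl) huv hvw
    · have := (hFE u hu' v hv').2
      tauto
    · have := (hFE v hv' u hu').1
      omega
    · have := hE u hu' v hv'
      tauto
  · exact h u hu' v hv' w hw huv hvw

theorem CE.trans_elems {Z : Set ℕ} {f : ℕ → ℕ → Prop} (hf : CE Z (fun x : ℕ × ℕ => f x.1 x.2))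
    (hf' : CE Z (fun x : ℕ × ℕ => ¬ f x.1 x.2)) {α : Type} [Primcodable α] {g : α → List ℕ}
    (hg : Primrec g) : CE Z (fun a => Trans f (elems (g a))) := by
  have hc : ∀ {β : Type} [Primcodable β] {u v : β → ℕ}, Primrec u → Primrec v →
      CE Z (fun x => f (u x) (v x)) := fun hu hv => hf.comp (hu.pair hv)
  have hc' : ∀ {β : Type} [Primcodable β] {u v : β → ℕ}, Primrec u → Primrec v →
      CE Z (fun x => ¬ f (u x) (v x)) := fun hu hv => hf'.comp (hu.pair hv)
  have : CE Z (fun a => ∀ x < (g a).sum, ∀ y < (g a).sum, ∀ z < (g a).sum,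
      ¬ (x ∈ elems (g a) ∧ y ∈ elems (g a) ∧ z ∈ elems (g a) ∧ x < y ∧ y < z) ∨
      ((¬ f x y ∨ ¬ f y z ∨ f x z) ∧ (f x y ∨ f y z ∨ ¬ f x z))) := by
    refine .ball (by fun_prop) (.ball (by fun_prop) (.ball (by fun_prop) (.or (.prim (.not (.and
      (primrecPred_mem_elems (by fun_prop) (by fun_prop)) (.and (primrecPred_mem_elems
      (by fun_prop) (by fun_prop)) (.and (primrecPred_mem_elems (by fun_prop) (by fun_prop))
      (.and (primrecPred_lt (by fun_prop) (by fun_prop)) (primrecPred_lt (by fun_prop)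
      (by fun_prop)))))))) (.and (.or (hc' (by fun_prop) (by fun_prop)) (.or (hc' (by fun_prop)
      (by fun_prop)) (hc (by fun_prop) (by fun_prop)))) (.or (hc (by fun_prop) (by fun_prop))
      (.or (hc (by fun_prop) (by fun_prop)) (hc' (by fun_prop) (by fun_prop))))))))
  refine this.of_iff fun a => ⟨fun h x _ y _ z _ => ?_, fun h x hx y hy z hz hxy hyz => ?_⟩
  · by_cases hh : x ∈ elems (g a) ∧ y ∈ elems (g a) ∧ z ∈ elems (g a) ∧ x < y ∧ y < z
    · have := h x hh.1 y hh.2.1 z hh.2.2.1 hh.2.2.2.1 hh.2.2.2.2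
      tauto
    · exact Or.inl hh
  · have := (h x (lt_sum_of_mem_elems hx) y (lt_sum_of_mem_elems hy) z
      (lt_sum_of_mem_elems hz)).resolve_left fun hn => hn ⟨hx, hy, hz, hxy, hyz⟩
    tauto

theorem Good.inter_or_diff {Z : Set ℕ} {A : ℕ → Set ℕ} {X : Set ℕ} (h : Good Z A X) {R : Set ℕ}
    (hR : TuringLE R Z) : Good Z A (X ∩ R) ∨ Good Z A (X \ R) := by
  have hX := turingLE_join_left X Z
  have hR' := hR.trans (turingLE_join_right X Z)
  by_cases hinf : (X ∩ R).Infinite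
  · exact Or.inl (h.of_turingLE (hX.inter hR') hinf)
  · refine Or.inr (h.of_turingLE (hX.diff hR') ?_)
    exact (h.1.sdiff (Set.not_infinite.1 hinf)).mono fun x hx => ⟨hx.1, fun h => hx.2 ⟨hx.1, h⟩⟩

/-- A good set on which `f` is stable has a good subset on which `f` is transitive and which is
cohesive for the sequence `r`. -/
theorem Good.exists_transitive_cohesive {Z : Set ℕ} {A : ℕ → Set ℕ} {X₀ : Set ℕ}
    (hX₀ : Good Z A X₀) {f : ℕ → ℕ → Prop} (hf : CE Z (fun x : ℕ × ℕ => f x.1 x.2))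
    (hf' : CE Z (fun x : ℕ × ℕ => ¬ f x.1 x.2)) (hst : StableOn f X₀)
    {r : ℕ → Set ℕ} (hr : ∀ i, TuringLE (r i) Z) :
    ∃ Y ⊆ X₀, Good Z A Y ∧ Trans f Y ∧
      ∀ i, (∃ N, ∀ y ∈ Y, N ≤ y → y ∈ r i) ∨ (∃ N, ∀ y ∈ Y, N ≤ y → y ∉ r i) := by
  -- A single block, because all its points must share one limit color: blocks with different limit
  -- colors could break transitivity with later points.
  let Ok : List ℕ → List ℕ → Prop := fun σ ρ => ρ.length = 1 ∧ Trans f (elems (σ ++ ρ))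
  -- Each chosen point has a constant color towards the reservoir, and each single point of the
  -- reservoir may be added; these are the hypotheses of `Trans.insert_of_block`.
  let Valid : List ℕ → Set ℕ → Prop := fun σ X => X ⊆ X₀ ∧ Trans f (elems σ) ∧
    (∀ a ∈ elems σ, ∀ x ∈ X, a < x) ∧
    (∀ a ∈ elems σ, (∀ x ∈ X, f a x) ∨ (∀ x ∈ X, ¬ f a x)) ∧
    (∀ x ∈ X, Trans f (insert x (elems σ)))
  have hmono : ∀ σ ρ, elems σ ⊆ elems (σ ++ ρ) := fun σ ρ => by
    rw [elems_append]
    exact Set.subset_union_left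
  have hsub : ∀ σ X X', Valid σ X → X' ⊆ X → Valid σ X' :=
    fun σ X X' ⟨h1, h2, h3, h4, h5⟩ h => ⟨h.trans h1, h2, fun a ha x hx => h3 a ha x (h hx),
      fun a ha => (h4 a ha).imp (fun k x hx => k x (h hx)) (fun k x hx => k x (h hx)),
      fun x hx => h5 x (h hx)⟩
  have hext : ∀ σ X ρ, Valid σ X → Ok σ ρ → BlocksIn ρ X → BlocksHomog ρ (limitSet f X₀) →
      ∃ N, Valid (σ ++ ρ) (X \ Set.Iio N) := by
    rintro σ X ρ ⟨h1, h2, h3, h4, h5⟩ ⟨hlen, htr⟩ hin hhom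
    obtain ⟨b, rfl⟩ := List.length_eq_one_iff.1 hlen
    obtain ⟨N, hN⟩ := hst.exists_threshold b
    have hinX : ∀ x, Bit b x → x ∈ X := hin b (by simp)
    have hthr : ∀ a, Bit b a → ∀ x ∈ X \ Set.Iio N,
        a < x ∧ (f a x ↔ a ∈ limitSet f X₀) := fun a ha x hx => by
      have := hN a (h1 (hinX a ha)) ha.lt
      have hx' : N ≤ x := not_lt.1 hx.2
      exact ⟨by omega, this.2 x (h1 hx.1) hx'⟩
    refine ⟨N, Set.sdiff_subset.trans h1, htr, ?_, ?_, ?_⟩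
    · rw [elems_append]
      rintro a (ha | ha) x hx
      · exact h3 a ha x hx.1
      · exact (hthr a (mem_elems_singleton.1 ha) x hx).1
    · rw [elems_append]
      rintro a (ha | ha)
      · exact (h4 a ha).imp (fun k x hx => k x hx.1) (fun k x hx => k x hx.1)
      · have ha := mem_elems_singleton.1 ha
        by_cases haB : a ∈ limitSet f X₀
        · exact Or.inl fun x hx => (hthr a ha x hx).2.2 haB
        · exact Or.inr fun x hx hfx => haB ((hthr a ha x hx).2.1 hfx)
    · intro x hx
      rw [elems_append] at htr ⊢
      refine htr.insert_of_block (h5 x hx.1) (fun a ha c hc => ?_) (fun a ha => h3 a ha x hx.1)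
        (fun c hc => (hthr c (mem_elems_singleton.1 hc) x hx).1) fun c hc d hd => ?_
      · have hcX := hinX c (mem_elems_singleton.1 hc)
        refine ⟨h3 a ha c hcX, ?_⟩
        rcases h4 a ha with h | h
        · exact iff_of_true (h c hcX) (h x hx.1)
        · exact iff_of_false (h c hcX) (h x hx.1)
      · have hc := mem_elems_singleton.1 hc
        have hd := mem_elems_singleton.1 hd
        rw [(hthr c hc x hx).2, (hthr d hd x hx).2]
        rcases hhom b (by simp) with h | h
        · exact iff_of_true (h c hc) (h d hd)
        · exact iff_of_false (h c hc) (h d hd)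
  obtain ⟨σ, X, hσ0, hX0, hval, hle, hQ, hhyp⟩ := exists_generic (Z := Z) (A := A)
    (fun i => (hX₀.2 i).1) (Ok := Ok) (real := elems)
    (.and (.prim (primrecPred_eq (by fun_prop) (by fun_prop)))
      (CE.trans_elems hf hf' (by fun_prop)))
    (.prim (primrecPred_mem_elems (by fun_prop) (by fun_prop)))
    (.prim (primrecPred_mem_elems (by fun_prop) (by fun_prop)).not) hmono
    (fun σ ρ N hin _ y hy h => by
      rw [elems_append] at h
      exact h.resolve_right fun h => (not_le.2 hy) (hin.elems_subset h))
    (limitSet f X₀) (Valid := Valid) hsub hext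
    (fun σ X ρ Y _ hv hin => by
      obtain ⟨b, hb⟩ := exists_block ρ
      have he : elems (σ ++ [b]) = elems (σ ++ ρ) := by rw [elems_append, hb, ← elems_append]
      refine ⟨[b], ⟨rfl, ?_⟩, fun c hc x hx => ?_, he⟩
      · rw [he]
        exact hv.2.1
      · rw [List.mem_singleton.1 hc] at hx
        exact hin.elems_subset (hb ▸ mem_elems_singleton.2 hx))
    -- The first clause makes the limit infinite, the second makes it cohesive.
    (Q := fun j σ X => (∃ x ∈ elems σ, j ≤ x) ∧ ((∀ x ∈ X, x ∈ r j) ∨ (∀ x ∈ X, x ∉ r j)))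
    (fun j σ X hv hg => by
      obtain ⟨x, hx, hjx⟩ := hg.1.exists_gt j
      -- `2 ^ x` is the index of `{x}`, and a singleton is homogeneous for every set.
      have hbit : ∀ y, Bit (2 ^ x) y → y = x := fun y h => bit_two_pow.1 h
      have hin : BlocksIn [2 ^ x] X := fun b hb y hy => by
        rw [List.mem_singleton.1 hb] at hy
        exact hbit y hy ▸ hx
      have hx2 : elems [2 ^ x] = {x} := by
        ext y
        rw [mem_elems_singleton, bit_two_pow, Set.mem_singleton_iff]
      obtain ⟨N, hN⟩ := hext σ X [2 ^ x] hv ⟨rfl, by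
          rw [elems_append, hx2, Set.union_singleton]
          exact hv.2.2.2.2 x hx⟩ hin fun b hb => by
        rw [List.mem_singleton.1 hb]
        by_cases h : x ∈ limitSet f X₀
        · exact Or.inl fun y hy => hbit y hy ▸ h
        · exact Or.inr fun y hy => hbit y hy ▸ h
      have hxe : x ∈ elems (σ ++ [2 ^ x]) := by
        rw [elems_append, hx2]
        exact Or.inr rfl
      rcases (hg.diff_Iio N).inter_or_diff (hr j) with hg' | hg'
      · exact ⟨[2 ^ x], _, Set.inter_subset_left.trans Set.sdiff_subset, hin,
          hsub _ _ _ hN Set.inter_subset_left, hg', ⟨x, hxe, hjx.le⟩, Or.inl fun y hy => hy.2⟩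
      · exact ⟨[2 ^ x], _, Set.sdiff_subset.trans Set.sdiff_subset, hin,
          hsub _ _ _ hN Set.sdiff_subset, hg', ⟨x, hxe, hjx.le⟩, Or.inr fun y hy => hy.2⟩)
    (σ₀ := []) (X₀ := X₀)
    ⟨subset_rfl, by simp [elems, Trans], by simp [elems], by simp [elems], fun x _ => by
      intro u hu v hv w hw huv
      simp only [elems, List.not_mem_nil, false_and, exists_false, Set.mem_insert_iff,
        Set.mem_ofPred_eq, or_false] at hu hv
      omega⟩ hX₀
  have hrealmono : ∀ k m, k ≤ m → elems (σ k) ⊆ elems (σ m) := fun k m hkm => by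
    obtain ⟨-, ρ, h, -⟩ := hle k m hkm
    rw [h]
    exact hmono _ _
  refine ⟨⋃ k, elems (σ k), ?_, ⟨?_, hhyp⟩, ?_, fun i => ?_⟩
  · refine Set.iUnion_subset fun k => ?_
    obtain ⟨-, ρ, h, hin⟩ := hle 0 k (Nat.zero_le k)
    rw [h, hσ0]
    exact hX0 ▸ hin.elems_subset
  · refine Set.infinite_of_not_bddAbove fun ⟨M, hM⟩ => ?_
    obtain ⟨k, ⟨x, hx, hMx⟩, -⟩ := hQ (M + 1)
    have := hM (Set.mem_iUnion.2 ⟨k, hx⟩)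
    omega
  · intro x hx y hy z hz
    obtain ⟨k1, hx⟩ := Set.mem_iUnion.1 hx
    obtain ⟨k2, hy⟩ := Set.mem_iUnion.1 hy
    obtain ⟨k3, hz⟩ := Set.mem_iUnion.1 hz
    let m := max k1 (max k2 k3)
    exact (hval m).2.1 x (hrealmono k1 m (by omega) hx) y (hrealmono k2 m (by omega) hy) z
      (hrealmono k3 m (by omega) hz)
  · obtain ⟨k, -, hk⟩ := hQ i
    -- A point from `(σ k).sum` on is not in `σ k`, so it was added later and came from the
    -- reservoir `X k`.
    have : ∀ y ∈ ⋃ k, elems (σ k), (σ k).sum ≤ y → y ∈ X k := by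
      intro y hy hsum
      obtain ⟨m, hm⟩ := Set.mem_iUnion.1 hy
      obtain ⟨-, ρ, h, hin⟩ := hle k (max k m) (le_max_left _ _)
      have := hrealmono m (max k m) (le_max_right _ _) hm
      rw [h, elems_append] at this
      exact hin.elems_subset (this.resolve_left fun h => by
        have := lt_sum_of_mem_elems h
        omega)
    exact hk.imp (fun h => ⟨_, fun y hy hs => h y (this y hy hs)⟩)
      (fun h => ⟨_, fun y hy hs => h y (this y hy hs)⟩)

end RevMath
namespace RevMath

/-! ### The stable grouping principle -/

/-- The relation between two successive blocks of a grouping. -/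
def BlockRel (f : ℕ → ℕ → Prop) (b c : ℕ) : Prop :=
  (∀ x y, Bit b x → Bit c y → x < y) ∧
    ((∀ x y, Bit b x → Bit c y → f x y) ∨ (∀ x y, Bit b x → Bit c y → ¬ f x y))

/-- `σ` is a finite grouping with blocks in `L`. -/
def FinGrouping (L : Set ℕ) (f : ℕ → ℕ → Prop) (σ : List ℕ) : Prop :=
  (∀ b ∈ σ, b ∈ L ∧ ∃ x, Bit b x) ∧ σ.Pairwise (BlockRel f)

theorem CE.blockRel {Z : Set ℕ} {f : ℕ → ℕ → Prop} (hf : CE Z (fun x : ℕ × ℕ => f x.1 x.2))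
    (hf' : CE Z (fun x : ℕ × ℕ => ¬ f x.1 x.2)) {α : Type} [Primcodable α] {g h : α → ℕ}
    (hg : Primrec g) (hh : Primrec h) : CE Z (fun a => BlockRel f (g a) (h a)) := by
  have hc : ∀ {β : Type} [Primcodable β] {u v : β → ℕ}, Primrec u → Primrec v →
      CE Z (fun x => f (u x) (v x)) := fun hu hv => hf.comp (hu.pair hv)
  have hc' : ∀ {β : Type} [Primcodable β] {u v : β → ℕ}, Primrec u → Primrec v →
      CE Z (fun x => ¬ f (u x) (v x)) := fun hu hv => hf'.comp (hu.pair hv)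
  have hall : ∀ {p : α → ℕ → ℕ → Prop}, CE Z (fun x : (α × ℕ) × ℕ => p x.1.1 x.1.2 x.2) →
      CE Z (fun a => ∀ x y, Bit (g a) x → Bit (h a) y → p a x y) := by
    intro p hp
    have key : CE Z (fun a => ∀ x < g a, ∀ y < h a, ¬ (Bit (g a) x ∧ Bit (h a) y) ∨ p a x y) :=
      .ball (by fun_prop) (.ball (by fun_prop) (.or (.prim (.not (.and (primrecPred_bit
        (by fun_prop) (by fun_prop)) (primrecPred_bit (by fun_prop) (by fun_prop))))) hp))
    refine key.of_iff fun a => ?_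
    exact ⟨fun H x _ y _ => or_iff_not_imp_left.2 fun hn => H x y (not_not.1 hn).1 (not_not.1 hn).2,
      fun H x y hx hy => (H x hx.lt y hy.lt).resolve_left fun hn => hn ⟨hx, hy⟩⟩
  exact .and (hall (.prim (primrecPred_lt (by fun_prop) (by fun_prop))))
    (.or (hall (hc (by fun_prop) (by fun_prop))) (hall (hc' (by fun_prop) (by fun_prop))))

theorem CE.finGrouping {Z L : Set ℕ} (hL : CE Z (· ∈ L)) {f : ℕ → ℕ → Prop}
    (hf : CE Z (fun x : ℕ × ℕ => f x.1 x.2))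
    (hf' : CE Z (fun x : ℕ × ℕ => ¬ f x.1 x.2)) {α : Type} [Primcodable α] {g : α → List ℕ}
    (hg : Primrec g) : CE Z (fun a => FinGrouping L f (g a)) := by
  refine .and (.ballMem hg (.and (hL.comp (by fun_prop)) (.ex (.prim (primrecPred_bit
    (by fun_prop) (by fun_prop)))))) ?_
  have : CE Z (fun a => ∀ i < (g a).length, ∀ j < (g a).length, ¬ i < j ∨ ∃ b : ℕ × ℕ,
      (g a)[i]? = some b.1 ∧ (g a)[j]? = some b.2 ∧ BlockRel f b.1 b.2) :=
    .ball (by fun_prop) (.ball (by fun_prop) (.or (.prim (primrecPred_lt (by fun_prop)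
      (by fun_prop)).not) (.ex (.and (.prim (primrecPred_eq (by fun_prop) (by fun_prop)))
      (.and (.prim (primrecPred_eq (by fun_prop) (by fun_prop)))
      (.blockRel hf hf' (by fun_prop) (by fun_prop)))))))
  refine this.of_iff fun a => ?_
  rw [List.pairwise_iff_getElem]
  constructor
  · intro h i hi j hj
    refine or_iff_not_imp_left.2 fun hij => ⟨((g a)[i], (g a)[j]), by simp, by simp, ?_⟩
    exact h i j hi hj (not_not.1 hij)
  · intro h i j hi hj hij
    obtain ⟨⟨b, c⟩, h1, h2, h3⟩ := (h i hi j hj).resolve_left (not_not.2 hij)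
    simp only [hi, hj, List.getElem?_eq_getElem, Option.some.injEq] at h1 h2
    rwa [h1, h2]

/-- The part of the code of a grouping that is determined by its first blocks. -/
def partCode (σ : List ℕ) : Set ℕ := {n | σ[n.unpair.1]? = some n.unpair.2}

/-- Either there is a grouping for `f` in the good set `X₀`, or the latter has a good subset
witnessing that `L` is not a largeness notion. -/
theorem Good.exists_grouping {Z : Set ℕ} {A : ℕ → Set ℕ} {X₀ : Set ℕ}
    (hX₀ : Good Z A X₀) {f : ℕ → ℕ → Prop} (hf : CE Z (fun x : ℕ × ℕ => f x.1 x.2))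
    (hf' : CE Z (fun x : ℕ × ℕ => ¬ f x.1 x.2)) (hst : StableOn f X₀)
    {L : Set ℕ} (hL : CE Z (· ∈ L)) :
    (∃ F : ℕ → Finset ℕ, (∀ i, finCode (F i) ∈ L ∧ (F i).Nonempty) ∧
      (∀ i j, i < j → (∀ x ∈ F i, ∀ y ∈ F j, x < y) ∧
        ((∀ x ∈ F i, ∀ y ∈ F j, f x y) ∨ (∀ x ∈ F i, ∀ y ∈ F j, ¬ f x y))) ∧
      ∀ i, Hyperimmune (join (seqCode F) Z) (A i)) ∨
    (∃ W ⊆ X₀, Good Z A W ∧ ∀ b ∈ L, (∃ x, Bit b x) → ¬ ∀ x, Bit b x → x ∈ W) := by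
  rw [or_iff_not_imp_right]
  intro hW
  -- Any number of blocks is allowed: a grouping needs each block to have one limit color, not all
  -- blocks the same one.
  let Ok : List ℕ → List ℕ → Prop := fun σ ρ => FinGrouping L f (σ ++ ρ)
  let Valid : List ℕ → Set ℕ → Prop := fun σ X => X ⊆ X₀ ∧ FinGrouping L f σ ∧
    ∀ b ∈ σ, (∀ a x, Bit b a → x ∈ X → a < x) ∧
      ((∀ a x, Bit b a → x ∈ X → f a x) ∨ (∀ a x, Bit b a → x ∈ X → ¬ f a x))
  have hmono : ∀ σ ρ, partCode σ ⊆ partCode (σ ++ ρ) := fun σ ρ n hn => by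
    have : σ[n.unpair.1]? = some n.unpair.2 := hn
    change (σ ++ ρ)[n.unpair.1]? = some n.unpair.2
    rw [List.getElem?_append_left (List.getElem?_eq_some_iff.1 this).1, this]
  have hsub : ∀ σ X X', Valid σ X → X' ⊆ X → Valid σ X' :=
    fun σ X X' ⟨h1, h2, h3⟩ h => ⟨h.trans h1, h2, fun b hb =>
      ⟨fun a x ha hx => (h3 b hb).1 a x ha (h hx), (h3 b hb).2.imp
        (fun k a x ha hx => k a x ha (h hx)) (fun k a x ha hx => k a x ha (h hx))⟩⟩
  have hext : ∀ σ X ρ, Valid σ X → Ok σ ρ → BlocksIn ρ X → BlocksHomog ρ (limitSet f X₀) →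
      ∃ N, Valid (σ ++ ρ) (X \ Set.Iio N) := by
    rintro σ X ρ ⟨h1, h2, h3⟩ hok hin hhom
    obtain ⟨N, hN⟩ := hst.exists_threshold ρ.sum
    have hthr : ∀ b ∈ ρ, ∀ a, Bit b a → ∀ x ∈ X \ Set.Iio N,
        a < x ∧ (f a x ↔ a ∈ limitSet f X₀) := fun b hb a ha x hx => by
      have := hN a (h1 (hin b hb a ha)) (ha.lt.trans_le (List.le_sum_of_mem hb))
      have hx' : N ≤ x := not_lt.1 hx.2
      exact ⟨by omega, this.2 x (h1 hx.1) hx'⟩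
    refine ⟨N, Set.sdiff_subset.trans h1, hok, fun b hb => ?_⟩
    rcases List.mem_append.1 hb with hb | hb
    · exact (hsub σ X _ ⟨h1, h2, h3⟩ Set.sdiff_subset).2.2 b hb
    · refine ⟨fun a x ha hx => (hthr b hb a ha x hx).1, (hhom b hb).imp
        (fun k a x ha hx => (hthr b hb a ha x hx).2.2 (k a ha))
        (fun k a x ha hx hfx => k a ha ((hthr b hb a ha x hx).2.1 hfx))⟩
  -- Without a nonempty block of `L` inside `X` homogeneous for the limit colors, `limitSet f X₀`
  -- would belong to the `Π⁰₁` class of colorings having no such homogeneous block. A member of the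
  -- class with a good monochromatic subset `W` of `X` then contradicts `hW`, because every block
  -- inside `W` is homogeneous for it.
  have hone : ∀ σ X, Valid σ X → Good Z A X → ∃ b N, BlocksIn [b] X ∧
      Valid (σ ++ [b]) (X \ Set.Iio N) := by
    intro σ X hv hg
    have hb : ∃ b s, b ∈ L ∧ (∃ x, Bit b x) ∧ BlocksHomogOn [b] X (pre (limitSet f X₀) s) := by
      by_contra hcon
      obtain ⟨C, hC, W, hWX, hWg, hWC⟩ := hg.exists_subset (U := fun l => ∃ b, b ∈ L ∧
        (∃ x, Bit b x) ∧ BlocksHomogOn [b] X l)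
        (.ex (.and (((turingLE_join_right X Z).ce hL).comp (by fun_prop)) (.and (.ex (.prim
          (primrecPred_bit (by fun_prop) (by fun_prop)))) (.blocksHomogOn (turingLE_join_left X Z)
          (by fun_prop) (by fun_prop)))))
        ⟨limitSet f X₀, fun s ⟨b, hb⟩ => hcon ⟨b, s, hb⟩⟩
      refine hW ⟨W, hWX.trans hv.1, hWg, fun b hbL hbne hbW => ?_⟩
      obtain ⟨s, hs⟩ := exists_blocksHomogOn (ρ := [b]) (X := X) (B := C)
        (fun c hc x hx => hWX (hbW x (List.mem_singleton.1 hc ▸ hx)))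
        (fun c hc => hWC.imp (fun h x hx => h x (hbW x (List.mem_singleton.1 hc ▸ hx)))
          (fun h x hx => h x (hbW x (List.mem_singleton.1 hc ▸ hx))))
      exact hC s ⟨b, hbL, hbne, hs⟩
    obtain ⟨b, s, hbL, hbne, hbs⟩ := hb
    have hinX : ∀ x, Bit b x → x ∈ X := hbs.blocksIn b (by simp)
    obtain ⟨N, hN⟩ := hext σ X [b] hv ⟨fun c hc => by
      rcases List.mem_append.1 hc with hc | hc
      · exact hv.2.1.1 c hc
      · rw [List.mem_singleton.1 hc]
        exact ⟨hbL, hbne⟩, by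
      refine List.pairwise_append.2 ⟨hv.2.1.2, by simp, fun c hc d hd => ?_⟩
      rw [List.mem_singleton.1 hd]
      exact ⟨fun x y hx hy => (hv.2.2 c hc).1 x y hx (hinX y hy), (hv.2.2 c hc).2.imp
        (fun k x y hx hy => k x y hx (hinX y hy)) (fun k x y hx hy => k x y hx (hinX y hy))⟩⟩
      hbs.blocksIn hbs.blocksHomog
    exact ⟨b, N, hbs.blocksIn, hN⟩
  obtain ⟨σ, X, hσ0, hX0, hval, hle, hQ, hhyp⟩ := exists_generic (Z := Z) (A := A)
    (fun i => (hX₀.2 i).1) (Ok := Ok) (real := partCode)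
    (.finGrouping hL hf hf' (by fun_prop))
    (.prim (primrecPred_eq (by fun_prop) (by fun_prop)))
    (.prim (primrecPred_eq (by fun_prop) (by fun_prop)).not) hmono
    -- Nonemptiness of blocks is essential: a block with an element `x ≥ N` has an index above `N`,
    -- hence so is the code of its entry in the sequence.
    (fun σ ρ N hin hok y hy h => by
      have h : (σ ++ ρ)[y.unpair.1]? = some y.unpair.2 := h
      by_cases hlt : y.unpair.1 < σ.length
      · rwa [List.getElem?_append_left hlt] at h
      · rw [List.getElem?_append_right (not_lt.1 hlt)] at h
        have hmem := List.mem_of_getElem? h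
        obtain ⟨x, hx⟩ := (hok.1 _ (List.mem_append_right σ hmem)).2
        have h1 : N ≤ x := hin _ hmem x hx
        have h2 := hx.lt
        have h3 := Nat.unpair_right_le y
        omega)
    (limitSet f X₀) (Valid := Valid) hsub hext
    (fun σ X ρ Y _ hv hin => ⟨ρ, hv.2.1, hin, rfl⟩)
    (Q := fun j σ _ => j ≤ σ.length)
    (fun j σ X hv hg => by
      induction j with
      | zero => exact ⟨[], X, subset_rfl, by simp [BlocksIn], by simpa using hv, hg, by simp⟩
      | succ j ih =>
        obtain ⟨ρ, X', h1, h2, h3, h4, h5⟩ := ih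
        obtain ⟨b, N, h6, h7⟩ := hone _ X' h3 h4
        refine ⟨ρ ++ [b], X' \ Set.Iio N, Set.sdiff_subset.trans h1, h2.append (h6.mono h1),
          by rwa [← List.append_assoc], h4.diff_Iio N, ?_⟩
        rw [← List.append_assoc, List.length_append, List.length_singleton]
        omega)
    (σ₀ := []) (X₀ := X₀) ⟨subset_rfl, ⟨by simp, by simp⟩, by simp⟩ hX₀
  have hlen : ∀ i, ∃ k, i < (σ k).length := fun i => hQ (i + 1)
  choose k hk using hlen
  have hget : ∀ i m, i < (σ m).length → (σ m)[i]? = some ((σ (k i))[i]'(hk i)) := by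
    intro i m him
    rcases le_total (k i) m with h | h
    · obtain ⟨-, ρ, hρ, -⟩ := hle _ _ h
      rw [hρ, List.getElem?_append_left (hk i), List.getElem?_eq_getElem]
    · obtain ⟨-, ρ, hρ, -⟩ := hle _ _ h
      have : (σ (k i))[i]? = (σ m)[i]? := by rw [hρ, List.getElem?_append_left him]
      rw [← this, List.getElem?_eq_getElem]
  refine ⟨fun i => finDecode ((σ (k i))[i]'(hk i)), fun i => ?_, fun i j hij => ?_, fun i => ?_⟩
  · have := (hval (k i)).2.1.1 _ (List.getElem_mem (hk i))
    rw [finCode_finDecode]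
    exact ⟨this.1, this.2.imp fun x hx => mem_finDecode.2 hx⟩
  · have hlt : i < (σ (k j)).length := hij.trans (hk j)
    have hpw := List.pairwise_iff_getElem.1 (hval (k j)).2.1.2 i j hlt (hk j) hij
    have h1 := hget i (k j) hlt
    rw [List.getElem?_eq_getElem hlt, Option.some.injEq] at h1
    rw [h1] at hpw
    simp only [mem_finDecode]
    exact ⟨fun x hx y hy => hpw.1 x y hx hy, hpw.2.imp (fun h x hx y hy => h x y hx hy)
      (fun h x hx y hy => h x y hx hy)⟩
  · have : seqCode (fun i => finDecode ((σ (k i))[i]'(hk i))) = ⋃ m, partCode (σ m) := by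
      ext n
      simp only [seqCode, finCode_finDecode, Set.mem_ofPred_eq, Set.mem_iUnion, partCode]
      constructor
      · rintro ⟨i, rfl⟩
        exact ⟨k i, by simp [hk i]⟩
      · rintro ⟨m, hm⟩
        have hlt := (List.getElem?_eq_some_iff.1 hm).1
        rw [hget _ m hlt, Option.some.injEq] at hm
        exact ⟨n.unpair.1, by rw [hm, Nat.pair_unpair]⟩
    rw [this]
    exact hhyp i

theorem good_univ {Z : Set ℕ} {A : ℕ → Set ℕ} (h : ∀ i, Hyperimmune Z (A i)) :
    Good Z A Set.univ :=
  ⟨Set.infinite_univ, fun i => (h i).mono (.join (turingLE_iff.2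
    ⟨(CE.const True).of_iff (by simp), (CE.const False).of_iff (by simp)⟩) (.refl Z))⟩

theorem SGP22_preservesHyperimmunity : SGP22.PreservesHyperimmunity := by
  rintro Z A hA X ⟨L, f, hst, rfl⟩ hXZ
  have hL : TuringLE (finCode '' L) Z := (turingLE_join_left _ _).trans hXZ
  have hf := (turingLE_join_right _ _).trans hXZ
  have hmem : ∀ x y, Nat.pair x y ∈ {n | ∃ x y, x < y ∧ f x y = 1 ∧ n = Nat.pair x y} ↔
      x < y ∧ f x y = 1 := by
    intro x y
    constructor
    · rintro ⟨x', y', h1, h2, h3⟩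
      obtain ⟨rfl, rfl⟩ := Nat.pair_eq_pair.1 h3
      exact ⟨h1, h2⟩
    · rintro ⟨h1, h2⟩
      exact ⟨x, y, h1, h2, rfl⟩
  -- The instance records only pairs `x < y`, so the order is built into the predicate; limits are
  -- unaffected.
  have hst' : StableOn (fun x y => x < y ∧ f x y = 1) Set.univ := by
    intro x _
    obtain ⟨c, hc⟩ := hst x
    obtain ⟨N, hN⟩ := Filter.eventually_atTop.1 hc
    by_cases h1 : c = 1
    · exact Or.inl ⟨max N (x + 1), fun y _ hy => ⟨by omega, h1 ▸ hN y (by omega)⟩⟩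
    · exact Or.inr ⟨N, fun y _ hy h => h1 (hN y hy ▸ h.2)⟩
  have hdec : ∀ b, (b ∈ finCode '' L ↔ finDecode b ∈ L) := fun b => by
    constructor
    · rintro ⟨F, hF, rfl⟩
      rwa [finDecode_finCode]
    · intro h
      exact ⟨_, h, finCode_finDecode b⟩
  rcases (good_univ hA).exists_grouping (f := fun x y => x < y ∧ f x y = 1)
    ((hf.mem (f := fun x : ℕ × ℕ => Nat.pair x.1 x.2) (by fun_prop)).of_iff
      fun x => (hmem _ _).symm)
    ((hf.notMem (f := fun x : ℕ × ℕ => Nat.pair x.1 x.2) (by fun_prop)).of_iff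
      fun x => (not_congr (hmem _ _)).symm) hst' (hL.mem Primrec.id) with
    ⟨F, h1, h2, h3⟩ | ⟨W, -, h1, h2⟩
  · refine ⟨seqCode F, ⟨L, f, rfl, Or.inl ⟨F, ⟨fun i => ⟨?_, (h1 i).2⟩,
      fun i j hij => (h2 i j hij).1, fun i j hij => ?_⟩, rfl⟩⟩, h3⟩
    · have := (hdec _).1 (h1 i).1
      rwa [finDecode_finCode] at this
    · obtain ⟨hlt, h | h⟩ := h2 i j hij
      · exact ⟨1, fun x hx y hy => (h x hx y hy).2⟩
      · refine ⟨0, fun x hx y hy => ?_⟩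
        have := h x hx y hy
        have := hlt x hx y hy
        have : f x y ≠ 1 := by tauto
        omega
  · refine ⟨W, ⟨L, f, rfl, Or.inr ⟨h1.1, fun F hF ⟨x, hx⟩ hFW => ?_⟩⟩, h1.2⟩
    exact h2 (finCode F) ⟨F, hF, rfl⟩ ⟨x, bit_finCode.2 hx⟩ fun y hy => hFW (bit_finCode.1 hy)

end RevMath
namespace RevMath

/-! ### A generic stable linear order -/

/-- The pairing function of second-order arithmetic. -/
def npair (x y : ℕ) : ℕ := (x + y) * (x + y) + x

theorem left_le_npair (x y : ℕ) : x ≤ npair x y := Nat.le_add_left _ _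

theorem right_le_npair (x y : ℕ) : y ≤ npair x y := by
  have : x + y ≤ (x + y) * (x + y) := Nat.le_mul_self _
  unfold npair
  omega

/-- The sum can be read off, since `(x + y)² + x` lies in the interval from `(x + y)²` to `(x + y +
1)²`, right end excluded. -/
theorem npair_inj {x y x' y' : ℕ} : npair x y = npair x' y' ↔ x = x' ∧ y = y' := by
  refine ⟨fun h => ?_, fun ⟨h, h'⟩ => by rw [h, h']⟩
  unfold npair at h
  have hs : x + y = x' + y' := by
    rcases lt_trichotomy (x + y) (x' + y') with hlt | heq | hlt
    · nlinarith
    · exact heq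
    · nlinarith
  rw [hs] at h
  omega

/-- The order on `ℕ` induced by `t`, as an oracle. -/
def orderCode (t : ℕ → ℚ) : Set ℕ := {n | ∃ x y, n = npair x y ∧ t x < t y}

/-- The elements with only finitely many predecessors in the order induced by `t`. -/
def lowerPart (t : ℕ → ℚ) : Set ℕ := {x | ∃ N, ∀ y, N ≤ y → t x < t y}

theorem pre_orderCode_congr {t t' : ℕ → ℚ} {s : ℕ} (h : ∀ x < s, t x = t' x) :
    pre (orderCode t) s = pre (orderCode t') s := by
  refine pre_congr fun i hi => ?_
  constructor
  · rintro ⟨x, y, rfl, hxy⟩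
    exact ⟨x, y, rfl, by rwa [← h x ((left_le_npair x y).trans_lt hi),
      ← h y ((right_le_npair x y).trans_lt hi)]⟩
  · rintro ⟨x, y, rfl, hxy⟩
    exact ⟨x, y, rfl, by rwa [h x ((left_le_npair x y).trans_lt hi),
      h y ((right_le_npair x y).trans_lt hi)]⟩

/-- A condition decides the first `n` values of `t` and an interval, avoiding these, for the
other ones. -/
structure OrderCond where
  /-- The number of decided values. -/
  n : ℕ
  /-- A function satisfying the condition. -/
  t : ℕ → ℚ
  /-- The left end of the interval. -/
  a : ℚ
  /-- The right end of the interval. -/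
  b : ℚ
  left : ∀ x < n, t x ≤ a ∨ b ≤ t x
  right : ∀ x, n ≤ x → a < t x ∧ t x < b

namespace OrderCond

theorem lt (c : OrderCond) : c.a < c.b := (c.right c.n le_rfl).1.trans (c.right c.n le_rfl).2

/-- The functions satisfying a condition. -/
def Sat (c : OrderCond) : Set (ℕ → ℚ) :=
  {t | ∀ x, (x < c.n → t x = c.t x) ∧ (c.n ≤ x → c.a < t x ∧ t x < c.b)}

theorem self_mem (c : OrderCond) : c.t ∈ c.Sat := fun x => ⟨fun _ => rfl, c.right x⟩

theorem mem_lowerPart {c : OrderCond} {t : ℕ → ℚ} (ht : t ∈ c.Sat) {x : ℕ} (h : t x ≤ c.a) :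
    x ∈ lowerPart t :=
  ⟨c.n, fun y hy => h.trans_lt ((ht y).2 hy).1⟩

theorem eventually_not_lt {c : OrderCond} {t : ℕ → ℚ} (ht : t ∈ c.Sat) {x : ℕ}
    (h : c.b ≤ t x) : ∃ N, ∀ y, N ≤ y → ¬ t x < t y :=
  ⟨c.n, fun y hy => not_lt.2 (((ht y).2 hy).2.le.trans h)⟩

end OrderCond

theorem notMem_lowerPart {t : ℕ → ℚ} {x : ℕ} (h : ∃ N, ∀ y, N ≤ y → ¬ t x < t y) :
    x ∉ lowerPart t := by
  rintro ⟨M, hM⟩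
  obtain ⟨N, hN⟩ := h
  exact hN _ (le_max_left N M) (hM _ (le_max_right N M))

theorem exists_upper_bound_lt {t : ℕ → ℚ} {n : ℕ} {a b : ℚ} (hab : a < b)
    (h : ∀ x, n ≤ x → t x < b) (m : ℕ) :
    ∃ a', a ≤ a' ∧ a' < b ∧ ∀ x, n ≤ x → x < m → t x ≤ a' := by
  induction m with
  | zero => exact ⟨a, le_rfl, hab, by simp⟩
  | succ m ih =>
    obtain ⟨a', h1, h2, h3⟩ := ih
    by_cases hm : n ≤ m
    · refine ⟨max a' (t m), h1.trans (le_max_left _ _), max_lt h2 (h m hm), fun x hx hxm => ?_⟩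
      rcases Nat.lt_succ_iff_lt_or_eq.1 hxm with hlt | rfl
      · exact (h3 x hx hlt).trans (le_max_left _ _)
      · exact le_max_right _ _
    · exact ⟨a', h1, h2, fun x hx hxm => by omega⟩

theorem exists_lower_bound_gt {t : ℕ → ℚ} {n : ℕ} {a b : ℚ} (hab : a < b)
    (h : ∀ x, n ≤ x → a < t x) (m : ℕ) :
    ∃ b', b' ≤ b ∧ a < b' ∧ ∀ x, n ≤ x → x < m → b' ≤ t x := by
  obtain ⟨c, h1, h2, h3⟩ := exists_upper_bound_lt (t := fun x => - t x) (n := n)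
    (neg_lt_neg hab) (fun x hx => neg_lt_neg (h x hx)) m
  exact ⟨-c, by linarith, by linarith, fun x hx hxm => by linarith [h3 x hx hxm]⟩

namespace OrderCond

theorem exists_interval (c : OrderCond) {t : ℕ → ℚ} (ht : t ∈ c.Sat) {m : ℕ} (hm : c.n ≤ m)
    {a' b' : ℚ} (ha : c.a ≤ a') (hb : b' ≤ c.b) (hab : a' < b')
    (h : ∀ x, c.n ≤ x → x < m → t x ≤ a' ∨ b' ≤ t x) :
    ∃ c' : OrderCond, c'.n = m ∧ c'.a = a' ∧ c'.b = b' ∧ c'.Sat ⊆ c.Sat ∧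
      ∀ t' ∈ c'.Sat, ∀ x < m, t' x = t x := by
  -- A condition carries a function satisfying it; from `m` on, any value inside the new interval
  -- would do.
  have hlt : ∀ x < m, (if x < m then t x else (a' + b') / 2) = t x := fun x hx => if_pos hx
  refine ⟨⟨m, fun x => if x < m then t x else (a' + b') / 2, a', b', fun x hx => ?_,
    fun x hx => ?_⟩, rfl, rfl, rfl, fun t' ht' x => ⟨fun hx => ?_, fun hx => ?_⟩,
    fun t' ht' x hx => ?_⟩
  · rw [hlt x hx]
    rcases lt_or_ge x c.n with hn | hn
    · rw [(ht x).1 hn]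
      exact (c.left x hn).imp (fun h => h.trans ha) (fun h => hb.trans h)
    · exact h x hn hx
  · rw [if_neg (not_lt.2 hx)]
    constructor <;> linarith
  · rw [((ht' x).1 (hx.trans_le hm)).trans (hlt x (hx.trans_le hm)), (ht x).1 hx]
  · rcases lt_or_ge x m with hlt' | hge
    · rw [((ht' x).1 hlt').trans (hlt x hlt')]
      exact (ht x).2 hx
    · have := (ht' x).2 hge
      exact ⟨ha.trans_lt this.1, this.2.trans_le hb⟩
  · exact ((ht' x).1 hx).trans (hlt x hx)

/-- The left end is raised to bound the newly decided values, which leaves these points below all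
undecided ones. -/
theorem exists_up (c : OrderCond) {t : ℕ → ℚ} (ht : t ∈ c.Sat) {m : ℕ} (hm : c.n ≤ m) :
    ∃ c' : OrderCond, c'.n = m ∧ c'.Sat ⊆ c.Sat ∧
      ∀ t' ∈ c'.Sat, (∀ x < m, t' x = t x) ∧ ∀ x, c.n ≤ x → x < m → x ∈ lowerPart t' := by
  obtain ⟨a', h1, h2, h3⟩ := exists_upper_bound_lt c.lt (fun x hx => ((ht x).2 hx).2) m
  obtain ⟨c', hn, ha, -, hs, ht'⟩ := c.exists_interval ht hm h1 le_rfl h2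
    (fun x hx hxm => Or.inl (h3 x hx hxm))
  refine ⟨c', hn, hs, fun t' h => ⟨ht' t' h, fun x hx hxm => mem_lowerPart h ?_⟩⟩
  rw [ht' t' h x hxm, ha]
  exact h3 x hx hxm

theorem exists_down (c : OrderCond) {t : ℕ → ℚ} (ht : t ∈ c.Sat) {m : ℕ} (hm : c.n ≤ m) :
    ∃ c' : OrderCond, c'.n = m ∧ c'.Sat ⊆ c.Sat ∧
      ∀ t' ∈ c'.Sat, (∀ x < m, t' x = t x) ∧ ∀ x, c.n ≤ x → x < m → x ∉ lowerPart t' := by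
  obtain ⟨b', h1, h2, h3⟩ := exists_lower_bound_gt c.lt (fun x hx => ((ht x).2 hx).1) m
  obtain ⟨c', hn, -, hb, hs, ht'⟩ := c.exists_interval ht hm le_rfl h1 h2
    (fun x hx hxm => Or.inr (h3 x hx hxm))
  refine ⟨c', hn, hs, fun t' h => ⟨ht' t' h, fun x hx hxm => notMem_lowerPart
    (eventually_not_lt h ?_)⟩⟩
  rw [ht' t' h x hxm, hb]
  exact h3 x hx hxm

/-- Every condition has a (proper) extension forcing `D`. -/
def Dense (D : (ℕ → ℚ) → Prop) : Prop :=
  ∀ c : OrderCond, ∃ c' : OrderCond, c.n < c'.n ∧ c'.Sat ⊆ c.Sat ∧ ∀ t ∈ c'.Sat, D t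

theorem Dense.and {D E : (ℕ → ℚ) → Prop} (hD : Dense D) (hE : Dense E) :
    Dense (fun t => D t ∧ E t) := fun c => by
  obtain ⟨c', h1, h2, h3⟩ := hD c
  obtain ⟨c'', h4, h5, h6⟩ := hE c'
  exact ⟨c'', h1.trans h4, h5.trans h2, fun t ht => ⟨h3 t (h5 ht), h6 t ht⟩⟩

theorem exists_of_dense {D : ℕ → (ℕ → ℚ) → Prop} (hD : ∀ j, Dense (D j)) : ∃ t, ∀ j, D j t := by
  choose next h1 h2 h3 using hD
  let c : ℕ → OrderCond := fun k => Nat.rec ⟨0, fun _ => 0, -1, 1, by simp, by norm_num⟩ next k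
  have hn : ∀ k, k ≤ (c k).n := fun k => by
    induction k with
    | zero => exact Nat.zero_le _
    | succ k ih => exact (Nat.succ_le_of_lt (ih.trans_lt (h1 k (c k))))
  have hle : ∀ k m, k ≤ m → (c m).Sat ⊆ (c k).Sat := fun k m hkm => by
    induction m, hkm using Nat.le_induction with
    | base => exact subset_rfl
    | succ m _ ih => exact (h2 m (c m)).trans ih
  -- The `k`-th condition decides at least `k` values, so the value at `x` is final from stage `x +
  -- 1` on.
  have hagree : ∀ x m, x + 1 ≤ m → (c m).t x = (c (x + 1)).t x := fun x m hm =>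
    (hle _ _ hm (c m).self_mem x).1 (hn (x + 1))
  have hmem : ∀ k, (fun x => (c (x + 1)).t x) ∈ (c k).Sat := fun k x => by
    have := hle k (max k (x + 1)) (le_max_left _ _) (c _).self_mem x
    rwa [hagree x _ (le_max_right _ _)] at this
  exact ⟨_, fun j => h3 j (c j) _ (hmem (j + 1))⟩

theorem dense_exists_mem (j : ℕ) : Dense (fun t => ∃ x, j ≤ x ∧ x ∈ lowerPart t) := fun c => by
  obtain ⟨c', h1, h2, h3⟩ := c.exists_up c.self_mem (m := max c.n j + 1) (by omega)
  exact ⟨c', by omega, h2, fun t ht => ⟨max c.n j, le_max_right _ _,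
    (h3 t ht).2 _ (le_max_left _ _) (by omega)⟩⟩

theorem dense_exists_notMem (j : ℕ) : Dense (fun t => ∃ x, j ≤ x ∧ x ∉ lowerPart t) := fun c => by
  obtain ⟨c', h1, h2, h3⟩ := c.exists_down c.self_mem (m := max c.n j + 1) (by omega)
  exact ⟨c', by omega, h2, fun t ht => ⟨max c.n j, le_max_right _ _,
    (h3 t ht).2 _ (le_max_left _ _) (by omega)⟩⟩

theorem dense_stable (j : ℕ) :
    Dense (fun t => j ∈ lowerPart t ∨ ∃ N, ∀ y, N ≤ y → ¬ t j < t y) := fun c => by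
  obtain ⟨c', h1, h2, h3⟩ := c.exists_up c.self_mem (m := max c.n j + 1) (by omega)
  refine ⟨c', by omega, h2, fun t ht => ?_⟩
  have hj : j < c'.n := by omega
  -- The value at `j` is already decided, hence lies on one side of the interval that will contain
  -- all later values.
  have := c'.left j hj
  rw [← (ht j).1 hj] at this
  exact this.imp (mem_lowerPart ht) (eventually_not_lt ht)

/-- If the functional can take a value `v` at `c.n`, the values of `t` are frozen past the use and
past `v`, with all points of the frozen stretch kept out of `S t`. The elements of `S t` up to `v`
then lie below `c.n`. Otherwise `c` already forces the functional to be undefined at `c.n`. -/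
theorem dense_escape {S : (ℕ → ℚ) → Set ℕ}
    (hS : ∀ (c : OrderCond) (t : ℕ → ℚ), t ∈ c.Sat → ∀ m, c.n ≤ m →
      ∃ c' : OrderCond, c'.n = m ∧ c'.Sat ⊆ c.Sat ∧
        ∀ t' ∈ c'.Sat, (∀ x < m, t' x = t x) ∧ ∀ x, c.n ≤ x → x < m → x ∉ S t')
    (R : ℕ × ℕ → List Bool → Prop) : Dense (fun t =>
      (∃ m v s, R (m, v) (pre (orderCode t) s) ∧ ∀ y ∈ S t, y ≤ v → y < m) ∨
      (∃ m, ∀ v s, ¬ R (m, v) (pre (orderCode t) s))) := fun c => by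
  by_cases h : ∃ t ∈ c.Sat, ∃ v s, R (c.n, v) (pre (orderCode t) s)
  · obtain ⟨t, ht, v, s, hR⟩ := h
    obtain ⟨c', h1, h2, h3⟩ := hS c t ht (max c.n (max s v) + 1) (by omega)
    refine ⟨c', by omega, h2, fun t' ht' => Or.inl ⟨c.n, v, s, ?_, fun y hy hyv => ?_⟩⟩
    · rwa [pre_orderCode_congr fun x hx => (h3 t' ht').1 x (by omega)]
    · by_contra hlt
      exact (h3 t' ht').2 y (not_lt.1 hlt) (by omega) hy
  · obtain ⟨c', h1, h2, h3⟩ := hS c c.t c.self_mem (c.n + 1) (by omega)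
    exact ⟨c', by omega, h2, fun t ht => Or.inr ⟨c.n, fun v s hR => h ⟨t, h2 ht, v, s, hR⟩⟩⟩

end OrderCond

/-- Since `p_B(m) ≥ m`, a set whose elements up to `v` are all below `m` has `p_B(m) > v`. -/
theorem hyperimmune_of_escape {Y B : Set ℕ} (hB : ∀ j, ∃ x, j ≤ x ∧ x ∈ B)
    (h : ∀ R, IsFunctional R → (∃ m v s, R (m, v) (pre Y s) ∧ ∀ y ∈ B, y ≤ v → y < m) ∨
      (∃ m, ∀ v s, ¬ R (m, v) (pre Y s))) : Hyperimmune Y B := by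
  have hinf : B.Infinite := Set.infinite_of_not_bddAbove fun ⟨M, hM⟩ => by
    obtain ⟨x, hx, hxB⟩ := hB (M + 1)
    have := hM hxB
    omega
  refine hyperimmune_of_functionals hinf fun R hR htot => ?_
  rcases h R hR with ⟨m, v, s, h1, h2⟩ | ⟨m, hm⟩
  · refine ⟨m, v, s, h1, ?_⟩
    by_contra hle
    have h3 := h2 _ (Nat.nth_mem_of_infinite hinf m) (not_lt.1 hle)
    have h4 : m ≤ Nat.nth (· ∈ B) m := (Nat.nth_strictMono hinf).le_apply
    exact absurd h3 (not_lt.2 h4)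
  · obtain ⟨v, s, hs⟩ := htot m
    exact absurd hs (hm v s)

/-- There is a stable linear (pre)order on `ℕ` relative to which both its lower part and the
complement of the latter are hyperimmune. -/
theorem exists_generic_order : ∃ t : ℕ → ℚ,
    (∀ x, x ∉ lowerPart t → ∃ N, ∀ y, N ≤ y → ¬ t x < t y) ∧
    Hyperimmune (orderCode t) (lowerPart t) ∧ Hyperimmune (orderCode t) (lowerPart t)ᶜ := by
  obtain ⟨Φ, hΦ, hΦs⟩ := exists_functional_enumeration
  obtain ⟨t, ht⟩ := OrderCond.exists_of_dense fun j => (OrderCond.dense_exists_mem j).and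
    ((OrderCond.dense_exists_notMem j).and ((OrderCond.dense_stable j).and
    ((OrderCond.dense_escape (S := lowerPart) (fun c t ht m hm => c.exists_down ht hm) (Φ j)).and
    (OrderCond.dense_escape (S := fun t => (lowerPart t)ᶜ) (fun c t ht m hm => by
      obtain ⟨c', h1, h2, h3⟩ := c.exists_up ht hm
      exact ⟨c', h1, h2, fun t' ht' => ⟨(h3 t' ht').1, fun x hx hxm h =>
        h ((h3 t' ht').2 x hx hxm)⟩⟩) (Φ j)))))
  refine ⟨t, fun x hx => (ht x).2.2.1.resolve_left hx, ?_, ?_⟩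
  · refine hyperimmune_of_escape (fun j => (ht j).1) fun R hR => ?_
    obtain ⟨e, rfl⟩ := hΦs R hR
    exact (ht e).2.2.2.1
  · refine hyperimmune_of_escape (fun j => (ht j).2.1) fun R hR => ?_
    obtain ⟨e, rfl⟩ := hΦs R hR
    exact (ht e).2.2.2.2

end RevMath
namespace RevMath

/-! ### Codes of finite sets inside the structure -/

/-- `x` belongs to the finite set coded by `c` in second-order arithmetic. -/
def NCode (x c : ℕ) : Prop :=
  ∃ k m n q : ℕ, c = npair k (npair m n) ∧ x < k ∧ n = q * (m * (x + 1) + 1)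

/-- `c` is the least code of the finite set that it codes. -/
def NFin (c : ℕ) : Prop := ∀ d : ℕ, d < c → ¬ ∀ x : ℕ, NCode x d ↔ NCode x c

theorem NCode.lt {x c : ℕ} (h : NCode x c) : x < c := by
  obtain ⟨k, m, n, q, rfl, hx, -⟩ := h
  exact hx.trans_le (left_le_npair _ _)

@[fun_prop]
theorem primrec_npair {α : Type} [Primcodable α] {f g : α → ℕ} (hf : Primrec f)
    (hg : Primrec g) : Primrec (fun a => npair (f a) (g a)) := by
  unfold npair
  fun_prop

theorem primrecPred_nCode {α : Type} [Primcodable α] {f g : α → ℕ} (hf : Primrec f)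
    (hg : Primrec g) : PrimrecPred (fun a => NCode (f a) (g a)) := by
  -- All witnesses are bounded by the code itself.
  have key : PrimrecPred (fun a => ∃ k < g a + 1, ∃ m < g a + 1, ∃ n < g a + 1, ∃ q < g a + 1,
      g a = npair k (npair m n) ∧ f a < k ∧ n = q * (m * (f a + 1) + 1)) := by
    refine primrecPred_exists_lt (by fun_prop) (primrecPred_exists_lt (by fun_prop)
      (primrecPred_exists_lt (by fun_prop) (primrecPred_exists_lt (by fun_prop)
      (.and ?_ (.and ?_ ?_)))))
    · exact primrecPred_eq (by fun_prop) (by fun_prop)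
    · exact primrecPred_lt (by fun_prop) (by fun_prop)
    · exact primrecPred_eq (by fun_prop) (by fun_prop)
  refine key.of_eq fun a => ⟨?_, ?_⟩
  · rintro ⟨k, -, m, -, n, -, q, -, h⟩
    exact ⟨k, m, n, q, h⟩
  · rintro ⟨k, m, n, q, h1, h2, h3⟩
    have hk : k ≤ g a := h1 ▸ left_le_npair _ _
    have hmn : npair m n ≤ g a := h1 ▸ right_le_npair _ _
    have hm := (left_le_npair m n).trans hmn
    have hn := (right_le_npair m n).trans hmn
    have hq : q ≤ n := h3 ▸ Nat.le_mul_of_pos_right q (Nat.succ_pos _)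
    exact ⟨k, by omega, m, by omega, n, by omega, q, by omega, h1, h2, h3⟩

theorem primrecPred_iff {α : Type} [Primcodable α] {p q : α → Prop} (hp : PrimrecPred p)
    (hq : PrimrecPred q) : PrimrecPred (fun a => p a ↔ q a) :=
  ((hp.and hq).or (hp.not.and hq.not)).of_eq fun a => by tauto

theorem nFin_iff {c : ℕ} : NFin c ↔ ∀ d < c, ¬ ∀ x < c, NCode x d ↔ NCode x c := by
  refine forall₂_congr fun d hd => not_congr ⟨fun h x _ => h x, fun h x => ?_⟩
  by_cases hx : x < c
  · exact h x hx
  · exact iff_of_false (fun h' => hx (h'.lt.trans hd)) (fun h' => hx h'.lt)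

theorem primrecPred_nFin {α : Type} [Primcodable α] {f : α → ℕ} (hf : Primrec f) :
    PrimrecPred (fun a => NFin (f a)) := by
  simp only [nFin_iff]
  exact primrecPred_forall_lt (by fun_prop) (PrimrecPred.not (primrecPred_forall_lt (by fun_prop)
    (primrecPred_iff (primrecPred_nCode (by fun_prop) (by fun_prop))
      (primrecPred_nCode (by fun_prop) (by fun_prop)))))

/-- Gödel's coding: with `m = k!` the moduli `m (x + 1) + 1` for `x < k` are pairwise coprime, so
the product of those with `x ∈ F` is divisible by no others. -/
theorem exists_nCode (F : Finset ℕ) : ∃ c, ∀ x, NCode x c ↔ x ∈ F := by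
  let k := F.sup id + 1
  let m := k.factorial
  have hlt : ∀ x ∈ F, x < k := fun x hx => Nat.lt_succ_of_le (Finset.le_sup (f := id) hx)
  have hcop : ∀ x y, x < k → y < k → x ≠ y →
      Nat.Coprime (m * (x + 1) + 1) (m * (y + 1) + 1) := by
    have : ∀ x y, y < k → x < y → Nat.Coprime (m * (x + 1) + 1) (m * (y + 1) + 1) := by
      intro x y hy hxy
      rw [Nat.mul_comm m, Nat.mul_comm m]
      exact Nat.coprime_mul_succ (Nat.dvd_factorial (by omega) (by omega))
    intro x y hx hy hne
    rcases lt_or_gt_of_ne hne with h | h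
    · exact this x y hy h
    · exact (this y x hx h).symm
  refine ⟨npair k (npair m (∏ x ∈ F, (m * (x + 1) + 1))), fun x => ⟨?_, fun hx => ?_⟩⟩
  · rintro ⟨k', m', n', q, h1, h2, h3⟩
    obtain ⟨hk, h1⟩ := npair_inj.1 h1
    obtain ⟨hm, h1⟩ := npair_inj.1 h1
    by_contra hx
    rw [← hm, ← h1] at h3
    have hc : Nat.Coprime (m * (x + 1) + 1) (∏ x ∈ F, (m * (x + 1) + 1)) :=
      Nat.Coprime.prod_right fun y hy => hcop x y (hk ▸ h2) (hlt y hy) fun h => hx (h ▸ hy)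
    have h4 := Nat.Coprime.eq_one_of_dvd hc (Dvd.intro_left q h3.symm)
    have h5 : 0 < m := Nat.factorial_pos k
    have h6 : 0 < m * (x + 1) := Nat.mul_pos h5 (Nat.succ_pos x)
    omega
  · obtain ⟨q, hq⟩ := Finset.dvd_prod_of_mem (fun x => m * (x + 1) + 1) hx
    exact ⟨_, _, _, q, rfl, hlt x hx, by rw [hq, Nat.mul_comm]⟩

/-- `c` is the canonical code of the set `F`. -/
def IsCodeOf (c : ℕ) (F : Set ℕ) : Prop := NFin c ∧ ∀ x, NCode x c ↔ x ∈ F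

theorem exists_isCodeOf {F : Set ℕ} (hF : F.Finite) : ∃ c, IsCodeOf c F := by
  classical
  have h : ∃ c, ∀ x, NCode x c ↔ x ∈ F := by
    obtain ⟨c, hc⟩ := exists_nCode hF.toFinset
    exact ⟨c, fun x => by rw [hc, Set.Finite.mem_toFinset]⟩
  refine ⟨Nat.find h, fun d hd hcon => Nat.find_min h hd fun x => ?_, Nat.find_spec h⟩
  rw [hcon, Nat.find_spec h]

theorem NFin.eq {c d : ℕ} (hc : NFin c) (hd : NFin d) (h : ∀ x, NCode x c ↔ NCode x d) :
    c = d := by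
  rcases lt_trichotomy c d with hlt | heq | hlt
  · exact absurd h (hd c hlt)
  · exact heq
  · exact absurd (fun x => (h x).symm) (hc d hlt)

theorem IsCodeOf.eq {c d : ℕ} {F : Set ℕ} (hc : IsCodeOf c F) (hd : IsCodeOf d F) : c = d :=
  hc.1.eq hd.1 fun x => (hc.2 x).trans (hd.2 x).symm

theorem isCodeOf_bit_iff {b c : ℕ} : IsCodeOf c {x | Bit b x} ↔
    NFin c ∧ ∀ x < b + c, NCode x c ↔ Bit b x := by
  refine and_congr_right fun _ => ⟨fun h x _ => h x, fun h x => ?_⟩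
  by_cases hx : x < b + c
  · exact h x hx
  · exact iff_of_false (fun h' => hx (by have := h'.lt; omega))
      (fun h' => hx (by have := Bit.lt h'; omega))

theorem primrecPred_isCodeOf_bit {α : Type} [Primcodable α] {f g : α → ℕ} (hf : Primrec f)
    (hg : Primrec g) : PrimrecPred (fun a => IsCodeOf (f a) {x | Bit (g a) x}) := by
  simp only [isCodeOf_bit_iff]
  exact .and (primrecPred_nFin hf) (primrecPred_forall_lt (by fun_prop)
    (primrecPred_iff (primrecPred_nCode (by fun_prop) (by fun_prop))
    (primrecPred_bit (by fun_prop) (by fun_prop))))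

theorem isCodeOf_string_iff {c : ℕ} {l : List Bool} :
    IsCodeOf c {x | l[x]? = some true} ↔
      NFin c ∧ ∀ x < l.length + c, NCode x c ↔ l[x]? = some true := by
  refine and_congr_right fun _ => ⟨fun h x _ => h x, fun h x => ?_⟩
  by_cases hx : x < l.length + c
  · exact h x hx
  · refine iff_of_false (fun h' => hx (by have := h'.lt; omega)) (fun h' => ?_)
    have := (List.getElem?_eq_some_iff.1 h').1
    omega

theorem primrecPred_isCodeOf_string {α : Type} [Primcodable α] {f : α → ℕ} {g : α → List Bool}
    (hf : Primrec f) (hg : Primrec g) :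
    PrimrecPred (fun a => IsCodeOf (f a) {x | (g a)[x]? = some true}) := by
  simp only [isCodeOf_string_iff]
  exact .and (primrecPred_nFin hf) (primrecPred_forall_lt (by fun_prop)
    (primrecPred_iff (primrecPred_nCode (by fun_prop) (by fun_prop))
    (primrecPred_eq (by fun_prop) (by fun_prop))))

end RevMath
namespace RevMath

/-! ### The model -/

/-- The `ω`-model with second-order part `S`. -/
def omegaModel (S : Set (Set ℕ)) (h : S.Nonempty) : L2Structure where
  M := ℕ
  zero := inferInstance
  one := inferInstance
  add := inferInstance
  mul := inferInstance
  lt := inferInstance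
  S := S
  S_nonempty := h

/-- `S` is closed under joins and Turing reducibility. -/
structure IsTuringIdeal (S : Set (Set ℕ)) : Prop where
  down : ∀ X ∈ S, ∀ Y, TuringLE Y X → Y ∈ S
  join : ∀ X ∈ S, ∀ Y ∈ S, join X Y ∈ S

section RCA

variable {S : Set (Set ℕ)} {hS : S.Nonempty}

theorem primrec_termVal {α : Type} [Primcodable α] (v : α → ℕ → ℕ)
    (hv : ∀ i, Primrec (fun a => v a i)) (t : L2Term) :
    Primrec (β := ℕ) (fun a => (omegaModel S hS).termVal (v a) t) := by
  induction t with
  | var i => exact hv i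
  | zero => exact Primrec.const 0
  | one => exact Primrec.const 1
  | add s t hs ht => exact primrec_add hs ht
  | mul s t hs ht => exact primrec_mul hs ht

/-- A formula mentions finitely many set variables, so one join of parameters decides it. Uniformity
in `α` carries the induction through bounded quantifiers, which pass from `α` to `α × ℕ`. -/
theorem exists_dec_sat (hI : IsTuringIdeal S) (V : ℕ → Set ℕ) (hV : ∀ j, V j ∈ S)
    (θ : BddFormula) : ∃ Z ∈ S, ∀ (α : Type) [Primcodable α] (v : α → ℕ → ℕ),
      (∀ i, Primrec (fun a => v a i)) → CE Z (fun a => (omegaModel S hS).Sat V (v a) θ) ∧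
        CE Z (fun a => ¬ (omegaModel S hS).Sat V (v a) θ) := by
  induction θ with
  | eq s t =>
    refine ⟨_, hV 0, fun α _ v hv => ?_⟩
    have := primrecPred_eq (primrec_termVal (hS := hS) v hv s) (primrec_termVal (hS := hS) v hv t)
    exact ⟨.prim this, .prim this.not⟩
  | lt s t =>
    refine ⟨_, hV 0, fun α _ v hv => ?_⟩
    have := primrecPred_lt (primrec_termVal (hS := hS) v hv s) (primrec_termVal (hS := hS) v hv t)
    exact ⟨.prim this, .prim this.not⟩
  | mem t j =>
    refine ⟨_, hV j, fun α _ v hv => ?_⟩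
    exact ⟨CE.mem (primrec_termVal (hS := hS) v hv t),
      CE.notMem (primrec_termVal (hS := hS) v hv t)⟩
  | neg φ ih =>
    obtain ⟨Z, hZ, h⟩ := ih
    refine ⟨Z, hZ, fun α _ v hv => ⟨(h α v hv).2, (h α v hv).1.of_iff fun a => ?_⟩⟩
    exact not_not
  | and φ ψ ih1 ih2 =>
    obtain ⟨Z, hZ, h⟩ := ih1
    obtain ⟨W, hW, k⟩ := ih2
    refine ⟨_, hI.join Z hZ W hW, fun α _ v hv => ?_⟩
    have hZ' := turingLE_join_left Z W
    have hW' := turingLE_join_right Z W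
    exact ⟨(hZ'.ce (h α v hv).1).and (hW'.ce (k α v hv).1),
      ((hZ'.ce (h α v hv).2).or (hW'.ce (k α v hv).2)).of_iff fun a => not_and_or⟩
  | ball i t φ ih =>
    obtain ⟨Z, hZ, h⟩ := ih
    refine ⟨Z, hZ, fun α _ v hv => ?_⟩
    have ht := primrec_termVal (hS := hS) v hv t
    have hu : ∀ j, Primrec (fun x : α × ℕ => Function.update (v x.1) i x.2 j) := fun j => by
      by_cases hj : j = i
      · subst hj
        simpa using Primrec.snd
      · simpa [hj] using (hv j).comp Primrec.fst
    obtain ⟨h1, h2⟩ := h (α × ℕ) (fun x => Function.update (v x.1) i x.2) hu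
    have hlt : PrimrecPred (fun x : α × ℕ => x.2 < ((omegaModel S hS).termVal (v x.1) t : ℕ)) :=
      primrecPred_lt (f := fun x : α × ℕ => x.2) (by fun_prop) (ht.comp Primrec.fst)
    refine ⟨.ball ht h1, (CE.ex (p := fun a (b : ℕ) =>
      b < ((omegaModel S hS).termVal (v a) t : ℕ) ∧
        ¬ (omegaModel S hS).Sat V (Function.update (v a) i b) φ)
      ((CE.prim hlt).and h2)).of_iff fun a => ?_⟩
    change ¬ (∀ b : ℕ, b < _ → _) ↔ _
    push Not
    rfl

theorem omegaModel_RCA0 (hI : IsTuringIdeal S) : (omegaModel S hS).RCA0 := by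
  refine ⟨⟨fun n => Nat.succ_ne_zero n, fun m n h => Nat.succ_injective h, fun m => Nat.add_zero m,
    fun m n => rfl, fun m => Nat.mul_zero m, fun m n => Nat.mul_succ m n, fun m => Nat.not_lt_zero m,
    fun m n => Nat.lt_succ_iff_lt_or_eq⟩, fun θ v V _ h0 hs n => ?_, fun θ η v V hV h => ?_⟩
  · change ℕ at n
    induction n with
    | zero => exact h0
    | succ n ih => exact hs n ih
  · have hassign : ∀ i, Primrec (β := ℕ)
        (fun x : ℕ × ℕ => (omegaModel S hS).assign v x.1 x.2 i) := by
      intro i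
      by_cases h1 : i = 1
      · subst h1
        exact Primrec.snd.of_eq fun x =>
            (Function.update_self (f := Function.update v 0 x.1) 1 x.2).symm
      · by_cases h0 : i = 0
        · subst h0
          exact Primrec.fst.of_eq fun x =>
            ((Function.update_of_ne zero_ne_one x.2 (Function.update v 0 x.1)).trans
              (Function.update_self 0 x.1 v)).symm
        · exact (Primrec.const (α := ℕ × ℕ) (show ℕ from v i)).of_eq fun x =>
            ((Function.update_of_ne h1 x.2 (Function.update v 0 x.1)).trans
              (Function.update_of_ne h0 x.1 v)).symm
    obtain ⟨Z, hZ, hθ⟩ := exists_dec_sat (hS := hS) hI V hV θ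
    obtain ⟨W, hW, hη⟩ := exists_dec_sat (hS := hS) hI V hV η
    refine hI.down _ (hI.join Z hZ W hW) _ (turingLE_iff.2 ⟨?_, ?_⟩)
    · exact CE.ex (β := ℕ) ((turingLE_join_left Z W).ce (hθ (ℕ × ℕ) _ hassign).1)
    -- The complement is enumerated through the `Π⁰₁` form.
    · refine (CE.ex (p := fun a b : ℕ => ¬ (omegaModel S hS).Sat V
        ((omegaModel S hS).assign v a b) η) ((turingLE_join_right Z W).ce (hη (ℕ × ℕ) _ hassign).2)).of_iff fun a => ?_
      refine (not_congr (h a)).trans ?_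
      exact not_forall

end RCA

/-! ### Construction of the ideal -/

theorem exists_countable_enumeration : ∃ E : ℕ → Set ℕ → Set ℕ,
    ∀ X Z, TuringLE X Z → ∃ e, E e Z = X := by
  obtain ⟨Φ, hΦ, hΦs⟩ := exists_functional_enumeration
  refine ⟨fun e Z => {n | ∃ s, Φ e (n, 0) (pre Z s)}, fun X Z h => ?_⟩
  obtain ⟨R, h1, -, h3⟩ := (turingLE_iff.1 h).1
  obtain ⟨e, he⟩ := hΦs (fun x l => R x.1 l)
    (primrecPred_comp h1 (f := fun x : (ℕ × ℕ) × List Bool => (x.1.1, x.2)) (by fun_prop))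
  refine ⟨e, ?_⟩
  change {n | ∃ s, Φ e (n, 0) (pre Z s)} = X
  rw [he]
  ext n
  exact (h3 n).symm

/-- Iterating problems that admit preservation of the hyperimmunity of the sets `A i` yields a
Turing ideal closed under these problems. -/
theorem exists_closed_ideal {A : ℕ → Set ℕ} {Z₀ : Set ℕ} (h₀ : ∀ i, Hyperimmune Z₀ (A i))
    (Sol : ℕ → Set ℕ → Set ℕ → Prop)
    (hSol : ∀ j Z X, (∀ i, Hyperimmune Z (A i)) → TuringLE X Z →
      ∃ Y, Sol j X Y ∧ ∀ i, Hyperimmune (join Y Z) (A i)) :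
    ∃ S : Set (Set ℕ), IsTuringIdeal S ∧ Z₀ ∈ S ∧ (∀ Z ∈ S, ∀ i, Hyperimmune Z (A i)) ∧
      ∀ j, ∀ X ∈ S, ∃ Y ∈ S, Sol j X Y := by
  obtain ⟨E, hE⟩ := exists_countable_enumeration
  let G : Type := {Z : Set ℕ // ∀ i, Hyperimmune Z (A i)}
  have step : ∀ (j : ℕ) (X : Set ℕ) (Z : G), ∃ Z' : G, TuringLE Z.1 Z'.1 ∧
      (TuringLE X Z.1 → ∃ Y, Sol j X Y ∧ TuringLE Y Z'.1) := by
    rintro j X ⟨Z, hZ⟩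
    by_cases hX : TuringLE X Z
    · obtain ⟨Y, h1, h2⟩ := hSol j Z X hZ hX
      exact ⟨⟨join Y Z, h2⟩, turingLE_join_right _ _, fun _ => ⟨Y, h1, turingLE_join_left _ _⟩⟩
    · exact ⟨⟨Z, hZ⟩, .refl Z, fun h => absurd h hX⟩
  choose next hn1 hn2 using step
  -- Stage `k = ⟨m, ⟨e, j⟩⟩` treats problem `j` for the `e`-th set obtained from `Z m`, where `m ≤
  -- k`. The recursion refers to all earlier values, so `c k` below stores the whole history.
  obtain ⟨Z, hZ0, hZsucc⟩ : ∃ Z : ℕ → G, (Z 0).1 = Z₀ ∧ ∀ k, Z (k + 1) =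
      next k.unpair.2.unpair.2 (E k.unpair.2.unpair.1 (Z k.unpair.1).1) (Z k) := by
    let c : ℕ → ℕ → G := fun k => Nat.rec (fun _ => ⟨Z₀, h₀⟩) (fun k prev =>
      let Z := next k.unpair.2.unpair.2 (E k.unpair.2.unpair.1 (prev k.unpair.1).1) (prev k)
      fun i => if i ≤ k then prev i else Z) k
    have hstable : ∀ k m i, i ≤ k → k ≤ m → c m i = c k i := by
      intro k m i hik hkm
      induction m, hkm using Nat.le_induction with
      | base => rfl
      | succ m hm ih =>
        change (if i ≤ m then c m i else _) = _
        rw [if_pos (hik.trans hm), ih]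
    have hc : ∀ k, c (k + 1) (k + 1) = next k.unpair.2.unpair.2
        (E k.unpair.2.unpair.1 (c k k.unpair.1).1) (c k k) := by
      intro k
      change (if k + 1 ≤ k then c k (k + 1) else _) = _
      rw [if_neg (by omega)]
    refine ⟨fun k => c k k, rfl, fun k => ?_⟩
    change c (k + 1) (k + 1) = _
    rw [hc, hstable k.unpair.1 k k.unpair.1 le_rfl (Nat.unpair_left_le k)]
  have hmono : ∀ k m, k ≤ m → TuringLE (Z k).1 (Z m).1 := by
    intro k m hkm
    induction m, hkm using Nat.le_induction with
    | base => exact .refl _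
    | succ m _ ih =>
      refine ih.trans ?_
      rw [hZsucc]
      exact hn1 _ _ _
  refine ⟨{X | ∃ k, TuringLE X (Z k).1}, ⟨?_, ?_⟩, ⟨0, hZ0 ▸ .refl _⟩, ?_, ?_⟩
  · rintro X ⟨k, hX⟩ Y hY
    exact ⟨k, hY.trans hX⟩
  · rintro X ⟨k, hX⟩ Y ⟨m, hY⟩
    exact ⟨max k m, (hX.trans (hmono _ _ (le_max_left _ _))).join
      (hY.trans (hmono _ _ (le_max_right _ _)))⟩
  · rintro X ⟨k, hX⟩ i
    exact ((Z k).2 i).mono hX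
  · rintro j X ⟨m, hX⟩
    obtain ⟨e, rfl⟩ := hE X _ hX
    have hk := hZsucc (Nat.pair m (Nat.pair e j))
    have h2 := hn2 j (E e (Z m).1) (Z (Nat.pair m (Nat.pair e j)))
      (hX.trans (hmono _ _ (Nat.left_le_pair _ _)))
    simp only [Nat.unpair_pair] at hk
    rw [← hk] at h2
    obtain ⟨Y, h3, h4⟩ := h2
    exact ⟨Y, ⟨_, h4⟩, h3⟩

end RevMath
namespace RevMath

/-! ### The problems solved in the model -/

/-- All but finitely many elements of `Y` are in `R`, or all but finitely many are not. -/
def AlmostDecides (Y R : Set ℕ) : Prop :=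
  (∃ N, ∀ y ∈ Y, N ≤ y → y ∈ R) ∨ (∃ N, ∀ y ∈ Y, N ≤ y → y ∉ R)

/-- The set `Y` is the graph of the function sending `i` to the code of the `i`-th block of an
infinite `L`-grouping for the coloring `f`. -/
def NGrouping (L f Y : Set ℕ) : Prop :=
  (∀ i, ∃! c, npair i c ∈ Y) ∧
  (∀ i c, npair i c ∈ Y → (NFin c ∧ c ∈ L) ∧ ∃ x, NCode x c) ∧
  (∀ i j c d, i < j → npair i c ∈ Y → npair j d ∈ Y →
    (∀ x y, NCode x c → NCode y d → x < y) ∧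
    ((∀ x y, NCode x c → NCode y d → npair x y ∈ f) ∨
      (∀ x y, NCode x c → NCode y d → npair x y ∉ f)))

/-- `T` is a tree of codes of binary strings. -/
def NTree (T : Set ℕ) : Prop :=
  (∀ s ∈ T, ∃ l c, s = npair l c ∧ NFin c ∧ ∀ x, NCode x c → x < l) ∧
  (∀ l c l' c', npair l c ∈ T → l' < l → NFin c' →
    (∀ x, NCode x c' ↔ NCode x c ∧ x < l') → npair l' c' ∈ T)

section

variable {Z : Set ℕ} {A : ℕ → Set ℕ}

theorem TuringLE.section_npair {f : Set ℕ} (hf : TuringLE f Z) (i : ℕ) :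
    TuringLE {y | npair i y ∈ f} Z :=
  turingLE_iff.2 ⟨hf.mem (f := fun y => npair i y) (by fun_prop),
    hf.notMem (f := fun y => npair i y) (by fun_prop)⟩

/-- A constant coloring makes stability and transitivity trivial and leaves cohesiveness. -/
theorem exists_cohesive (hA : ∀ i, Hyperimmune Z (A i)) {r : ℕ → Set ℕ}
    (hr : ∀ i, TuringLE (r i) Z) : ∃ Y, Good Z A Y ∧ ∀ i, AlmostDecides Y (r i) := by
  obtain ⟨Y, -, hY, -, h⟩ := (good_univ hA).exists_transitive_cohesive (f := fun _ _ => False)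
    (.const False) ((CE.const True).of_iff fun _ => by simp)
    (fun _ _ => Or.inr ⟨0, fun _ _ _ => id⟩) hr
  exact ⟨Y, hY, h⟩

/-- On a set cohesive for the rows of `f` the coloring is stable. -/
theorem exists_transitive (hA : ∀ i, Hyperimmune Z (A i)) {f : Set ℕ} (hf : TuringLE f Z) :
    ∃ Y, Good Z A Y ∧ Trans (fun x y => npair x y ∈ f) Y := by
  obtain ⟨C, hC, h⟩ := exists_cohesive hA hf.section_npair
  obtain ⟨Y, -, hY, hT, -⟩ := hC.exists_transitive_cohesive (f := fun x y => npair x y ∈ f)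
    (hf.mem (by fun_prop)) (hf.notMem (by fun_prop)) (fun x _ => h x) (r := fun _ => f)
    (fun _ => hf)
  exact ⟨Y, hY, hT⟩

/-- Paths form a `Π⁰₁(Z)` class. If it were empty, compactness would bound the height of `T`, making
`T` finite; so the basis theorem applies. -/
theorem NTree.exists_path (hA : ∀ i, Hyperimmune Z (A i)) {T : Set ℕ} (hTZ : TuringLE T Z)
    (hT : NTree T) (hinf : T.Infinite) :
    ∃ P, (∀ l, ∃ c, NFin c ∧ (∀ x, NCode x c ↔ x ∈ P ∧ x < l) ∧ npair l c ∈ T) ∧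
      ∀ i, Hyperimmune (join P Z) (A i) := by
  let U : List Bool → Prop := fun l =>
    ∃ c, IsCodeOf c {x | l[x]? = some true} ∧ npair l.length c ∉ T
  have hU : CE Z U := .ex (.and (.prim (primrecPred_isCodeOf_string (f := fun x : List Bool × ℕ =>
    x.2) (g := fun x => x.1) (by fun_prop) (by fun_prop)))
    (hTZ.notMem (f := fun x : List Bool × ℕ => npair x.1.length x.2) (by fun_prop)))
  have hset : ∀ (P : Set ℕ) s, {x | (pre P s)[x]? = some true} = {x | x ∈ P ∧ x < s} := by
    intro P s
    ext x
    exact pre_getElem?_true.trans and_comm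
  have hne : ∃ C : Set ℕ, ∀ s, ¬ U (pre C s) := by
    by_contra! hcon
    obtain ⟨k, hk⟩ := exists_length_of_forall_exists U hcon
    have hlt : ∀ l c, NFin c → (∀ x, NCode x c → x < l) → npair l c ∈ T → l < k := by
      intro l c hc hcl hlc
      by_contra! hkl
      obtain ⟨j, hj, c', hc', hc'T⟩ := hk (pre {x | NCode x c} k) (length_pre _ _)
      rw [take_pre _ hj, length_pre] at hc'T
      rw [take_pre _ hj, hset] at hc'
      rcases (hj.trans hkl).lt_or_eq with hjl | rfl
      · exact hc'T (hT.2 l c j c' hlc hjl hc'.1 hc'.2)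
      · have : c' = c := hc'.1.eq hc fun x => (hc'.2 x).trans ⟨fun h => h.1, fun h => ⟨h, hcl x h⟩⟩
        exact hc'T (this ▸ hlc)
    choose cd hcd using fun F : Finset ℕ => exists_isCodeOf F.finite_toSet
    classical
    refine hinf ((((Finset.range k ×ˢ (Finset.range k).powerset).image
      fun p => npair p.1 (cd p.2)).finite_toSet).subset fun s hs => ?_)
    obtain ⟨l, c, rfl, hc, hcl⟩ := hT.1 s hs
    have hlk := hlt l c hc hcl hs
    refine Finset.mem_coe.2 (Finset.mem_image.2 ⟨(l, (Finset.range k).filter (NCode · c)), ?_, ?_⟩)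
    · simp [hlk]
    · refine congrArg (npair l) ((hcd _).1.eq hc fun x => ((hcd _).2 x).trans ?_)
      simp only [Finset.coe_filter, Finset.mem_range, Set.mem_ofPred_eq, and_iff_right_iff_imp]
      exact fun h => (hcl x h).trans hlk
  obtain ⟨P, hP, hPA⟩ := hyperimmuneFree_basis hU hne
  refine ⟨P, fun l => ?_, fun i => hPA _ (hA i)⟩
  obtain ⟨c, hc⟩ := exists_isCodeOf (F := {x | x ∈ P ∧ x < l})
    ((Set.finite_Iio l).subset fun x hx => hx.2)
  refine ⟨c, hc.1, hc.2, ?_⟩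
  by_contra h
  exact hP l ⟨c, by rwa [hset], by rwa [length_pre]⟩

/-- Translates binary indices into the codes used inside the structure. Uniqueness of the code of
each block makes the complement enumerable too. -/
theorem turingLE_graph_codes {F : ℕ → Finset ℕ} {c : ℕ → ℕ}
    (hc : ∀ i, IsCodeOf (c i) (F i)) :
    TuringLE {n | ∃ i, n = npair i (c i)} (seqCode F) := by
  have hiff : ∀ i b d, Nat.pair i b ∈ seqCode F → (IsCodeOf d {x | Bit b x} ↔ d = c i) := by
    rintro i b d ⟨i', h⟩
    obtain ⟨rfl, rfl⟩ := Nat.pair_eq_pair.1 h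
    have : {x | Bit (finCode (F i)) x} = (F i : Set ℕ) := Set.ext fun x => bit_finCode
    rw [this]
    exact ⟨fun h => h.eq (hc i), fun h => h ▸ hc i⟩
  have hmem : ∀ i, Nat.pair i (finCode (F i)) ∈ seqCode F := fun i => ⟨i, rfl⟩
  have hpair : ∀ n, ¬ (∃ i < n + 1, ∃ d < n + 1, n = npair i d) ∨ ∃ i d, n = npair i d := by
    intro n
    by_cases h : ∃ i < n + 1, ∃ d < n + 1, n = npair i d
    · obtain ⟨i, -, d, -, h⟩ := h
      exact Or.inr ⟨i, d, h⟩
    · exact Or.inl h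
  have heq : PrimrecPred (fun x : ℕ × (ℕ × ℕ × ℕ) => x.1 = npair x.2.1 x.2.2.1) :=
    primrecPred_eq (by fun_prop) (by fun_prop)
  have hseq : CE (seqCode F) (fun x : ℕ × (ℕ × ℕ × ℕ) => Nat.pair x.2.1 x.2.2.2 ∈ seqCode F) :=
    CE.mem (by fun_prop)
  have hcode : PrimrecPred (fun x : ℕ × (ℕ × ℕ × ℕ) =>
      IsCodeOf x.2.2.1 {y | Bit x.2.2.2 y}) :=
    primrecPred_isCodeOf_bit (by fun_prop) (by fun_prop)
  have hnot : PrimrecPred (fun n : ℕ => ∃ i < n + 1, ∃ d < n + 1, n = npair i d) :=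
    primrecPred_exists_lt (by fun_prop) (primrecPred_exists_lt (by fun_prop)
      (primrecPred_eq (by fun_prop) (by fun_prop)))
  refine turingLE_iff.2 ⟨(CE.ex (p := fun n (x : ℕ × ℕ × ℕ) => n = npair x.1 x.2.1 ∧
      Nat.pair x.1 x.2.2 ∈ seqCode F ∧ IsCodeOf x.2.1 {y | Bit x.2.2 y})
      ((CE.prim heq).and (hseq.and (.prim hcode)))).of_iff fun n => ⟨?_, ?_⟩,
    ((CE.prim hnot.not).or (CE.ex (p := fun n (x : ℕ × ℕ × ℕ) => n = npair x.1 x.2.1 ∧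
      Nat.pair x.1 x.2.2 ∈ seqCode F ∧ ¬ IsCodeOf x.2.1 {y | Bit x.2.2 y})
      ((CE.prim heq).and (hseq.and (.prim hcode.not))))).of_iff fun n => ⟨?_, ?_⟩⟩
  · rintro ⟨i, rfl⟩
    exact ⟨(i, c i, finCode (F i)), rfl, hmem i, (hiff i _ _ (hmem i)).2 rfl⟩
  · rintro ⟨⟨i, d, b⟩, rfl, h1, h2⟩
    exact ⟨i, by rw [(hiff i b d h1).1 h2]⟩
  · intro hn
    refine (hpair n).imp id ?_
    rintro ⟨i, d, rfl⟩
    refine ⟨(i, d, finCode (F i)), rfl, hmem i, fun h => hn ⟨i, ?_⟩⟩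
    rw [(hiff i _ d (hmem i)).1 h]
  · rintro (h | ⟨⟨i, d, b⟩, rfl, h1, h2⟩) ⟨i', h'⟩
    · subst h'
      exact h ⟨i', Nat.lt_succ_of_le (left_le_npair _ _), c i',
        Nat.lt_succ_of_le (right_le_npair _ _), rfl⟩
    · dsimp only at h1 h2 h'
      obtain ⟨rfl, hd⟩ := npair_inj.1 h'
      exact h2 ((hiff i b d h1).2 hd)

theorem exists_nGrouping (hA : ∀ i, Hyperimmune Z (A i)) {L f C : Set ℕ} (hL : TuringLE L Z)
    (hf : TuringLE f Z) (hC : TuringLE C Z) (hinf : C.Infinite)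
    (hst : ∀ i, AlmostDecides C {y | npair i y ∈ f}) :
    ∃ Y, (NGrouping L f Y ∨ (Y.Infinite ∧ ∀ c, NFin c → c ∈ L → (∃ x, NCode x c) →
      ¬ ∀ x, NCode x c → x ∈ Y)) ∧ ∀ i, Hyperimmune (join Y Z) (A i) := by
  have hL' : CE Z (· ∈ {b | ∃ c, c ∈ L ∧ IsCodeOf c {x | Bit b x}}) :=
    .ex (.and (hL.mem (f := fun x : ℕ × ℕ => x.2) (by fun_prop))
      (.prim (primrecPred_isCodeOf_bit (by fun_prop) (by fun_prop))))
  have hgood : Good Z A C := ⟨hinf, fun i => (hA i).mono (hC.join (.refl Z))⟩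
  rcases hgood.exists_grouping (f := fun x y => npair x y ∈ f) (hf.mem (by fun_prop))
    (hf.notMem (by fun_prop)) (fun x _ => hst x) hL' with ⟨F, h1, h2, h3⟩ | ⟨W, -, h1, h2⟩
  · choose c hc using fun i => exists_isCodeOf (F i).finite_toSet
    have hY : ∀ i d, npair i d ∈ {n | ∃ i, n = npair i (c i)} ↔ d = c i := by
      intro i d
      constructor
      · rintro ⟨i', h⟩
        obtain ⟨rfl, rfl⟩ := npair_inj.1 h
        rfl
      · rintro rfl
        exact ⟨i, rfl⟩
    refine ⟨{n | ∃ i, n = npair i (c i)}, Or.inl ⟨fun i => ⟨c i, (hY _ _).2 rfl,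
      fun d hd => (hY _ _).1 hd⟩, fun i d hd => ?_, fun i j d e hij hd he => ?_⟩, fun i => ?_⟩
    · obtain rfl := (hY _ _).1 hd
      obtain ⟨⟨d, hd, hcode⟩, x, hx⟩ := h1 i
      have : {x | Bit (finCode (F i)) x} = (F i : Set ℕ) := Set.ext fun x => bit_finCode
      rw [this] at hcode
      exact ⟨⟨(hc i).1, (hc i).eq hcode ▸ hd⟩, x, ((hc i).2 x).2 hx⟩
    · obtain rfl := (hY _ _).1 hd
      obtain rfl := (hY _ _).1 he
      simp only [(hc _).2]
      exact ⟨fun x y hx hy => (h2 i j hij).1 x hx y hy, (h2 i j hij).2.imp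
        (fun h x y hx hy => h x hx y hy) (fun h x y hx hy => h x hx y hy)⟩
    · exact (h3 i).mono (((turingLE_graph_codes hc).trans (turingLE_join_left _ _)).join
        (turingLE_join_right _ _))
  · refine ⟨W, Or.inr ⟨h1.1, fun c hc hcL ⟨x, hx⟩ hcW => ?_⟩, h1.2⟩
    obtain ⟨b, hb⟩ : ∃ b, ∀ x, Bit b x ↔ NCode x c := by
      classical
      refine ⟨finCode ((Finset.range c).filter (NCode · c)), fun x => ?_⟩
      rw [bit_finCode, Finset.mem_filter, Finset.mem_range]
      exact ⟨fun h => h.2, fun h => ⟨h.lt, h⟩⟩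
    exact h2 b ⟨c, hcL, hc, fun x => (hb x).symm⟩ ⟨x, (hb x).2 hx⟩ fun x hx => hcW x ((hb x).1 hx)

end

theorem join_inj {X Y X' Y' : Set ℕ} (h : join X Y = join X' Y') : X = X' ∧ Y = Y' := by
  constructor
  · ext n
    have := Set.ext_iff.1 h (2 * n)
    simpa [mem_join] using this
  · ext n
    have := Set.ext_iff.1 h (2 * n + 1)
    have h2 : (2 * n + 1) / 2 = n := by omega
    simpa [mem_join, h2, Nat.add_mod] using this

/-- There is a Turing ideal preserving the hyperimmunity of the sets `A i` which is closed under
solutions of the combinatorial principles. -/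
theorem exists_ideal {A : ℕ → Set ℕ} {Z₀ : Set ℕ} (h₀ : ∀ i, Hyperimmune Z₀ (A i)) :
    ∃ S : Set (Set ℕ), IsTuringIdeal S ∧ Z₀ ∈ S ∧ (∀ Z ∈ S, ∀ i, Hyperimmune Z (A i)) ∧
      (∀ X ∈ S, ∃ Y ∈ S, Y.Infinite ∧ ∀ i, AlmostDecides Y {y | npair i y ∈ X}) ∧
      (∀ X ∈ S, ∃ Y ∈ S, Y.Infinite ∧ Trans (fun x y => npair x y ∈ X) Y) ∧
      (∀ X ∈ S, NTree X → X.Infinite → ∃ Y ∈ S,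
        ∀ l, ∃ c, NFin c ∧ (∀ x, NCode x c ↔ x ∈ Y ∧ x < l) ∧ npair l c ∈ X) ∧
      (∀ L ∈ S, ∀ f ∈ S, ∀ C ∈ S, C.Infinite → (∀ i, AlmostDecides C {y | npair i y ∈ f}) →
        ∃ Y ∈ S, NGrouping L f Y ∨ (Y.Infinite ∧ ∀ c, NFin c → c ∈ L → (∃ x, NCode x c) →
          ¬ ∀ x, NCode x c → x ∈ Y)) := by
  obtain ⟨S, h1, h2, h3, h4⟩ := exists_closed_ideal h₀ (fun j X Y => match j with
    | 0 => Y.Infinite ∧ ∀ i, AlmostDecides Y {y | npair i y ∈ X}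
    | 1 => Y.Infinite ∧ Trans (fun x y => npair x y ∈ X) Y
    | 2 => NTree X → X.Infinite →
        ∀ l, ∃ c, NFin c ∧ (∀ x, NCode x c ↔ x ∈ Y ∧ x < l) ∧ npair l c ∈ X
    -- The instance of the grouping problem also contains a set `C` along which `f` is stable.
    | _ => ∀ L f C, X = join L (join f C) → C.Infinite →
        (∀ i, AlmostDecides C {y | npair i y ∈ f}) →
        NGrouping L f Y ∨ (Y.Infinite ∧ ∀ c, NFin c → c ∈ L → (∃ x, NCode x c) →
          ¬ ∀ x, NCode x c → x ∈ Y)) fun j Z X hZ hX => by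
    have htriv : ∀ i, Hyperimmune (join X Z) (A i) := fun i => (hZ i).mono (hX.join (.refl Z))
    match j with
    | 0 =>
      obtain ⟨Y, h, h'⟩ := exists_cohesive hZ hX.section_npair
      exact ⟨Y, ⟨h.1, h'⟩, h.2⟩
    | 1 =>
      obtain ⟨Y, h, h'⟩ := exists_transitive hZ hX
      exact ⟨Y, ⟨h.1, h'⟩, h.2⟩
    | 2 =>
      by_cases hT : NTree X ∧ X.Infinite
      · obtain ⟨P, h, h'⟩ := hT.1.exists_path hZ hX hT.2
        exact ⟨P, fun _ _ => h, h'⟩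
      · exact ⟨X, fun h h' => absurd ⟨h, h'⟩ hT, htriv⟩
    | k + 3 =>
      by_cases h : ∃ L f C, X = join L (join f C) ∧ C.Infinite ∧
        ∀ i, AlmostDecides C {y | npair i y ∈ f}
      · obtain ⟨L, f, C, rfl, h1, h2⟩ := h
        have hfC := (turingLE_join_right _ _).trans hX
        obtain ⟨Y, h3, h4⟩ := exists_nGrouping hZ ((turingLE_join_left _ _).trans hX)
          ((turingLE_join_left _ _).trans hfC) ((turingLE_join_right _ _).trans hfC) h1 h2
        refine ⟨Y, fun L' f' C' heq _ _ => ?_, h4⟩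
        obtain ⟨rfl, heq'⟩ := join_inj heq
        obtain ⟨rfl, -⟩ := join_inj heq'
        exact h3
      · exact ⟨X, fun L f C h1 h2 h3 => absurd ⟨L, f, C, h1, h2, h3⟩ h, htriv⟩
  refine ⟨S, h1, h2, h3, h4 0, h4 1, fun X hX hT hinf => ?_, fun L hL f hf C hC hinf hst => ?_⟩
  · obtain ⟨Y, hY, h⟩ := h4 2 X hX
    exact ⟨Y, hY, h hT hinf⟩
  · obtain ⟨Y, hY, h⟩ := h4 3 _ (h1.join L hL _ (h1.join f hf C hC))
    exact ⟨Y, hY, h L f C rfl hinf hst⟩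

/-! ### Failure of the ascending descending sequence principle -/

/-- A `Z`-hyperimmune set has no infinite `Z`-computable subset. -/
theorem Hyperimmune.not_subset {Z B H : Set ℕ} (hB : Hyperimmune Z B) (hH : TuringLE H Z)
    (hinf : H.Infinite) : ¬ H ⊆ B := by
  intro hHB
  -- `v` bounds `n + 1` distinct elements of `H`, which forces `p_B(n) ≤ v` if `H ⊆ B`.
  let T : ℕ → ℕ → Prop := fun n v => ∃ w : List ℕ, w.length = n + 1 ∧
    (∀ i < w.length, ∀ j < i, w.getD j 0 ≠ w.getD i 0) ∧ (∀ x ∈ w, x ≤ v) ∧ ∀ x ∈ w, x ∈ H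
  have hT : CE Z (fun x : ℕ × ℕ => T x.1 x.2) := by
    refine .ex (.and (.prim (primrecPred_eq (by fun_prop) (by fun_prop))) (.and (.prim ?_)
      (.and (.ballMem (by fun_prop) (.prim ?_)) (.ballMem (by fun_prop) (hH.mem (by fun_prop))))))
    · exact primrecPred_forall_lt (by fun_prop) (primrecPred_forall_lt (by fun_prop)
        (primrecPred_eq (by fun_prop) (by fun_prop)).not)
    · exact primrecPred_le (by fun_prop) (by fun_prop)
  obtain ⟨n, v, ⟨w, hw, hinj, hv, hwH⟩, hlt⟩ := (hyperimmune_iff.1 hB).2 T hT fun n => by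
    obtain ⟨F, hF, hcard⟩ := hinf.exists_subset_card_eq (n + 1)
    refine ⟨F.sup id, F.toList, by simpa using hcard, fun i hi j hj h => ?_, fun x hx =>
      Finset.le_sup (f := id) (Finset.mem_toList.1 hx), fun x hx => hF (Finset.mem_toList.1 hx)⟩
    rw [List.getD_eq_getElem _ _ hi, List.getD_eq_getElem _ _ (hj.trans hi),
      F.nodup_toList.getElem_inj_iff] at h
    omega
  classical
  have hmemw : ∀ i < w.length, w.getD i 0 ∈ w := fun i hi => by
    rw [List.getD_eq_getElem _ _ hi]
    exact List.getElem_mem hi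
  have hcount : n < Nat.count (· ∈ B) (v + 1) := by
    rw [Nat.count_eq_card_filter_range, ← Nat.succ_le_iff, Nat.succ_eq_add_one, ← hw,
      ← Finset.card_range w.length]
    refine Finset.card_le_card_of_injOn (fun i => w.getD i 0) (fun i hi => ?_) ?_
    · have := hmemw i (by simpa using hi)
      simp only [Finset.coe_filter, Finset.mem_range, Set.mem_ofPred_eq]
      exact ⟨Nat.lt_succ_of_le (hv _ this), hHB (hwH _ this)⟩
    · intro i hi j hj hij
      rw [Finset.coe_range, Set.mem_Iio] at hi hj
      rcases lt_trichotomy i j with h | h | h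
      · exact absurd hij (hinj j hj i h)
      · exact h
      · exact absurd hij.symm (hinj i hi j h)
  have := Nat.nth_lt_of_lt_count hcount
  omega

theorem npair_mem_orderCode {t : ℕ → ℚ} {x y : ℕ} : npair x y ∈ orderCode t ↔ t x < t y := by
  constructor
  · rintro ⟨x', y', h, hxy⟩
    obtain ⟨rfl, rfl⟩ := npair_inj.1 h
    exact hxy
  · exact fun h => ⟨x, y, rfl, h⟩

theorem unbdd_iff {S : Set (Set ℕ)} {hS : S.Nonempty} {X : Set ℕ} :
    (omegaModel S hS).Unbdd X ↔ X.Infinite :=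
  ⟨fun h => Set.infinite_of_forall_exists_gt h, fun h b => h.exists_gt b⟩

theorem exists_model_not_ADS : ∃ N : L2Structure,
    N.RCA0 ∧ N.GP22 ∧ N.COH ∧ N.EM ∧ N.WKL ∧ ¬ N.ADS := by
  obtain ⟨t, ht, hlow, hup⟩ := exists_generic_order
  obtain ⟨S, hI, htS, hS, hcoh, hem, hwkl, hgp⟩ := exists_ideal
    (A := fun i => if i = 0 then lowerPart t else (lowerPart t)ᶜ) (Z₀ := orderCode t) fun i => by
      split_ifs <;> assumption
  refine ⟨omegaModel S ⟨_, htS⟩, omegaModel_RCA0 hI, ?_, ?_, ?_, ?_, ?_⟩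
  · intro L hL hlarge f hf
    -- A set cohesive for the rows of `f` reduces the grouping principle to its stable case.
    obtain ⟨C, hC, hinf, hst⟩ := hcoh f hf
    obtain ⟨Y, hY, h | ⟨hYinf, h⟩⟩ := hgp L hL f hf C hC hinf hst
    · exact ⟨Y, hY, h⟩
    · exfalso
      obtain ⟨c, ⟨hc, hcL⟩, hcY⟩ := hlarge.1 Y hY (unbdd_iff.2 hYinf)
      by_cases hne : ∃ x, NCode x c
      · exact h c hc hcL hne hcY
      -- The witness excludes nonempty blocks only. If `c` codes the empty set, closure under
      -- supersets puts a singleton from `Y` into `L`.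
      · obtain ⟨y, hy⟩ := hYinf.nonempty
        obtain ⟨d, hd⟩ := exists_isCodeOf (Set.finite_singleton y)
        have hdL := hlarge.2 c d ⟨hc, hcL⟩ hd.1 fun x hx => absurd ⟨x, hx⟩ hne
        refine h d hd.1 hdL.2 ⟨y, (hd.2 y).2 rfl⟩ fun x hx => ?_
        rw [(hd.2 x).1 hx]
        exact hy
  · intro R hR
    obtain ⟨C, hC, hinf, h⟩ := hcoh R hR
    exact ⟨C, hC, unbdd_iff.2 hinf, fun i => (h i).imp
      (fun ⟨N, hN⟩ => ⟨N, fun x hx hlt => hN x hx (le_of_lt (α := ℕ) hlt)⟩)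
      (fun ⟨N, hN⟩ => ⟨N, fun x hx hlt => hN x hx (le_of_lt (α := ℕ) hlt)⟩)⟩
  · intro f hf
    obtain ⟨H, hH, hinf, h⟩ := hem f hf
    exact ⟨H, hH, unbdd_iff.2 hinf, h⟩
  · intro T hT htree hinf
    exact hwkl T hT htree (unbdd_iff.1 hinf)
  · intro hads
    obtain ⟨H, hH, hinf, hhom⟩ := hads (orderCode t) htS fun x _ y _ z _ _ _ =>
      ⟨fun h1 h2 => npair_mem_orderCode.2
        ((npair_mem_orderCode.1 h1).trans (npair_mem_orderCode.1 h2)),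
      fun h1 h2 h3 => (npair_mem_orderCode.1 h3).not_ge
        ((not_lt.1 (mt npair_mem_orderCode.2 h2)).trans (not_lt.1 (mt npair_mem_orderCode.2 h1)))⟩
    replace hinf : Set.Infinite (α := ℕ) H := unbdd_iff.1 hinf
    -- A homogeneous set of color 1 lies in the lower part and one of color 0 in its complement:
    -- otherwise the color of some `x` with infinitely many `y` in `H` contradicts its limit.
    rcases hhom with h | h
    · refine Hyperimmune.not_subset (hS H hH 0) (.refl H) hinf fun x hx => ?_
      rw [if_pos rfl]
      by_contra hxl
      obtain ⟨N, hN⟩ := ht x hxl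
      obtain ⟨y, hy, hlt⟩ := hinf.exists_gt (max x N)
      exact hN y (le_trans (le_max_right _ _) hlt.le)
        (npair_mem_orderCode.1 (h x hx y hy ((le_max_left _ _).trans_lt hlt)))
    · refine Hyperimmune.not_subset (hS H hH 1) (.refl H) hinf fun x hx => ?_
      rw [if_neg one_ne_zero]
      rintro ⟨N, hN⟩
      obtain ⟨y, hy, hlt⟩ := hinf.exists_gt (max x N)
      exact h x hx y hy ((le_max_left _ _).trans_lt hlt)
        (npair_mem_orderCode.2 (hN y (le_trans (le_max_right _ _) hlt.le)))

end RevMath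

/-- (1) `SGP²₂` admits preservation of hyperimmunity. (2) `RCA₀ + GP²₂ + COH + EM + WKL₀` does not
imply `ADS`: it is not the case that every model of the former satisfies the latter. -/
theorem mainTheorem12 :
    RevMath.SGP22.PreservesHyperimmunity ∧
    ¬ (∀ N : RevMath.L2Structure,
        N.RCA0 → N.GP22 → N.COH → N.EM → N.WKL → N.ADS) := by
  refine ⟨RevMath.SGP22_preservesHyperimmunity, fun h => ?_⟩
  obtain ⟨N, h1, h2, h3, h4, h5, h6⟩ := RevMath.exists_model_not_ADS
  exact h6 (h N h1 h2 h3 h4 h5)
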